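/- **Setting.** Let $d\ge 1$ and let $(X,D,Y(0),Y(1))$ take values in $\mathbb R^d\times\{0,1\}\times\mathbb R^2$. Put $Y=Y(D)$, $e(x)=P(D=1\mid X=x)$, $\mu_\omega(x)=E[Y\mid X=x,D=\omega]$, $U_\omega=Y(\omega)-\mu_\omega(X)$, and let $\mathcal S$ be the support of $X$. Let $(X_i,D_i,Y_i)_{i\le n}$ be i.i.d. copies of $(X,D,Y)$. Assume (A): for almost every $x$, $D$ is independent of $(Y(0),Y(1))$ given $X=x$; for some $\eta>0$, $\eta<e(x)<1-\eta$ for almost every $x$; $E[U_\omega^2\mid X=x]$ is bounded over almost every $x$ and $\omega\in\{0,1\}$; and $E[\mu_\omega(X)^2]<\infty$. **Forest.** A tree is a finite recursive partition of $\mathbb R^d$ by axis-aligned splits $\{x_p\le c\}$, $\{x_p>c\}$; $L(x)$ is its leaf containing $x$. A base learner (it may depend on $n$) builds a tree from a finite data set of pairs $(X_i,Y_i)$, regardless of their order, and an independent random seed, measurably, in such a way that every leaf contains at least one data point; $|L_t|$ is the number of data points in the leaf $L_t$. For subsample sizes $s=s_n\ge1$ and numbers of trees $B=B_n\ge 1$,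 given the sample draw, independently for $b\le B$ and $\omega\in\{0,1\}$, a subset $\mathcal I_b^\omega$ of $\{i:D_i=\omega\}$ of size $s$ uniformly without replacement (all of $\{i:D_i=\omega\}$ if it has fewer than $s$ elements), and let $L_b^\omega(x)$ be the leaf containing $x$ of the tree built on $\{(X_i,Y_i)\}_{i\in\mathcal I_b^\omega}$. The weights of random forest imputation are, for $D_i+D_j=1$, $$w_{i\leftarrow j}=\frac1B\sum_{b=1}^B\frac{1\big(j\in\mathcal I_b^{1-D_i},\ X_j\in L_b^{1-D_i}(X_i)\big)}{\big|\{k\in\mathcal I_b^{1-D_i}:X_k\in L_b^{1-D_i}(X_i)\}\big|}.$$ The trees are *honest* if the base learner does not use the responses $Y_i$. Let (B) be the following assumption: $X$ has a density that is bounded, and bounded away from zero on $\mathcal S$; $X\mid D=1$ and $X\mid D=0$ have densities that are continuous (on $\mathcal S$) almost everywhere on $\mathcal S$; $\mathcal S$ is compact; $s=O(n^{1/2})$; $n/B=O(1)$; and for the tree $T$ with leaves $(L_t)_t$ built on $s$ i.i.d. draws of $(X,Y)\mid D=\omega$, for both $\omega\in\{0,1\}$, $$\lim_{n\to\infty}E\Big[\big(\min_t|L_t|\big)^{-1}\Big]=0,\qquad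 \lim_{n\to\infty}\int_{\mathcal S}E\big[\operatorname{diam}(L(x)\cap\mathcal S)\big]\,dx=0.$$ For a positive integer $k$ and real constants $\gamma_1,\dots,\gamma_{k-1}$, let (O) be the following condition on $\mu_\omega$ and on estimators $\hat\mu_\omega$ computed from the sample, for both $\omega\in\{0,1\}$: $\mu_\omega$ (a version of it) and $\hat\mu_\omega$ (almost surely) are $C^k$; $\max_{|t|=k}\|\partial^t\mu_\omega\|_\infty<\infty$; $\max_{|t|=k}\|\partial^t\hat\mu_\omega\|_\infty=O_P(1)$; and $\max_{|t|=\ell}\|\partial^t\hat\mu_\omega-\partial^t\mu_\omega\|_\infty=O_P(n^{-\gamma_\ell})$ for $1\le\ell\le k-1$. Here $t$ ranges over the multi-indices and $\|\cdot\|_\infty$ is the essential supremum under the law of $X$. **Theorem.** Assume (A). Then the following hold. (i) The weights are nonnegative, and almost surely $\sum_{j:D_j=1-D_i}w_{i\leftarrow j}=1$ for every $i$ for which $\{j:D_j=1-D_i\}$ is nonempty. The weights are invariant under permutations of the sample: for every permutation $\pi$ of $\{1,\dots,n\}$, if $(w^\pi_{i\leftarrow j})$ are the weights built from $(X_{\pi(i)},D_{\pi(i)},Y_{\pi(i)})_{i\le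 n}$, then, conditionally on the sample, $(w^\pi_{i\leftarrow j})_{i,j}$ and $(w_{\pi(i)\leftarrow\pi(j)})_{i,j}$ have the same law. Moreover $E\big[\big(\sum_{j:D_j=1-D_1}w_{1\leftarrow j}-1\big)^2\big]=o(n^{-1})$, so that it tends to $0$, and $E\big|\sum_{j:D_j=1-D_1}w_{j\leftarrow1}\big|=O(1)$. (ii) If (B) holds and the trees are honest, then the column sums estimate the density ratio consistently: $$\lim_{n\to\infty}E\Big[\sum_{j:D_j=1-D_1}w_{j\leftarrow1}-\Big(D_1\frac{1-e(X_1)}{e(X_1)}+(1-D_1)\frac{e(X_1)}{1-e(X_1)}\Big)\Big]^2=0.$$ (iii) If the trees are honest, the weights are constructed from $(X_i,D_i)_{i\le n}$ without using $(Y_i)_{i\le n}$: their conditional law given the sample depends on $(X_i,D_i)_{i\le n}$ only. (iv) Let $k\ge1$ and $\gamma_1,\dots,\gamma_{k-1}\in\mathbb R$. Suppose that (B) and (O) hold, that the trees are honest, and that, for both $\omega\in\{0,1\}$ and the tree built on $s$ i.i.d. draws of $(X,Y)\mid D=\omega$, $$\int_{\mathcal S}E[\operatorname{diam}^k(L(x)\cap\mathcal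 S)]\,dx=o(n^{-1/2}),\qquad \int_{\mathcal S}E[\operatorname{diam}^\ell(L(x)\cap\mathcal S)]\,dx=o(n^{-1/2+\gamma_\ell})\quad(1\le\ell\le k-1).$$ Then all the conditions for efficiency hold with the same $k$ and $\gamma_\ell$: condition (O), the locality condition $$E\Big[\sum_{j:D_j=1-D_1}|w_{1\leftarrow j}|\,\|X_j-X_1\|^k\Big]=o(n^{-1/2}),\qquad E\Big[\sum_{j:D_j=1-D_1}|w_{1\leftarrow j}|\,\|X_j-X_1\|^\ell\Big]=o(n^{-1/2+\gamma_\ell})\quad(1\le\ell\le k-1),$$ and $E\big[\big(\sum_{j:D_j=1-D_1}w_{1\leftarrow j}-1\big)^2\big]=o(n^{-1})$. -/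

import Mathlib

open MeasureTheory ProbabilityTheory Filter Topology
open scoped ENNReal NNReal

/-! ### The data generating distribution -/

/-- The covariate space `ℝ^d` with its Euclidean norm. -/
abbrev Cov (d : ℕ) := EuclideanSpace ℝ (Fin d)

/-- One unit with its potential outcomes: `(X, D, (Y(ω))_ω)`.
The treatment arms `1` and `0` are `true` and `false`; the opposite arm `1 - ω` is `!ω`. -/
abbrev FullData (d : ℕ) := Cov d × Bool × (Bool → ℝ)

/-- One observed unit `(X, D, Y)`. -/
abbrev ObsData (d : ℕ) := Cov d × Bool × ℝ

/-- What is observed of a unit: `(X, D, Y)` with `Y = Y(D)`. -/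
def observe {d : ℕ} (u : FullData d) : ObsData d := (u.1, u.2.1, u.2.2 u.2.1)

/-- The joint law of the observed triple `(X, D, Y)`. -/
noncomputable abbrev obsLaw {d : ℕ} (P : Measure (FullData d)) : Measure (ObsData d) :=
  P.map observe

/-- The law of `n` i.i.d. observations of `(X, D, Y)`. -/
noncomputable abbrev sampleLaw {d : ℕ} (P : Measure (FullData d)) (n : ℕ) :
    Measure (Fin n → ObsData d) :=
  Measure.pi fun _ => obsLaw P

/-- The law of `(X, Y)` given `D = ω`. -/
noncomputable def armLaw {d : ℕ} (P : Measure (FullData d)) (ω : Bool) : Measure (Cov d × ℝ) :=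
  ((obsLaw P)[|{o | o.2.1 = ω}]).map fun o => (o.1, o.2.2)

/-- The support `𝒮` of `X`. -/
def covSupport {d : ℕ} (P : Measure (FullData d)) : Set (Cov d) := P.fst.support

section Population

variable {d : ℕ} (P : Measure (FullData d)) [IsFiniteMeasure P]

/-- The propensity score `e(x) = P(D = 1 | X = x)`. Here `P.condKernel x` is the regular
conditional law of `(D, Y(0), Y(1))` given `X = x`. -/
noncomputable def propensity (x : Cov d) : ℝ := (P.condKernel x).real {v | v.1 = true}

/-- The conditional mean `μ_ω(x) = E[Y | X = x, D = ω]` of the observed outcome. -/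
noncomputable def outcomeMean (ω : Bool) (x : Cov d) : ℝ :=
  ∫ v, v.2 v.1 ∂((P.condKernel x)[|{v | v.1 = ω}])

/-- The target of the column sums: `(1 - e(x)) / e(x)` for a treated unit and
`e(x) / (1 - e(x))` for a control unit. -/
noncomputable def densityRatio (x : Cov d) (D : Bool) : ℝ :=
  if D = true then (1 - propensity P x) / propensity P x
  else propensity P x / (1 - propensity P x)

/-- The basic assumptions on the data generating distribution. The i.i.d. sampling is built into
`sampleLaw`. Almost every `x` in the support means almost every `x` under the law of `X`. -/
structure BasicAssumption : Prop where
  /-- `D` is independent of `(Y(0), Y(1))` conditionally on `X = x`. -/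
  unconfounded : ∀ᵐ x ∂P.fst, IndepFun (fun v : Bool × (Bool → ℝ) => v.1) (fun v => v.2)
    (P.condKernel x)
  overlap : ∃ η : ℝ, 0 < η ∧ ∀ᵐ x ∂P.fst, η < propensity P x ∧ propensity P x < 1 - η
  /-- `E[U_ω² | X = x]` is bounded, where `U_ω = Y(ω) - μ_ω(X)`. -/
  residual : ∃ C : ℝ≥0, ∀ ω : Bool, ∀ᵐ x ∂P.fst,
    ∫⁻ v, ‖v.2 ω - outcomeMean P ω x‖ₑ ^ 2 ∂(P.condKernel x) ≤ C
  /-- `E[μ_ω(X)²]` is finite. -/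
  mean_sq : ∀ ω : Bool, MemLp (outcomeMean P ω) 2 P.fst

/-- The density of `X` is bounded and bounded away from zero on the support, the densities of
`X | D = 1` and `X | D = 0` are continuous almost everywhere, and the support is compact. -/
structure DensityAssumption : Prop where
  density : ∃ f : Cov d → ℝ≥0, Measurable f ∧
    P.fst = volume.withDensity (fun x => (f x : ℝ≥0∞)) ∧
    ∃ c C : ℝ≥0, 0 < c ∧ ∀ᵐ x ∂volume.restrict (covSupport P), c ≤ f x ∧ f x ≤ C
  arm_density : ∀ ω : Bool, ∃ f : Cov d → ℝ≥0, Measurable f ∧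
    (armLaw P ω).fst = volume.withDensity (fun x => (f x : ℝ≥0∞)) ∧
    ∀ᵐ x ∂volume.restrict (covSupport P), ContinuousWithinAt f (covSupport P) x
  compact : IsCompact (covSupport P)

end Population

/-! ### Conditions on a smoothing matrix -/

/-- A (possibly randomized) smoothing matrix: for each sample size `n ≥ 1` and each sample, the
conditional law, given the sample, of the matrix `W` whose entry `W i j` is the weight
`w_{i ← j}`. -/
abbrev SmoothingMatrix (d : ℕ) :=
  (n : ℕ+) → (Fin n → ObsData d) → Measure (Fin n → Fin n → ℝ)

/-- The row sum `∑_{j : D_j = 1 - D_i} w_{i ← j}`. -/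
noncomputable def rowSum {d n : ℕ} (z : Fin n → ObsData d) (W : Fin n → Fin n → ℝ)
    (i : Fin n) : ℝ :=
  ∑ j with (z j).2.1 = !(z i).2.1, W i j

/-- The column sum `∑_{j : D_j = 1 - D_i} w_{j ← i}`. -/
noncomputable def colSum {d n : ℕ} (z : Fin n → ObsData d) (W : Fin n → Fin n → ℝ)
    (i : Fin n) : ℝ :=
  ∑ j with (z j).2.1 = !(z i).2.1, W j i

/-- The discrepancy `∑_{j : D_j = 1 - D_i} |w_{i ← j}| ‖X_j - X_i‖ ^ ℓ`. -/
noncomputable def discrepancy {d n : ℕ} (ℓ : ℕ) (z : Fin n → ObsData d)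
    (W : Fin n → Fin n → ℝ) (i : Fin n) : ℝ :=
  ∑ j with (z j).2.1 = !(z i).2.1, |W i j| * ‖(z j).1 - (z i).1‖ ^ ℓ

/-- The expectation of a nonnegative function of an i.i.d. sample of size `n` and of the smoothing
matrix computed from it. -/
noncomputable def expect {d : ℕ} (P : Measure (FullData d)) (w : SmoothingMatrix d) (n : ℕ+)
    (F : (Fin n → ObsData d) → (Fin n → Fin n → ℝ) → ℝ≥0∞) : ℝ≥0∞ :=
  ∫⁻ z, ∫⁻ W, F z W ∂(w n z) ∂(sampleLaw P n)

/-- `a n = o(n ^ r)`. -/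
def IsLittleOPow (a : ℕ+ → ℝ≥0∞) (r : ℝ) : Prop :=
  Tendsto (fun n : ℕ+ => a n / ENNReal.ofReal (((n : ℕ) : ℝ) ^ r)) atTop (𝓝 0)

/-- `Z n = O_P(n ^ r)` for statistics `Z n` of i.i.d. samples of size `n`. -/
def IsBigOProbPow {d : ℕ} (P : Measure (FullData d))
    (Z : (n : ℕ+) → (Fin n → ObsData d) → ℝ≥0∞) (r : ℝ) : Prop :=
  ∀ ε : ℝ≥0∞, 0 < ε → ∃ C : ℝ≥0, ∀ᶠ n : ℕ+ in atTop,
    sampleLaw P n {z | C * ENNReal.ofReal (((n : ℕ) : ℝ) ^ r) < Z n z} ≤ ε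

/-- The weights do not depend on the order of the sample: if unit `i` of the permuted sample is
unit `π i` of the original one, then the matrix `(w^π_{i ← j})` of the permuted sample and the
matrix `(w_{π i ← π j})` have the same conditional law given the sample. -/
def PermutationInvariant {d : ℕ} (w : SmoothingMatrix d) : Prop :=
  ∀ (n : ℕ+) (z : Fin n → ObsData d) (π : Equiv.Perm (Fin n)),
    w n (z ∘ π) = (w n z).map fun W i j => W (π i) (π j)

/-- The weights are invariant and `E[(∑_{j : D_j = 1 - D_1} w_{1 ← j} - 1)²] → 0`. -/
structure WeightAssumption {d : ℕ} (P : Measure (FullData d)) (w : SmoothingMatrix d) :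
    Prop where
  invariant : PermutationInvariant w
  rowSum_tendsto : Tendsto
    (fun n => expect P w n fun z W => ENNReal.ofReal ((rowSum z W 0 - 1) ^ 2)) atTop (𝓝 0)

/-- The density model condition: the column sum of unit `1` estimates the density ratio at unit `1`
consistently in mean square. -/
def DensityModelCondition {d : ℕ} (P : Measure (FullData d)) [IsFiniteMeasure P]
    (w : SmoothingMatrix d) : Prop :=
  Tendsto (fun n => expect P w n fun z W =>
    ENNReal.ofReal ((colSum z W 0 - densityRatio P (z 0).1 (z 0).2.1) ^ 2)) atTop (𝓝 0)

/-- The weights are constructed from the `(X_i, D_i)` without using the outcomes. -/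
def OutcomeFree {d : ℕ} (w : SmoothingMatrix d) : Prop :=
  ∀ (n : ℕ+) (z z' : Fin n → ObsData d),
    (∀ i, (z i).1 = (z' i).1) → (∀ i, (z i).2.1 = (z' i).2.1) → w n z = w n z'

/-- `E|∑_{j : D_j = 1 - D_1} w_{j ← 1}| = O(1)`. -/
def ColSumBounded {d : ℕ} (P : Measure (FullData d)) (w : SmoothingMatrix d) : Prop :=
  ∃ C : ℝ≥0, ∀ n, expect P w n (fun z W => ‖colSum z W 0‖ₑ) ≤ C

/-- `E[(∑_{j : D_j = 1 - D_1} w_{1 ← j} - 1)²] = o(n⁻¹)`. -/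
def RowSumRate {d : ℕ} (P : Measure (FullData d)) (w : SmoothingMatrix d) : Prop :=
  IsLittleOPow (fun n => expect P w n fun z W => ENNReal.ofReal ((rowSum z W 0 - 1) ^ 2)) (-1)

/-- The locality condition of order `k` with exponents `γ_1, …, γ_{k-1}`. -/
structure LocalityCondition {d : ℕ} (P : Measure (FullData d)) (w : SmoothingMatrix d)
    (k : ℕ) (γ : ℕ → ℝ) : Prop where
  top : IsLittleOPow
    (fun n => expect P w n fun z W => ENNReal.ofReal (discrepancy k z W 0)) (-1 / 2)
  lower : ∀ ℓ : ℕ, 1 ≤ ℓ → ℓ ≤ k - 1 → IsLittleOPow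
    (fun n => expect P w n fun z W => ENNReal.ofReal (discrepancy ℓ z W 0)) (-1 / 2 + γ ℓ)

/-- `max_{t ∈ Λ_ℓ} ‖∂^t f‖_∞`, the supremum norm being the essential one under the law of `X`.
A multi-index `t` of order `ℓ` is given by a list `v` of `ℓ` coordinate directions. -/
noncomputable def maxPartialNorm {d : ℕ} (P : Measure (FullData d)) (ℓ : ℕ) (f : Cov d → ℝ) :
    ℝ≥0∞ :=
  ⨆ v : Fin ℓ → Fin d, eLpNorm
    (fun x => iteratedFDeriv ℝ ℓ f x fun r => EuclideanSpace.single (v r) (1 : ℝ)) ∞ P.fst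

/-- Outcome estimators: `muHat n ω z` is the estimate of `μ_ω` computed from the sample `z`. -/
abbrev OutcomeEstimator (d : ℕ) :=
  (n : ℕ+) → Bool → (Fin n → ObsData d) → Cov d → ℝ

/-- Smoothness of the outcome models and rates of their estimators, of order `k` and with exponents
`γ_1, …, γ_{k-1}`. As `μ_ω` is determined almost everywhere only, the smoothness is that of a
version `m ω`. -/
def OutcomeSmoothness {d : ℕ} (P : Measure (FullData d)) [IsFiniteMeasure P]
    (muHat : OutcomeEstimator d) (k : ℕ) (γ : ℕ → ℝ) : Prop :=
  ∃ m : Bool → Cov d → ℝ, ∀ ω : Bool,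
    m ω =ᵐ[P.fst] outcomeMean P ω ∧ ContDiff ℝ k (m ω) ∧ maxPartialNorm P k (m ω) < ∞ ∧
    (∀ n : ℕ+, ∀ᵐ z ∂(sampleLaw P n), ContDiff ℝ k (muHat n ω z)) ∧
    IsBigOProbPow P (fun n z => maxPartialNorm P k (muHat n ω z)) 0 ∧
    ∀ ℓ : ℕ, 1 ≤ ℓ → ℓ ≤ k - 1 →
      IsBigOProbPow P (fun n z => maxPartialNorm P ℓ (fun x => muHat n ω z x - m ω x)) (-γ ℓ)

/-- The conditions for efficiency, for given `k` and `γ`: outcome smoothness and rates, locality,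
and the rate of the row sums. -/
structure EfficiencyAssumption {d : ℕ} (P : Measure (FullData d)) [IsFiniteMeasure P]
    (w : SmoothingMatrix d) (muHat : OutcomeEstimator d) (k : ℕ) (γ : ℕ → ℝ) : Prop where
  outcome : OutcomeSmoothness P muHat k γ
  locality : LocalityCondition P w k γ
  rowSum_rate : RowSumRate P w

/-! ### Trees -/

/-- Finite binary trees of axis-aligned splits of `ℝ^d`: `node j c l r` sends `x` to `l` if
`x_j ≤ c` and to `r` otherwise. -/
inductive SplitTree (d : ℕ) : Type
  | leaf : SplitTree d
  | node (j : Fin d) (c : ℝ) (l r : SplitTree d) : SplitTree d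

/-- The leaf (a subset of `ℝ^d`) containing the point `x`. -/
noncomputable def SplitTree.leafAt {d : ℕ} : SplitTree d → Cov d → Set (Cov d)
  | .leaf, _ => Set.univ
  | .node j c l r, x =>
      if x j ≤ c then {y | y j ≤ c} ∩ l.leafAt x else {y | c < y j} ∩ r.leafAt x

/-- A base learner with random seeds in `Ξ`: it builds a tree from a seed and from a set of data
`(X, Y)` of any size. The order of the data is irrelevant, every leaf contains at least one of the
data, and the tree depends measurably on the seed and the data. -/
structure BaseLearner (d : ℕ) (Ξ : Type*) [MeasurableSpace Ξ] where
  tree : (m : ℕ) → Ξ → (Fin m → Cov d × ℝ) → SplitTree d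
  symmetric : ∀ (m : ℕ) (ξ : Ξ) (a : Fin m → Cov d × ℝ) (σ : Equiv.Perm (Fin m)),
    tree m ξ (a ∘ σ) = tree m ξ a
  leaf_nonempty : ∀ (m : ℕ) (ξ : Ξ) (a : Fin m → Cov d × ℝ), 0 < m →
    ∀ x, ∃ r, (a r).1 ∈ (tree m ξ a).leafAt x
  measurable : ∀ m : ℕ, MeasurableSet
    {q : (Ξ × (Fin m → Cov d × ℝ)) × Cov d × Cov d | q.2.2 ∈ (tree m q.1.1 q.1.2).leafAt q.2.1}

/-- The tree does not use the responses. -/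
def BaseLearner.Honest {d : ℕ} {Ξ : Type*} [MeasurableSpace Ξ] (T : BaseLearner d Ξ) : Prop :=
  ∀ (m : ℕ) (ξ : Ξ) (a a' : Fin m → Cov d × ℝ),
    (∀ r, (a r).1 = (a' r).1) → T.tree m ξ a = T.tree m ξ a'

/-! ### Subsampled random forests -/

/-- The design of a forest at every sample size `n ≥ 1`: the base learner, the subsample size `s`
and the number `B` of trees. -/
structure ForestDesign (d : ℕ) (Ξ : Type*) [MeasurableSpace Ξ] where
  learner : ℕ+ → BaseLearner d Ξ
  s : ℕ+ → ℕ+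
  B : ℕ+ → ℕ+

section Forest

variable {d : ℕ} {Ξ : Type*} [MeasurableSpace Ξ]

/-- The units of arm `ω`. -/
def arm {n : ℕ} (z : Fin n → ObsData d) (ω : Bool) : Finset (Fin n) := {i | (z i).2.1 = ω}

/-- The possible subsamples of arm `ω`: its subsets of size `s`. If the arm has less than `s`
units, the whole arm is used. -/
def subsamples {n : ℕ} (s : ℕ) (z : Fin n → ObsData d) (ω : Bool) : Finset (Finset (Fin n)) :=
  (arm z ω).powersetCard (min s (arm z ω).card)

/-- For each tree `b` and arm `ω`: the subsample `ℐ_b^ω` and the seed of the tree. -/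
abbrev ForestRandomness (n B : ℕ) (Ξ : Type*) := Fin B × Bool → Finset (Fin n) × Ξ

/-- Given the sample, subsamples are drawn uniformly without replacement and seeds from `ρ`,
independently over trees and arms. -/
noncomputable def forestRandomnessLaw {n : ℕ} (s B : ℕ) (ρ : Measure Ξ)
    (z : Fin n → ObsData d) : Measure (ForestRandomness n B Ξ) :=
  Measure.pi fun q => (uniformOn (subsamples s z q.2 : Set (Finset (Fin n)))).prod ρ

/-- The leaf `L_b^ω(x)` containing `x` of the tree built on the `(X_i, Y_i)` with `i` in the
subsample `u.1`, with seed `u.2`. -/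
noncomputable def forestLeaf {n : ℕ} (T : BaseLearner d Ξ) (z : Fin n → ObsData d)
    (u : Finset (Fin n) × Ξ) (x : Cov d) : Set (Cov d) :=
  (T.tree u.1.card u.2 fun r =>
    ((z (u.1.orderEmbOfFin rfl r)).1, (z (u.1.orderEmbOfFin rfl r)).2.2)).leafAt x

open Classical in
/-- The weight `w_{i ← j}` of the forest: the average over the trees `b` of
`1(j ∈ ℐ_b, X_j ∈ L_b(X_i)) / |{k ∈ ℐ_b : X_k ∈ L_b(X_i)}|` for the arm `1 - D_i`. -/
noncomputable def forestWeight {n B : ℕ} (T : BaseLearner d Ξ) (z : Fin n → ObsData d)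
    (u : ForestRandomness n B Ξ) (i j : Fin n) : ℝ :=
  (B : ℝ)⁻¹ * ∑ b : Fin B,
    (if j ∈ (u (b, !(z i).2.1)).1 ∧ (z j).1 ∈ forestLeaf T z (u (b, !(z i).2.1)) (z i).1
      then (1 : ℝ) else 0) /
    (((u (b, !(z i).2.1)).1.filter
      fun k => (z k).1 ∈ forestLeaf T z (u (b, !(z i).2.1)) (z i).1).card : ℝ)

/-- The smoothing matrix of the forest. -/
noncomputable def forestMatrix (G : ForestDesign d Ξ) (ρ : Measure Ξ) : SmoothingMatrix d :=
  fun n z => (forestRandomnessLaw (G.s n) (G.B n) ρ z).map (forestWeight (G.learner n) z)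

/-- The law of the ingredients of a single tree: `s` i.i.d. draws of `(X, Y) | D = ω` and an
independent seed. -/
noncomputable def treeLaw (P : Measure (FullData d)) (ρ : Measure Ξ) (s : ℕ) (ω : Bool) :
    Measure ((Fin s → Cov d × ℝ) × Ξ) :=
  (Measure.pi fun _ => armLaw P ω).prod ρ

open Classical in
/-- `E[(min_t |L_t|)⁻¹]` for the tree built on `s` i.i.d. draws of `(X, Y) | D = ω`, where `|L_t|`
is the number of data in the leaf `L_t`. -/
noncomputable def invMinLeafSize (P : Measure (FullData d)) (ρ : Measure Ξ)
    (G : ForestDesign d Ξ) (ω : Bool) (n : ℕ+) : ℝ≥0∞ :=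
  ∫⁻ q, (⨅ x : Cov d, ((Finset.univ.filter fun r =>
      (q.1 r).1 ∈ ((G.learner n).tree (G.s n) q.2 q.1).leafAt x).card : ℝ≥0∞))⁻¹
    ∂(treeLaw P ρ (G.s n) ω)

/-- `∫_𝒮 E[diam^ℓ(L(x) ∩ 𝒮)] dx` for the tree built on `s` i.i.d. draws of `(X, Y) | D = ω`, where
`L(x)` is its leaf containing `x`. -/
noncomputable def leafDiamMoment (P : Measure (FullData d)) (ρ : Measure Ξ)
    (G : ForestDesign d Ξ) (ω : Bool) (ℓ : ℕ) (n : ℕ+) : ℝ≥0∞ :=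
  ∫⁻ x in covSupport P, ∫⁻ q,
    Metric.ediam (((G.learner n).tree (G.s n) q.2 q.1).leafAt x ∩ covSupport P) ^ ℓ
    ∂(treeLaw P ρ (G.s n) ω)

/-- The trees are honest. -/
def ForestDesign.Honest (G : ForestDesign d Ξ) : Prop := ∀ n, (G.learner n).Honest

/-- The assumptions for the density model condition: regular densities and compact support,
`s = O(√n)`, `n / B = O(1)`, vanishing inverse minimal leaf size and vanishing leaf diameter. -/
structure ForestDRAssumption (P : Measure (FullData d)) [IsFiniteMeasure P] (ρ : Measure Ξ)
    (G : ForestDesign d Ξ) : Prop where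
  density : DensityAssumption P
  subsample : (fun n : ℕ+ => ((G.s n : ℕ) : ℝ)) =O[atTop] fun n : ℕ+ => √((n : ℕ) : ℝ)
  trees : (fun n : ℕ+ => ((n : ℕ) : ℝ) / ((G.B n : ℕ) : ℝ)) =O[atTop] fun _ => (1 : ℝ)
  leafSize : ∀ ω : Bool, Tendsto (invMinLeafSize P ρ G ω) atTop (𝓝 0)
  leafDiam : ∀ ω : Bool, Tendsto (leafDiamMoment P ρ G ω 1) atTop (𝓝 0)

/-- The additional assumptions for efficiency, for given `k` and `γ`: outcome smoothness and rates,
and rates of the moments of the leaf diameters. -/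
structure ForestSEAssumption (P : Measure (FullData d)) [IsFiniteMeasure P] (ρ : Measure Ξ)
    (G : ForestDesign d Ξ) (muHat : OutcomeEstimator d) (k : ℕ) (γ : ℕ → ℝ) : Prop where
  outcome : OutcomeSmoothness P muHat k γ
  diam_top : ∀ ω : Bool, IsLittleOPow (leafDiamMoment P ρ G ω k) (-1 / 2)
  diam_lower : ∀ ω : Bool, ∀ ℓ : ℕ, 1 ≤ ℓ → ℓ ≤ k - 1 →
    IsLittleOPow (leafDiamMoment P ρ G ω ℓ) (-1 / 2 + γ ℓ)

end Forest

/-! Rows and locality are elementary. Every tree distributes total weight one over the data in one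
leaf, so a row sum differs from one only if an arm is empty, which by Hoeffding's inequality
(`sampleLaw_card_arm_le`) has exponentially small probability. Relabelling the units
(`expect_col_eq_row`) turns expected column sums into expected row sums. A donor lies in the leaf of
its recipient, so its distance is at most the diameter of the leaf within the support; the tree of
one arm is independent of the units of the other (`lintegral_subsample_le`), which gives
`expect_discrepancy_le`.

The core is the mean square consistency of the column sums c. Let r be the ratio `armRatio` at (D_1,
X_1) and V = E[r²]. Since E[(c - r)²] = E[c²] - 2E[cr] + V (`expect_sq_error_add`), it suffices that
in the limit E[c²] is at most V and E[cr] at least V.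

Cross term (`eventually_le_expect_cross`): exchanging units, E[cr] is the mean of the ratio averaged
over the donors of unit 1. As donors are close and the ratio is continuous almost everywhere, this
is almost at least the mean of the opposite ratio at unit 1, which a change of measure between the
arms identifies as V.

Second moment (`eventually_expect_sq_colSum_le`): c averages B independent trees, each contributing
only if unit 1 is in its subsample, so E[c²] is at most 1/B + s/|arm| times the second moment of a
single tree (`lintegral_mean_sq_le`). The latter is bounded through pairs of units of the opposite
arm that share a leaf, weighted with the inverse leaf size (`sum_sq_treeCol_le`, `pairMass`). What
remains is a sharp bound for s times `pairMass`. After moving both points to the arm of the tree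
(`pairMass_le`), it says that a fresh sample of size s does not put noticeably more points into a
leaf than the sample that built the tree: with N sample points and M ghost points in the leaf of a
ghost point, the sum of the positive parts of M/N - 1 over the ghost points has mean o(s), up to a
multiple of the mean inverse leaf sizes (`exists_lintegral_div_sub_one_le`).

This last fact is a uniform law over all trees, with leaf sizes that grow at no prescribed rate; a
union bound over partitions would cost log s per leaf, which is too much. Instead, mark the leaves
where M/N is too large. Given the 2s pooled points, the labels real/ghost are exchangeable, and a
Chernoff bound makes a marked leaf with m points cost q^m with q < 1. Trees are pruned to their
marked leaves, and the sum of the costs of all pruned trees obeys a quadratic recursion. If marked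
leaves have at least n₀ points, with q^n₀ small, its generating function in z is bounded at some z
close to 1 (`sum_pow_mul_maxPruned_le`). Hence the exponential moment of the number of ghost points
in marked leaves of the worst tree grows no faster than z^(-2s), and their mean number is a small
fraction of s. -/

set_option linter.unusedSectionVars false

/-! ### Entropy of partitions of a finite point set by trees of axis-aligned splits -/

section BoxEntropy

/-- `H` is a lower set for the preorder induced by `f`. -/
def IsCut {ι : Type*} (f : ι → ℝ) (H : Finset ι) : Prop := ∀ i j, f j ≤ f i → i ∈ H → j ∈ H

theorem IsCut.inter {ι : Type*} [DecidableEq ι] {f : ι → ℝ} {H K : Finset ι} (hH : IsCut f H)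
    (hK : IsCut f K) : IsCut f (H ∩ K) := by
  intro i j hij hi
  rw [Finset.mem_inter] at hi ⊢
  exact ⟨hH i j hij hi.1, hK i j hij hi.2⟩

theorem IsCut.subset_or_subset {ι : Type*} {f : ι → ℝ} {H K : Finset ι} (hH : IsCut f H)
    (hK : IsCut f K) : H ⊆ K ∨ K ⊆ H := by
  by_contra! h
  obtain ⟨h1, h2⟩ := h
  rw [Finset.not_subset] at h1 h2
  obtain ⟨a, ha, ha'⟩ := h1
  obtain ⟨b, hb, hb'⟩ := h2
  rcases le_total (f a) (f b) with h | h
  · exact ha' (hK b a h hb)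
  · exact hb' (hH a b h ha)

variable {ι Q : Type*} [Fintype ι] [DecidableEq ι] [Fintype Q] [DecidableEq Q] (φ : Q → ι → ℝ)

open Classical in
/-- The traces on `S` of the half-spaces in direction `q`. -/
noncomputable def cuts (q : Q) (S : Finset ι) : Finset (Finset ι) :=
  S.powerset.filter fun S₁ => ∃ H, IsCut (φ q) H ∧ S₁ = S ∩ H

open Classical in
/-- The traces on `S` of the intersections of half-spaces in the directions in `s`. -/
noncomputable def boxes (s : Finset Q) (S : Finset ι) : Finset (Finset ι) :=
  S.powerset.filter fun S' => ∃ H : Q → Finset ι, (∀ q, IsCut (φ q) (H q)) ∧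
    S' = S.filter fun i => ∀ q ∈ s, i ∈ H q

/-- Partial sums. -/
def partialSum (G : ℕ → ℝ≥0) (N : ℕ) : ℝ≥0 := ∑ a ∈ Finset.range (N + 1), G a

/-- The half-spaces of one direction form a chain, so their traces on `S` are determined by their
cardinalities, and each size between 0 and `S.card` occurs at most once. -/
theorem sum_cuts_le (q : Q) (S : Finset ι) (G : ℕ → ℝ≥0) :
    ∑ S₁ ∈ cuts φ q S, G S₁.card ≤ partialSum G S.card := by
  have hinj : Set.InjOn Finset.card (cuts φ q S : Set (Finset ι)) := by
    intro A hA B hB hAB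
    simp only [cuts, Finset.coe_filter, Set.mem_ofPred_eq] at hA hB
    obtain ⟨-, H, hH, rfl⟩ := hA
    obtain ⟨-, K, hK, rfl⟩ := hB
    rcases hH.subset_or_subset hK with h | h
    · exact Finset.eq_of_subset_of_card_le (Finset.inter_subset_inter_left h) hAB.ge
    · exact (Finset.eq_of_subset_of_card_le (Finset.inter_subset_inter_left h) hAB.le).symm
  rw [← Finset.sum_image (f := G) hinj]
  refine Finset.sum_le_sum_of_subset fun a ha => ?_
  rw [Finset.mem_image] at ha
  obtain ⟨A, hA, rfl⟩ := ha
  simp only [cuts, Finset.mem_filter, Finset.mem_powerset] at hA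
  exact Finset.mem_range.2 (Nat.lt_succ_of_le (Finset.card_le_card hA.1))

/-- A box is cut out one direction at a time, and by `sum_cuts_le` every direction costs one partial
sum. -/
theorem sum_boxes_le (s : Finset Q) (G : ℕ → ℝ≥0) : ∀ S : Finset ι,
    ∑ S' ∈ boxes φ s S, G S'.card ≤ partialSum^[s.card] G S.card := by
  classical
  induction s using Finset.induction_on with
  | empty =>
    intro S
    have : boxes φ ∅ S ⊆ {S} := by
      intro S' hS'
      simp only [boxes, Finset.mem_filter] at hS'
      obtain ⟨-, H, -, rfl⟩ := hS'
      simp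
    refine (Finset.sum_le_sum_of_subset this).trans ?_
    simp
  | insert q s hq ih =>
    intro S
    have hsub : boxes φ (insert q s) S ⊆ (cuts φ q S).biUnion (boxes φ s) := by
      intro S' hS'
      simp only [boxes, Finset.mem_filter, Finset.mem_powerset] at hS'
      obtain ⟨h1, H, hH, rfl⟩ := hS'
      simp only [Finset.mem_biUnion, cuts, boxes, Finset.mem_filter, Finset.mem_powerset]
      refine ⟨S ∩ H q, ⟨Finset.inter_subset_left, H q, hH q, rfl⟩, ?_, H, hH, ?_⟩
      · intro i hi
        simp only [Finset.mem_filter, Finset.mem_insert, forall_eq_or_imp] at hi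
        exact Finset.mem_inter.2 ⟨hi.1, hi.2.1⟩
      · ext i
        simp only [Finset.mem_filter, Finset.mem_insert, forall_eq_or_imp, Finset.mem_inter]
        tauto
    have hbi : ∑ S' ∈ (cuts φ q S).biUnion (boxes φ s), G S'.card ≤
        ∑ S₁ ∈ cuts φ q S, ∑ S' ∈ boxes φ s S₁, G S'.card := by
      rw [Finset.sum_sigma' (cuts φ q S) (fun S₁ => boxes φ s S₁) (fun _ S' => G S'.card)]
      have : (cuts φ q S).biUnion (boxes φ s) =
          ((cuts φ q S).sigma fun S₁ => boxes φ s S₁).image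
            fun p : (_ : Finset ι) × Finset ι => p.2 := by
        ext; simp
      rw [this]
      exact Finset.sum_image_le_of_nonneg (g := fun p : (_ : Finset ι) × Finset ι => p.2)
        (f := fun S' : Finset ι => G S'.card) (fun _ _ => zero_le)
    rw [Finset.card_insert_of_notMem hq, Function.iterate_succ_apply']
    calc _ ≤ _ := Finset.sum_le_sum_of_subset hsub
      _ ≤ _ := hbi
      _ ≤ ∑ S₁ ∈ cuts φ q S, partialSum^[s.card] G S₁.card := Finset.sum_le_sum fun S₁ _ => ih S₁
      _ ≤ _ := sum_cuts_le φ q S _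

/-- Taking partial sums of the coefficients multiplies a generating function by the geometric
series, which `C` bounds. Working with truncated sums avoids all questions of convergence. -/
theorem sum_pow_mul_partialSum_le {z C : ℝ≥0} (hC : ∀ n, ∑ p ∈ Finset.range n, z ^ p ≤ C)
    (G : ℕ → ℝ≥0) (n : ℕ) :
    ∑ N ∈ Finset.range n, z ^ N * partialSum G N ≤ C * ∑ N ∈ Finset.range n, z ^ N * G N := by
  have h1 : ∑ N ∈ Finset.range n, z ^ N * partialSum G N =
      ∑ a ∈ Finset.range n, ∑ N ∈ Finset.Ico a n, z ^ N * G a := by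
    simp only [partialSum, Finset.mul_sum]
    refine Finset.sum_comm' fun N a => ?_
    simp only [Finset.mem_range, Finset.mem_Ico]
    omega
  rw [h1, Finset.mul_sum]
  refine Finset.sum_le_sum fun a _ => ?_
  rw [Finset.sum_Ico_eq_sum_range]
  calc ∑ k ∈ Finset.range (n - a), z ^ (a + k) * G a
      = (∑ k ∈ Finset.range (n - a), z ^ k) * (z ^ a * G a) := by
        rw [Finset.sum_mul]
        exact Finset.sum_congr rfl fun k _ => by ring
    _ ≤ _ := mul_le_mul_left (hC _) _

theorem sum_pow_mul_partialSum_iterate_le {z C : ℝ≥0}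
    (hC : ∀ n, ∑ p ∈ Finset.range n, z ^ p ≤ C) (G : ℕ → ℝ≥0) (n k : ℕ) :
    ∑ N ∈ Finset.range n, z ^ N * partialSum^[k] G N ≤
      C ^ k * ∑ N ∈ Finset.range n, z ^ N * G N := by
  induction k with
  | zero => simp
  | succ k ih =>
    simp only [Function.iterate_succ_apply']
    refine (sum_pow_mul_partialSum_le hC _ n).trans ?_
    rw [pow_succ', mul_assoc]
    exact mul_le_mul_right ih _

/-- The weight of a set of points as a marked leaf, where `R` is the set of its real points. -/
noncomputable def markWeight (mark : ℕ → ℕ → Prop) [∀ N M, Decidable (mark N M)] (t : ℝ≥0)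
    (S R : Finset ι) : ℝ≥0 :=
  if mark (S ∩ R).card (S \ R).card then t ^ (S \ R).card else 0

variable (mark : ℕ → ℕ → Prop) [∀ N M, Decidable (mark N M)] (t : ℝ≥0)

/-- The sum over the trees of depth less than `k` on `S`, pruned to their marked leaves, of the
products of the weights of the marked leaves. -/
noncomputable def prunedSum : ℕ → Finset ι → Finset ι → ℝ≥0
  | 0, _, _ => 0
  -- A tree with at least one marked leaf is followed down until either a single marked leaf is left
  -- or a split has marked leaves on both sides. The points still present then form the trace `S'`
  -- of a box on `S`, so the branches without marked leaves are never enumerated.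
  | k + 1, S, R => ∑ S' ∈ boxes φ Finset.univ S, (markWeight mark t S' R +
      ∑ q, ∑ S₁ ∈ cuts φ q S', prunedSum k S₁ R * prunedSum k (S' \ S₁) R)

theorem boxes_subset {s : Finset Q} {S S' : Finset ι} (h : S' ∈ boxes φ s S) : S' ⊆ S := by
  simp only [boxes, Finset.mem_filter, Finset.mem_powerset] at h
  exact h.1

theorem cuts_subset {q : Q} {S S' : Finset ι} (h : S' ∈ cuts φ q S) : S' ⊆ S := by
  simp only [cuts, Finset.mem_filter, Finset.mem_powerset] at h
  exact h.1

theorem self_mem_boxes (s : Finset Q) (S : Finset ι) : S ∈ boxes φ s S := by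
  simp only [boxes, Finset.mem_filter, Finset.mem_powerset]
  exact ⟨subset_rfl, fun _ => Finset.univ, fun _ _ _ _ _ => Finset.mem_univ _, by simp⟩

theorem boxes_inter_subset {q : Q} {H : Finset ι} (hH : IsCut (φ q) H) (S : Finset ι) :
    boxes φ Finset.univ (S ∩ H) ⊆ boxes φ Finset.univ S := by
  intro S' h
  simp only [boxes, Finset.mem_filter, Finset.mem_powerset] at h ⊢
  obtain ⟨h1, K, hK, rfl⟩ := h
  refine ⟨h1.trans Finset.inter_subset_left,
    Function.update K q (K q ∩ H), fun q' => ?_, ?_⟩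
  · rcases eq_or_ne q' q with rfl | hne
    · simpa using (hK q').inter hH
    · simpa [hne] using hK q'
  · ext i
    simp only [Finset.mem_filter, Finset.mem_inter, Finset.mem_univ, true_imp_iff]
    constructor
    · rintro ⟨⟨hS, hiH⟩, hi⟩
      refine ⟨hS, fun q' => ?_⟩
      rcases eq_or_ne q' q with rfl | hne
      · simpa using ⟨hi q', hiH⟩
      · simpa [hne] using hi q'
    · rintro ⟨hS, hi⟩
      have := hi q
      simp only [Function.update_self, Finset.mem_inter] at this
      refine ⟨⟨hS, this.2⟩, fun q' => ?_⟩
      rcases eq_or_ne q' q with rfl | hne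
      · exact this.1
      · simpa [hne] using hi q'

theorem prunedSum_mono (k : ℕ) : ∀ S R : Finset ι,
    prunedSum φ mark t k S R ≤ prunedSum φ mark t (k + 1) S R := by
  induction k with
  | zero => intro S R; simp [prunedSum]
  | succ k ih =>
    intro S R
    rw [prunedSum, prunedSum]
    gcongr
    · exact ih _ _
    · exact ih _ _

theorem prunedSum_empty (h0 : ¬ mark 0 0) (k : ℕ) (R : Finset ι) :
    prunedSum φ mark t k ∅ R = 0 := by
  induction k with
  | zero => rfl
  | succ k ih =>
    rw [prunedSum]
    refine Finset.sum_eq_zero fun S' hS' => ?_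
    obtain rfl := Finset.subset_empty.1 (boxes_subset φ hS')
    rw [markWeight]
    simp only [Finset.empty_inter, Finset.card_empty, Finset.empty_sdiff, h0, if_false, zero_add]
    refine Finset.sum_eq_zero fun q _ => Finset.sum_eq_zero fun S₁ hS₁ => ?_
    obtain rfl := Finset.subset_empty.1 (cuts_subset φ hS₁)
    simp [ih]

/-- Splitting a set of points by a half-space. -/
theorem one_add_prunedSum_mul_le (h0 : ¬ mark 0 0) (k : ℕ) {q q' : Q} {H H' : Finset ι}
    (hH : IsCut (φ q) H) (hH' : IsCut (φ q') H') (hc : H' = Hᶜ) (S R : Finset ι) :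
    (1 + prunedSum φ mark t k (S ∩ H) R) * (1 + prunedSum φ mark t k (S ∩ H') R) ≤
      1 + prunedSum φ mark t (k + 1) S R := by
  have hdisj : Disjoint (S ∩ H) (S ∩ H') := by
    rw [hc, Finset.disjoint_left]
    intro i hi hi'
    simp only [Finset.mem_inter, Finset.mem_compl] at hi hi'
    exact hi'.2 hi.2
  have hunion : (S ∩ H) ∪ (S ∩ H') = S := by
    rw [hc, ← Finset.inter_union_distrib_left, Finset.union_compl, Finset.inter_univ]
  rcases Finset.eq_empty_or_nonempty (S ∩ H) with h1 | h1
  · have : S ∩ H' = S := by rw [h1, Finset.empty_union] at hunion; exact hunion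
    rw [h1, this, prunedSum_empty φ mark t h0, add_zero, one_mul]
    gcongr
    exact prunedSum_mono φ mark t k S R
  rcases Finset.eq_empty_or_nonempty (S ∩ H') with h2 | h2
  · have : S ∩ H = S := by rw [h2, Finset.union_empty] at hunion; exact hunion
    rw [h2, this, prunedSum_empty φ mark t h0, add_zero, mul_one]
    gcongr
    exact prunedSum_mono φ mark t k S R
  set g : Finset ι → ℝ≥0 := fun S' => markWeight mark t S' R +
    ∑ q, ∑ S₁ ∈ cuts φ q S', prunedSum φ mark t k S₁ R * prunedSum φ mark t k (S' \ S₁) R with hg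
  have hS : ∀ A, prunedSum φ mark t (k + 1) A R = ∑ S' ∈ boxes φ Finset.univ A, g S' := fun A => rfl
  have hg0 : g ∅ = 0 := by
    have := prunedSum_empty φ mark t h0 (k + 1) R
    rw [hS] at this
    exact (Finset.sum_eq_zero_iff.1 this) ∅ (self_mem_boxes φ _ _)
  have herase : ∀ A, ∑ S' ∈ (boxes φ Finset.univ A).erase ∅, g S' =
      ∑ S' ∈ boxes φ Finset.univ A, g S' := fun A => Finset.sum_erase _ hg0
  have hle : ∀ A, prunedSum φ mark t k A R ≤ ∑ S' ∈ (boxes φ Finset.univ A).erase ∅, g S' := by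
    intro A
    rw [herase, ← hS]
    exact prunedSum_mono φ mark t k A R
  have hprod : prunedSum φ mark t k (S ∩ H) R * prunedSum φ mark t k (S ∩ H') R ≤ g S := by
    have hmem : S ∩ H ∈ cuts φ q S := by
      simp only [cuts, Finset.mem_filter, Finset.mem_powerset]
      exact ⟨Finset.inter_subset_left, H, hH, rfl⟩
    have hsd : S \ (S ∩ H) = S ∩ H' := by
      rw [hc]; ext i; simp
    rw [← hsd]
    calc _ ≤ ∑ S₁ ∈ cuts φ q S, prunedSum φ mark t k S₁ R * prunedSum φ mark t k (S \ S₁) R :=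
          Finset.single_le_sum
            (f := fun S₁ => prunedSum φ mark t k S₁ R * prunedSum φ mark t k (S \ S₁) R)
            (fun _ _ => zero_le) hmem
      _ ≤ ∑ q, ∑ S₁ ∈ cuts φ q S, prunedSum φ mark t k S₁ R * prunedSum φ mark t k (S \ S₁) R :=
          Finset.single_le_sum (f := fun q => ∑ S₁ ∈ cuts φ q S,
            prunedSum φ mark t k S₁ R * prunedSum φ mark t k (S \ S₁) R)
            (fun _ _ => zero_le) (Finset.mem_univ q)
      _ ≤ g S := le_add_self
  have hd1 : Disjoint ((boxes φ Finset.univ (S ∩ H)).erase ∅)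
      ((boxes φ Finset.univ (S ∩ H')).erase ∅) := by
    rw [Finset.disjoint_left]
    intro A hA hA'
    rw [Finset.mem_erase] at hA hA'
    exact hA.1 (Finset.subset_empty.1 (hdisj (boxes_subset φ hA.2) (boxes_subset φ hA'.2)))
  have hd2 : S ∉ ((boxes φ Finset.univ (S ∩ H)).erase ∅) ∪
      ((boxes φ Finset.univ (S ∩ H')).erase ∅) := by
    intro hmem
    rw [Finset.mem_union, Finset.mem_erase, Finset.mem_erase] at hmem
    rcases hmem with h | h
    · obtain ⟨i, hi⟩ := h2
      exact (Finset.disjoint_left.1 hdisj) (boxes_subset φ h.2 (Finset.mem_inter.1 hi).1) hi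
    · obtain ⟨i, hi⟩ := h1
      exact (Finset.disjoint_left.1 hdisj) hi (boxes_subset φ h.2 (Finset.mem_inter.1 hi).1)
  have hsub : insert S (((boxes φ Finset.univ (S ∩ H)).erase ∅) ∪
      ((boxes φ Finset.univ (S ∩ H')).erase ∅)) ⊆ boxes φ Finset.univ S := by
    intro A hA
    rw [Finset.mem_insert, Finset.mem_union] at hA
    rcases hA with rfl | hA | hA
    · exact self_mem_boxes φ _ _
    · exact boxes_inter_subset φ hH S (Finset.mem_of_mem_erase hA)
    · exact boxes_inter_subset φ hH' S (Finset.mem_of_mem_erase hA)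
  -- Expanding the product, the term with marked leaves on both sides occurs as a split in `g S`,
  -- and the terms with marked leaves on one side only are sums over boxes of `S ∩ H` and `S ∩ H'`,
  -- which are boxes of `S` too. With the empty box removed, these families and `S` itself are
  -- disjoint, so nothing is counted twice. This is why both sides had to be nonempty.
  calc (1 + prunedSum φ mark t k (S ∩ H) R) * (1 + prunedSum φ mark t k (S ∩ H') R)
      = 1 + (prunedSum φ mark t k (S ∩ H) R * prunedSum φ mark t k (S ∩ H') R +
          (prunedSum φ mark t k (S ∩ H) R + prunedSum φ mark t k (S ∩ H') R)) := by ring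
    _ ≤ 1 + (g S + (∑ S' ∈ (boxes φ Finset.univ (S ∩ H)).erase ∅, g S' +
          ∑ S' ∈ (boxes φ Finset.univ (S ∩ H')).erase ∅, g S')) := by
        gcongr
        · exact hle _
        · exact hle _
    _ = 1 + ∑ S' ∈ insert S (((boxes φ Finset.univ (S ∩ H)).erase ∅) ∪
          ((boxes φ Finset.univ (S ∩ H')).erase ∅)), g S' := by
        rw [Finset.sum_insert hd2, Finset.sum_union hd1]
    _ ≤ 1 + ∑ S' ∈ boxes φ Finset.univ S, g S' := by
        gcongr
    _ = _ := by rw [hS]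

/-- Functions of the labels of two disjoint sets of points are independent. -/
theorem sum_mul_sum_of_disjoint {A B : Finset ι} (hAB : Disjoint A B) {f g : Finset ι → ℝ≥0}
    (hf : ∀ R, f (R ∩ A) = f R) (hg : ∀ R, g (R ∩ B) = g R) :
    (∑ R, f R) * ∑ R, g R = 2 ^ Fintype.card ι * ∑ R, f R * g R := by
  -- Two independent label sets exchange their parts outside `A`. This bijection keeps what `f` sees
  -- of the first set and lets `g` see the second set through the first.
  let σ : Finset ι × Finset ι → Finset ι × Finset ι :=
    fun p => ((p.1 ∩ A) ∪ (p.2 \ A), (p.2 ∩ A) ∪ (p.1 \ A))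
  have hσ : Function.Involutive σ := by
    rintro ⟨R₁, R₂⟩
    ext i
    · simp only [σ, Finset.mem_union, Finset.mem_inter, Finset.mem_sdiff]; tauto
    · simp only [σ, Finset.mem_union, Finset.mem_inter, Finset.mem_sdiff]; tauto
  have h1 : ∀ p : Finset ι × Finset ι, f (σ p).1 = f p.1 := by
    intro p
    rw [← hf p.1, ← hf (σ p).1]
    congr 1
    ext i
    simp only [σ, Finset.mem_union, Finset.mem_inter, Finset.mem_sdiff]; tauto
  have h2 : ∀ p : Finset ι × Finset ι, g (σ p).1 = g p.2 := by
    intro p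
    rw [← hg p.2, ← hg (σ p).1]
    congr 1
    ext i
    have := fun (h : i ∈ A) (h' : i ∈ B) => Finset.disjoint_left.1 hAB h h'
    simp only [σ, Finset.mem_union, Finset.mem_inter, Finset.mem_sdiff]; tauto
  calc (∑ R, f R) * ∑ R, g R = ∑ p : Finset ι × Finset ι, f p.1 * g p.2 := by
        rw [Finset.sum_mul_sum, Fintype.sum_prod_type]
    _ = ∑ p : Finset ι × Finset ι, f (σ p).1 * g (σ p).1 := by simp only [h1, h2]
    _ = ∑ p : Finset ι × Finset ι, f p.1 * g p.1 :=
        Equiv.sum_comp hσ.toPerm fun p : Finset ι × Finset ι => f p.1 * g p.1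
    _ = _ := by
        rw [Fintype.sum_prod_type]
        simp only [Finset.sum_const, Finset.card_univ, Fintype.card_finset, nsmul_eq_mul,
          Nat.cast_pow, Nat.cast_ofNat, Finset.mul_sum]

theorem markWeight_inter {S U : Finset ι} (hS : S ⊆ U) (R : Finset ι) :
    markWeight mark t S (R ∩ U) = markWeight mark t S R := by
  have h1 : S ∩ (R ∩ U) = S ∩ R := by
    ext i; have := @hS i; simp only [Finset.mem_inter]; tauto
  have h2 : S \ (R ∩ U) = S \ R := by
    ext i; have := @hS i; simp only [Finset.mem_inter, Finset.mem_sdiff]; tauto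
  simp only [markWeight, h1, h2]

theorem prunedSum_inter (k : ℕ) : ∀ {S U : Finset ι}, S ⊆ U → ∀ R : Finset ι,
    prunedSum φ mark t k S (R ∩ U) = prunedSum φ mark t k S R := by
  induction k with
  | zero => intros; rfl
  | succ k ih =>
    intro S U hS R
    rw [prunedSum, prunedSum]
    refine Finset.sum_congr rfl fun S' hS' => ?_
    have hS'U := (boxes_subset φ hS').trans hS
    congr 1
    · exact markWeight_inter mark t hS'U R
    · refine Finset.sum_congr rfl fun q _ => Finset.sum_congr rfl fun S₁ hS₁ => ?_
      rw [ih ((cuts_subset φ hS₁).trans hS'U), ih (Finset.sdiff_subset.trans hS'U)]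

/-- The mean of `prunedSum` over the uniformly random sets of real points. -/
noncomputable def meanPruned (k : ℕ) (S : Finset ι) : ℝ≥0 :=
  (∑ R, prunedSum φ mark t k S R) / 2 ^ Fintype.card ι

/-- Chernoff's bound: `b ^ M * c ^ N` dominates the indicator of a mark and is a product over the
points. With independent fair labels, a real point contributes `c` and a ghost point `t * b`, hence
the mean `(c + t * b) / 2` per point. -/
theorem sum_markWeight_le {b c : ℝ≥0} (hbc : ∀ N M, mark N M → 1 ≤ b ^ M * c ^ N)
    (S : Finset ι) :
    (∑ R, markWeight mark t S R) / 2 ^ Fintype.card ι ≤ ((c + t * b) / 2) ^ S.card := by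
  have h1 : ∀ R : Finset ι, markWeight mark t S R ≤
      (∏ i ∈ R, if i ∈ S then c else 1) * ∏ i ∈ Finset.univ \ R, if i ∈ S then t * b else 1 := by
    intro R
    have e1 : (∏ i ∈ R, if i ∈ S then c else 1) = c ^ (S ∩ R).card := by
      rw [Finset.prod_ite, Finset.prod_const, Finset.prod_const_one, mul_one,
        Finset.filter_mem_eq_inter, Finset.inter_comm]
    have e2 : (∏ i ∈ Finset.univ \ R, if i ∈ S then t * b else 1) = (t * b) ^ (S \ R).card := by
      rw [Finset.prod_ite, Finset.prod_const, Finset.prod_const_one, mul_one]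
      congr 2
      ext i; simp [and_comm]
    rw [e1, e2, markWeight]
    split_ifs with h
    · calc t ^ (S \ R).card ≤ t ^ (S \ R).card * (b ^ (S \ R).card * c ^ (S ∩ R).card) :=
            le_mul_of_one_le_right zero_le (hbc _ _ h)
        _ = _ := by rw [mul_pow]; ring
    · exact zero_le
  have h2 : ∑ R : Finset ι, (∏ i ∈ R, if i ∈ S then c else 1) *
      ∏ i ∈ Finset.univ \ R, (if i ∈ S then t * b else 1) =
      (c + t * b) ^ S.card * 2 ^ (Finset.univ \ S).card := by
    rw [← Finset.powerset_univ, ← Finset.prod_add]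
    have : ∀ i ∈ Finset.univ, ((if i ∈ S then c else 1) + if i ∈ S then t * b else 1) =
        if i ∈ S then c + t * b else 2 := by
      intro i _
      split_ifs
      · rfl
      · norm_num
    rw [Finset.prod_congr rfl this, Finset.prod_ite, Finset.prod_const, Finset.prod_const]
    congr 3
    · ext i; simp
    · ext i; simp
  have hcard : (Finset.univ \ S).card + S.card = Fintype.card ι := by
    rw [Finset.card_sdiff_add_card_eq_card (Finset.subset_univ S), Finset.card_univ]
  rw [div_le_iff₀ (by positivity), div_pow]
  calc _ ≤ _ := Finset.sum_le_sum fun R _ => h1 R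
    _ = _ := h2
    _ = _ := by
      rw [← hcard, pow_add]
      field_simp

theorem meanPruned_mul (k : ℕ) {A B : Finset ι} (hAB : Disjoint A B) :
    (∑ R, prunedSum φ mark t k A R * prunedSum φ mark t k B R) / 2 ^ Fintype.card ι =
      meanPruned φ mark t k A * meanPruned φ mark t k B := by
  have := sum_mul_sum_of_disjoint hAB (f := prunedSum φ mark t k A) (g := prunedSum φ mark t k B)
    (fun R => prunedSum_inter φ mark t k subset_rfl R)
    (fun R => prunedSum_inter φ mark t k subset_rfl R)
  rw [meanPruned, meanPruned, div_mul_div_comm, this]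
  field_simp

/-- The largest value of `meanPruned` over the sets of `N` points. -/
noncomputable def maxPruned (k N : ℕ) : ℝ≥0 :=
  (Finset.univ.powersetCard N).sup (meanPruned φ mark t k)

theorem meanPruned_le_maxPruned (k : ℕ) (S : Finset ι) :
    meanPruned φ mark t k S ≤ maxPruned φ mark t k S.card :=
  Finset.le_sup (f := meanPruned φ mark t k)
    (Finset.mem_powersetCard.2 ⟨Finset.subset_univ S, rfl⟩)

/-- The recursion of `prunedSum` is averaged over the labels. The two sides of a split carry
independent labels, so their means multiply, and indexing the cuts by size gives a convolution; the
passage to a box costs one partial sum per direction. -/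
theorem maxPruned_succ_le {b c : ℝ≥0} {n₀ : ℕ} (hbc : ∀ N M, mark N M → 1 ≤ b ^ M * c ^ N)
    (hn₀ : ∀ N M, mark N M → n₀ ≤ N + M) (k N : ℕ) :
    maxPruned φ mark t (k + 1) N ≤ partialSum^[Fintype.card Q]
      (fun m => (if n₀ ≤ m then ((c + t * b) / 2) ^ m else 0) + Fintype.card Q *
        ∑ a ∈ Finset.range (m + 1), maxPruned φ mark t k a * maxPruned φ mark t k (m - a)) N := by
  set G : ℕ → ℝ≥0 := fun m => (if n₀ ≤ m then ((c + t * b) / 2) ^ m else 0) + Fintype.card Q *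
        ∑ a ∈ Finset.range (m + 1), maxPruned φ mark t k a * maxPruned φ mark t k (m - a)
  refine Finset.sup_le fun S hS => ?_
  obtain ⟨-, rfl⟩ := Finset.mem_powersetCard.1 hS
  refine le_trans ?_ (sum_boxes_le φ Finset.univ G S)
  have hexp : meanPruned φ mark t (k + 1) S = ∑ S' ∈ boxes φ Finset.univ S,
      ((∑ R, markWeight mark t S' R) / 2 ^ Fintype.card ι + ∑ q, ∑ S₁ ∈ cuts φ q S',
        (∑ R, prunedSum φ mark t k S₁ R * prunedSum φ mark t k (S' \ S₁) R) /
          2 ^ Fintype.card ι) := by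
    simp only [meanPruned, prunedSum, Finset.sum_div, add_div]
    rw [Finset.sum_comm]
    refine Finset.sum_congr rfl fun S' _ => ?_
    rw [Finset.sum_add_distrib]
    congr 1
    rw [Finset.sum_comm]
    refine Finset.sum_congr rfl fun q _ => ?_
    rw [Finset.sum_comm]
  rw [hexp]
  refine Finset.sum_le_sum fun S' _ => add_le_add ?_ ?_
  · split_ifs with h
    · exact sum_markWeight_le mark t hbc S'
    · have : ∀ R, markWeight mark t S' R = 0 := by
        intro R
        rw [markWeight, if_neg]
        intro hm
        refine h ((hn₀ _ _ hm).trans ?_)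
        rw [Finset.card_inter_add_card_sdiff]
      simp [this]
  · calc _ ≤ ∑ q : Q, ∑ a ∈ Finset.range (S'.card + 1),
          maxPruned φ mark t k a * maxPruned φ mark t k (S'.card - a) := by
          refine Finset.sum_le_sum fun q _ => ?_
          refine le_trans ?_ (sum_cuts_le φ q S' fun a =>
            maxPruned φ mark t k a * maxPruned φ mark t k (S'.card - a))
          refine Finset.sum_le_sum fun S₁ hS₁ => ?_
          rw [meanPruned_mul φ mark t k Finset.disjoint_sdiff,
            ← Finset.card_sdiff_of_subset (cuts_subset φ hS₁)]
          gcongr <;> exact meanPruned_le_maxPruned _ _ _ _ _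
      _ = _ := by rw [Finset.sum_const, Finset.card_univ, nsmul_eq_mul]

theorem sum_pow_mul_conv_le (z : ℝ≥0) (W : ℕ → ℝ≥0) (n : ℕ) :
    ∑ m ∈ Finset.range n, z ^ m * ∑ a ∈ Finset.range (m + 1), W a * W (m - a) ≤
      (∑ a ∈ Finset.range n, z ^ a * W a) ^ 2 := by
  rw [sq, Finset.sum_mul_sum, ← Finset.sum_product']
  calc ∑ m ∈ Finset.range n, z ^ m * ∑ a ∈ Finset.range (m + 1), W a * W (m - a)
      = ∑ m ∈ Finset.range n, ∑ p ∈ Finset.HasAntidiagonal.antidiagonal m,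
          (z ^ p.1 * W p.1) * (z ^ p.2 * W p.2) := by
        refine Finset.sum_congr rfl fun m _ => ?_
        rw [Finset.Nat.sum_antidiagonal_eq_sum_range_succ
          (fun a b => (z ^ a * W a) * (z ^ b * W b)), Finset.mul_sum]
        refine Finset.sum_congr rfl fun a ha => ?_
        have : a ≤ m := Nat.lt_succ_iff.1 (Finset.mem_range.1 ha)
        conv_lhs => rw [← Nat.add_sub_cancel' this, pow_add]
        rw [Nat.add_sub_cancel' this]
        ring
    _ = ∑ p ∈ (Finset.range n).biUnion Finset.HasAntidiagonal.antidiagonal,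
          (z ^ p.1 * W p.1) * (z ^ p.2 * W p.2) := by
        rw [Finset.sum_biUnion]
        intro a _ b _ hab
        rw [Function.onFun, Finset.disjoint_left]
        intro p hp hp'
        rw [Finset.HasAntidiagonal.mem_antidiagonal] at hp hp'
        exact hab (hp.symm.trans hp')
    _ ≤ _ := by
        refine Finset.sum_le_sum_of_subset fun p hp => ?_
        rw [Finset.mem_biUnion] at hp
        obtain ⟨m, hm, hp⟩ := hp
        rw [Finset.HasAntidiagonal.mem_antidiagonal] at hp
        rw [Finset.mem_range] at hm
        rw [Finset.mem_product, Finset.mem_range, Finset.mem_range]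
        omega

/-- The generating function bound. -/
theorem sum_pow_mul_maxPruned_le {b c z C Y κ : ℝ≥0} {n₀ : ℕ}
    (hbc : ∀ N M, mark N M → 1 ≤ b ^ M * c ^ N) (hn₀ : ∀ N M, mark N M → n₀ ≤ N + M)
    (hC : ∀ n, ∑ p ∈ Finset.range n, z ^ p ≤ C)
    (hY : ∀ n, ∑ m ∈ Finset.range n, z ^ m * (if n₀ ≤ m then ((c + t * b) / 2) ^ m else 0) ≤ Y)
    (hκ : C ^ Fintype.card Q * (Y + Fintype.card Q * κ ^ 2) ≤ κ) (k n : ℕ) :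
    ∑ N ∈ Finset.range n, z ^ N * maxPruned φ mark t k N ≤ κ := by
  induction k with
  | zero =>
    have : ∀ N, maxPruned φ mark t 0 N = 0 := by
      intro N
      refine le_antisymm (Finset.sup_le fun S _ => ?_) zero_le
      simp [meanPruned, prunedSum]
    simp [this]
  | succ k ih =>
    -- `κ` is a supersolution of the quadratic recursion satisfied by the generating functions, so
    -- the bound passes from depth `k` to depth `k + 1` and is uniform in the depth.
    refine le_trans ?_ hκ
    calc _ ≤ _ := Finset.sum_le_sum fun N _ =>
          mul_le_mul_right (maxPruned_succ_le φ mark t hbc hn₀ k N) (z ^ N)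
      _ ≤ _ := sum_pow_mul_partialSum_iterate_le hC _ n _
      _ ≤ _ := by
        refine mul_le_mul_right ?_ _
        simp only [mul_add, Finset.sum_add_distrib]
        refine add_le_add (hY n) ?_
        calc _ = (Fintype.card Q : ℝ≥0) * ∑ m ∈ Finset.range n, z ^ m *
              ∑ a ∈ Finset.range (m + 1),
                maxPruned φ mark t k a * maxPruned φ mark t k (m - a) := by
              rw [Finset.mul_sum]
              exact Finset.sum_congr rfl fun m _ => by ring
          _ ≤ _ := by
            refine mul_le_mul_right ((sum_pow_mul_conv_le z _ n).trans ?_) _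
            gcongr

/-- A single coefficient of the generating function, that of the full point set, is at most the
whole sum. The price is the factor `z ^ Fintype.card ι`, harmless when `z` is close to 1. -/
theorem pow_mul_sum_prunedSum_le {b c z C Y κ : ℝ≥0} {n₀ : ℕ}
    (hbc : ∀ N M, mark N M → 1 ≤ b ^ M * c ^ N) (hn₀ : ∀ N M, mark N M → n₀ ≤ N + M)
    (hC : ∀ n, ∑ p ∈ Finset.range n, z ^ p ≤ C)
    (hY : ∀ n, ∑ m ∈ Finset.range n, z ^ m * (if n₀ ≤ m then ((c + t * b) / 2) ^ m else 0) ≤ Y)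
    (hκ : C ^ Fintype.card Q * (Y + Fintype.card Q * κ ^ 2) ≤ κ) (k : ℕ) :
    z ^ Fintype.card ι * ∑ R, prunedSum φ mark t k Finset.univ R ≤ 2 ^ Fintype.card ι * κ := by
  have h1 := sum_pow_mul_maxPruned_le φ mark t hbc hn₀ hC hY hκ k (Fintype.card ι + 1)
  have h2 := Finset.single_le_sum (f := fun N => z ^ N * maxPruned φ mark t k N)
    (fun _ _ => zero_le) (Finset.self_mem_range_succ (Fintype.card ι))
  have h3 := meanPruned_le_maxPruned φ mark t k Finset.univ
  rw [Finset.card_univ] at h3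
  have h4 : ∑ R, prunedSum φ mark t k Finset.univ R =
      2 ^ Fintype.card ι * meanPruned φ mark t k Finset.univ := by
    rw [meanPruned]; field_simp
  calc _ = 2 ^ Fintype.card ι * (z ^ Fintype.card ι * meanPruned φ mark t k Finset.univ) := by
        rw [h4]; ring
    _ ≤ 2 ^ Fintype.card ι * κ := by
      gcongr
      exact (mul_le_mul_right h3 _).trans (h2.trans h1)

end BoxEntropy

/-! ### Counts of points in the marked leaves of a tree -/

section TreeEntropy

variable {d : ℕ} {ι : Type*} [Fintype ι] [DecidableEq ι] (x : ι → Cov d)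
  (mark : ℕ → ℕ → Prop) [∀ N M, Decidable (mark N M)]

/-- The number of points of `S` outside `R` that lie in marked leaves of the tree. -/
noncomputable def markedCount : SplitTree d → Finset ι → Finset ι → ℕ
  | .leaf, S, R => if mark (S ∩ R).card (S \ R).card then (S \ R).card else 0
  | .node j c l r, S, R =>
      markedCount l (S.filter fun i => x i j ≤ c) R + markedCount r (S.filter fun i => c < x i j) R

/-- The depth of a tree. -/
def SplitTree.depth : SplitTree d → ℕ
  | .leaf => 0
  | .node _ _ l r => max l.depth r.depth + 1

/-- The directions of axis-aligned half-spaces. -/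
def halfSpace (q : Fin d × Bool) (i : ι) : ℝ := if q.2 then x i q.1 else -x i q.1

/-- At a node the counts add, so the powers multiply, and `one_add_prunedSum_mul_le` absorbs the
product into one more level. The summand 1 stands for the trees without marked leaves. -/
theorem pow_markedCount_le {t : ℝ≥0} (h0 : ¬ mark 0 0) (T : SplitTree d) :
    ∀ (k : ℕ), T.depth < k → ∀ S R : Finset ι,
      t ^ markedCount x mark T S R ≤ 1 + prunedSum (halfSpace x) mark t k S R := by
  induction T with
  | leaf =>
    intro k hk S R
    obtain ⟨k, rfl⟩ : ∃ m, k = m + 1 := ⟨k - 1, by simp only [SplitTree.depth] at hk; omega⟩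
    have h1 : markWeight mark t S R ≤ prunedSum (halfSpace x) mark t (k + 1) S R := by
      rw [prunedSum]
      refine le_trans le_self_add (Finset.single_le_sum (f := fun S' => markWeight mark t S' R +
        ∑ q, ∑ S₁ ∈ cuts (halfSpace x) q S', prunedSum (halfSpace x) mark t k S₁ R *
          prunedSum (halfSpace x) mark t k (S' \ S₁) R) (fun _ _ => zero_le)
        (self_mem_boxes (halfSpace x) _ S))
    refine le_trans ?_ (add_le_add_right h1 1)
    rw [markedCount, markWeight]
    split_ifs
    · exact le_add_self
    · simp
  | node j c l r ihl ihr =>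
    intro k hk S R
    obtain ⟨k, rfl⟩ : ∃ m, k = m + 1 := ⟨k - 1, by simp only [SplitTree.depth] at hk; omega⟩
    simp only [SplitTree.depth] at hk
    have hH : IsCut (halfSpace x (j, true)) (Finset.univ.filter fun i => x i j ≤ c) := by
      intro i i' h hi
      simp only [halfSpace, if_true, Finset.mem_filter, Finset.mem_univ, true_and] at *
      exact h.trans hi
    have hH' : IsCut (halfSpace x (j, false)) (Finset.univ.filter fun i => c < x i j) := by
      intro i i' h hi
      simp only [halfSpace, Finset.mem_filter, Finset.mem_univ, true_and, Bool.false_eq_true,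
        if_false, neg_le_neg_iff] at *
      exact hi.trans_le h
    have key := one_add_prunedSum_mul_le (halfSpace x) mark t h0 k hH hH'
      (by ext i; simp) S R
    have e1 : (S.filter fun i => x i j ≤ c) = S ∩ Finset.univ.filter fun i => x i j ≤ c := by
      ext; simp
    have e2 : (S.filter fun i => c < x i j) = S ∩ Finset.univ.filter fun i => c < x i j := by
      ext; simp
    rw [markedCount, pow_add]
    refine le_trans (mul_le_mul' (ihl k (by omega) _ R) (ihr k (by omega) _ R)) ?_
    rw [e1, e2]
    exact key

/-- Exponential moment of the number of points in marked leaves of the worst trees, for uniformly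
random sets of real points. -/
theorem sum_pow_markedCount_le {t b c z C Y κ : ℝ≥0} {n₀ : ℕ} (h0 : ¬ mark 0 0)
    (hbc : ∀ N M, mark N M → 1 ≤ b ^ M * c ^ N) (hn₀ : ∀ N M, mark N M → n₀ ≤ N + M)
    (hC : ∀ n, ∑ p ∈ Finset.range n, z ^ p ≤ C)
    (hY : ∀ n, ∑ m ∈ Finset.range n, z ^ m * (if n₀ ≤ m then ((c + t * b) / 2) ^ m else 0) ≤ Y)
    (hκ : C ^ (2 * d) * (Y + (2 * d : ℕ) * κ ^ 2) ≤ κ) (T : Finset ι → SplitTree d) :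
    z ^ Fintype.card ι * ∑ R, t ^ markedCount x mark (T R) Finset.univ R ≤
      2 ^ Fintype.card ι * (z ^ Fintype.card ι + κ) := by
  -- The tree may depend on the label set, but there are only finitely many label sets, and the
  -- bound for depth below `k` does not depend on `k`.
  obtain ⟨k, hk⟩ : ∃ k, ∀ R, (T R).depth < k :=
    ⟨(Finset.univ.sup fun R => (T R).depth) + 1, fun R =>
      Nat.lt_succ_of_le (Finset.le_sup (f := fun R => (T R).depth) (Finset.mem_univ R))⟩
  have hcard : Fintype.card (Fin d × Bool) = 2 * d := by simp [mul_comm]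
  have hmain := pow_mul_sum_prunedSum_le (halfSpace x) mark t hbc hn₀ hC hY
    (by rw [hcard]; exact hκ) k
  calc _ ≤ z ^ Fintype.card ι * ∑ R, (1 + prunedSum (halfSpace x) mark t k Finset.univ R) := by
        gcongr with R
        exact pow_markedCount_le x mark h0 (T R) k (hk R) _ R
    _ = 2 ^ Fintype.card ι * z ^ Fintype.card ι +
          z ^ Fintype.card ι * ∑ R, prunedSum (halfSpace x) mark t k Finset.univ R := by
        rw [Finset.sum_add_distrib]
        simp only [Finset.sum_const, Finset.card_univ, Fintype.card_finset, nsmul_eq_mul, mul_one,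
          Nat.cast_pow, Nat.cast_ofNat]
        ring
    _ ≤ _ := by rw [mul_add]; gcongr

open Classical in
-- The points of a leaf are counted together or not at all, so the recursive count can be read point
-- by point: a point outside `R` counts if the leaf containing it is marked. In this form it meets
-- `leafCount`.
theorem markedCount_eq (T : SplitTree d) : ∀ S R : Finset ι,
    markedCount x mark T S R = ((S \ R).filter fun k =>
      mark ((S ∩ R).filter fun i => x i ∈ T.leafAt (x k)).card
        ((S \ R).filter fun i => x i ∈ T.leafAt (x k)).card).card := by
  induction T with
  | leaf =>
    intro S R
    simp only [markedCount, SplitTree.leafAt, Set.mem_univ, Finset.filter_true]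
    split_ifs with h <;> simp [h]
  | node j c l r ihl ihr =>
    intro S R
    rw [markedCount, ihl, ihr, ← Finset.card_union_of_disjoint]
    · congr 1
      ext k
      simp only [Finset.mem_union, Finset.mem_filter, Finset.mem_sdiff, SplitTree.leafAt]
      by_cases hk : x k j ≤ c
      · have hk' : ¬ c < x k j := not_lt.2 hk
        have e1 : ((Finset.filter (fun i => x i j ≤ c) S ∩ R).filter
            fun i => x i ∈ l.leafAt (x k)) = (S ∩ R).filter
            fun i => x i ∈ {y : Cov d | y j ≤ c} ∩ l.leafAt (x k) := by
          ext i; simp only [Finset.mem_filter, Finset.mem_inter, Set.mem_inter_iff,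
            Set.mem_ofPred_eq]; tauto
        have e2 : ((Finset.filter (fun i => x i j ≤ c) S \ R).filter
            fun i => x i ∈ l.leafAt (x k)) = (S \ R).filter
            fun i => x i ∈ {y : Cov d | y j ≤ c} ∩ l.leafAt (x k) := by
          ext i; simp only [Finset.mem_filter, Finset.mem_sdiff, Set.mem_inter_iff,
            Set.mem_ofPred_eq]; tauto
        simp only [hk, hk', if_true, e1, e2, and_true, and_false, false_and, or_false]
      · have hk' : c < x k j := not_le.1 hk
        have e1 : ((Finset.filter (fun i => c < x i j) S ∩ R).filter
            fun i => x i ∈ r.leafAt (x k)) = (S ∩ R).filter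
            fun i => x i ∈ {y : Cov d | c < y j} ∩ r.leafAt (x k) := by
          ext i; simp only [Finset.mem_filter, Finset.mem_inter, Set.mem_inter_iff,
            Set.mem_ofPred_eq]; tauto
        have e2 : ((Finset.filter (fun i => c < x i j) S \ R).filter
            fun i => x i ∈ r.leafAt (x k)) = (S \ R).filter
            fun i => x i ∈ {y : Cov d | c < y j} ∩ r.leafAt (x k) := by
          ext i; simp only [Finset.mem_filter, Finset.mem_sdiff, Set.mem_inter_iff,
            Set.mem_ofPred_eq]; tauto
        simp only [hk, hk', if_false, e1, e2, and_true, and_false, false_and, false_or]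
    · rw [Finset.disjoint_left]
      intro i hi hi'
      simp only [Finset.mem_filter, Finset.mem_sdiff] at hi hi'
      exact absurd hi.1.1.2 (not_le.2 hi'.1.1.2)

end TreeEntropy

/-! ### Ghost samples -/

section Ghost

/-- Averaging over the sets of `s` real points among `2 s` points. -/
theorem sum_markedCount_le {d : ℕ} {ι : Type*} [Fintype ι] [DecidableEq ι] (x : ι → Cov d)
    (mark : ℕ → ℕ → Prop) [∀ N M, Decidable (mark N M)] {s : ℕ} (hs : 0 < s)
    (hcard : Fintype.card ι = 2 * s) {t b c z C Y κ : ℝ≥0} {n₀ : ℕ} (ht : 1 < t) (hz : 0 < z)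
    (h0 : ¬ mark 0 0)
    (hbc : ∀ N M, mark N M → 1 ≤ b ^ M * c ^ N) (hn₀ : ∀ N M, mark N M → n₀ ≤ N + M)
    (hC : ∀ n, ∑ p ∈ Finset.range n, z ^ p ≤ C)
    (hY : ∀ n, ∑ m ∈ Finset.range n, z ^ m * (if n₀ ≤ m then ((c + t * b) / 2) ^ m else 0) ≤ Y)
    (hκ : C ^ (2 * d) * (Y + (2 * d : ℕ) * κ ^ 2) ≤ κ) (T : Finset ι → SplitTree d) :
    ∑ R ∈ Finset.univ.powersetCard s, (markedCount x mark (T R) Finset.univ R : ℝ) ≤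
      Nat.choose (2 * s) s *
        ((2 * s * ((z : ℝ)⁻¹ - 1) + 2 * √(2 * s * κ)) / Real.log t) := by
  have hmain := sum_pow_markedCount_le x mark (t := t) h0 hbc hn₀ hC hY hκ T
  rw [hcard] at hmain
  have hz' : (0 : ℝ) < z := hz
  have ht' : (1 : ℝ) < t := ht
  have hlog : 0 < Real.log t := Real.log_pos ht'
  set v : Finset ι → ℕ := fun R => markedCount x mark (T R) Finset.univ R with hv
  have hmain' : (z : ℝ) ^ (2 * s) * ∑ R, (t : ℝ) ^ v R ≤ 2 ^ (2 * s) * (z ^ (2 * s) + κ) := by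
    exact_mod_cast hmain
  set u : ℝ := κ * ((z : ℝ)⁻¹) ^ (2 * s) with hu
  have hu0 : 0 ≤ u := by positivity
  have h1 : ∑ R, ((t : ℝ) ^ v R - 1) ≤ 2 ^ (2 * s) * u := by
    rw [Finset.sum_sub_distrib]
    have : ∑ R, (t : ℝ) ^ v R ≤ 2 ^ (2 * s) * (1 + u) := by
      have hzp : (0 : ℝ) < (z : ℝ) ^ (2 * s) := by positivity
      rw [← mul_le_mul_iff_right₀ hzp]
      refine hmain'.trans (le_of_eq ?_)
      rw [hu, inv_pow]
      field_simp
    simp only [Finset.sum_const, Finset.card_univ, Fintype.card_finset, hcard, nsmul_eq_mul,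
      mul_one]
    push_cast
    linarith
  have h2 : ∑ R ∈ Finset.univ.powersetCard s, ((t : ℝ) ^ v R - 1) ≤ 2 ^ (2 * s) * u := by
    refine le_trans (Finset.sum_le_sum_of_subset_of_nonneg (Finset.subset_univ _) ?_) h1
    intro R _ _
    rw [sub_nonneg]
    exact one_le_pow₀ ht'.le
  set ch : ℝ := (Nat.choose (2 * s) s : ℝ) with hch
  have hch0 : 0 ≤ ch := by positivity
  -- The entropy bound averages over all label sets, whereas exactly `s` points are real. The
  -- central binomial coefficient is at least `4 ^ s / (2 * s)`, so conditioning on the size costs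
  -- only the factor `2 * s`.
  have h4 : (2 : ℝ) ^ (2 * s) ≤ 2 * s * ch := by
    have := Nat.four_pow_le_two_mul_self_mul_centralBinom s hs
    rw [Nat.centralBinom] at this
    rw [pow_mul, hch]; norm_num
    exact_mod_cast this
  set w : ℝ := 2 * s * u with hw
  have hw0 : 0 ≤ w := by positivity
  have h5 : ∑ R ∈ Finset.univ.powersetCard s, ((t : ℝ) ^ v R - 1) ≤ ch * w := by
    refine h2.trans ?_
    calc (2 : ℝ) ^ (2 * s) * u ≤ (2 * s * ch) * u := by gcongr
      _ = ch * w := by rw [hw]; ring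
  have hcardR : ((Finset.univ.powersetCard s : Finset (Finset ι)).card : ℝ) = ch := by
    rw [Finset.card_powersetCard, Finset.card_univ, hcard]
  set Lg : ℝ := Real.log (1 + w) with hLg
  -- Jensen's inequality for the logarithm, through its tangent at `1 + w`: the mean of `v` is at
  -- most the logarithm of the exponential moment, divided by `log t`.
  have h6 : ∀ R, Real.log t * v R ≤ Lg - 1 + (t : ℝ) ^ v R / (1 + w) := by
    intro R
    have hexp : Real.exp (Real.log t * v R - Lg) = (t : ℝ) ^ v R / (1 + w) := by
      rw [Real.exp_sub, hLg, Real.exp_log (by positivity), mul_comm, Real.exp_nat_mul,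
        Real.exp_log (by positivity)]
    have := Real.add_one_le_exp (Real.log t * v R - Lg)
    rw [hexp] at this
    linarith
  have h7 : Real.log t * ∑ R ∈ Finset.univ.powersetCard s, (v R : ℝ) ≤ ch * Lg := by
    rw [Finset.mul_sum]
    calc _ ≤ ∑ R ∈ Finset.univ.powersetCard s, (Lg - 1 + (t : ℝ) ^ v R / (1 + w)) :=
          Finset.sum_le_sum fun R _ => h6 R
      _ = ch * (Lg - 1) + (∑ R ∈ Finset.univ.powersetCard s, ((t : ℝ) ^ v R - 1) + ch) /
            (1 + w) := by
          rw [Finset.sum_add_distrib, Finset.sum_const, nsmul_eq_mul, hcardR, ← Finset.sum_div]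
          congr 2
          rw [Finset.sum_sub_distrib, Finset.sum_const, nsmul_eq_mul, hcardR]
          ring
      _ ≤ ch * (Lg - 1) + (ch * w + ch) / (1 + w) := by gcongr
      _ = ch * Lg := by field_simp; ring
  have h8 : Lg ≤ 2 * s * ((z : ℝ)⁻¹ - 1) + 2 * √(2 * s * κ) := by
    have hz1 : (z : ℝ) ≤ 1 := by
      by_contra! hlt
      have := hC (⌈C⌉₊ + 1)
      have h : ((⌈C⌉₊ + 1 : ℕ) : ℝ≥0) ≤ ∑ p ∈ Finset.range (⌈C⌉₊ + 1), z ^ p := by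
        calc ((⌈C⌉₊ + 1 : ℕ) : ℝ≥0) = ∑ p ∈ Finset.range (⌈C⌉₊ + 1), 1 := by simp
          _ ≤ _ := Finset.sum_le_sum fun p _ => one_le_pow₀ (by exact_mod_cast hlt.le)
      have h' : ((⌈C⌉₊ + 1 : ℕ) : ℝ≥0) ≤ C := h.trans this
      push_cast at h'
      exact absurd (lt_of_le_of_lt (Nat.le_ceil C) (lt_add_one _)) (not_lt.2 h')
    have hzi : 1 ≤ (z : ℝ)⁻¹ := (one_le_inv₀ hz').2 hz1
    -- The exponential part is split off; the logarithm of the remaining factor is at most of order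
    -- `√s`.
    have e1 : 1 + w ≤ ((z : ℝ)⁻¹) ^ (2 * s) * (1 + √(2 * s * κ)) ^ 2 := by
      have hsq : √(2 * s * κ) ^ 2 = 2 * s * κ := Real.sq_sqrt (by positivity)
      have hp : 1 ≤ ((z : ℝ)⁻¹) ^ (2 * s) := one_le_pow₀ hzi
      have : w = ((z : ℝ)⁻¹) ^ (2 * s) * (2 * s * κ) := by rw [hw, hu]; ring
      rw [this]
      have hnn : 0 ≤ ((z : ℝ)⁻¹) ^ (2 * s) * (2 * √(2 * s * κ)) := by positivity
      calc _ ≤ ((z : ℝ)⁻¹) ^ (2 * s) + ((z : ℝ)⁻¹) ^ (2 * s) * (2 * s * κ) +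
            ((z : ℝ)⁻¹) ^ (2 * s) * (2 * √(2 * s * κ)) := by linarith
        _ = ((z : ℝ)⁻¹) ^ (2 * s) * (1 + 2 * √(2 * s * κ) + √(2 * s * κ) ^ 2) := by
            rw [hsq]; ring
        _ = _ := by ring
    calc Lg ≤ Real.log (((z : ℝ)⁻¹) ^ (2 * s) * (1 + √(2 * s * κ)) ^ 2) :=
          Real.log_le_log (by positivity) e1
      _ = (2 * s : ℕ) * Real.log ((z : ℝ)⁻¹) + (2 : ℕ) * Real.log (1 + √(2 * s * κ)) := by
          rw [Real.log_mul (by positivity) (by positivity), Real.log_pow, Real.log_pow]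
      _ ≤ (2 * s : ℕ) * ((z : ℝ)⁻¹ - 1) + (2 : ℕ) * √(2 * s * κ) := by
          gcongr
          · exact Real.log_le_sub_one_of_pos (by positivity)
          · have := Real.log_le_sub_one_of_pos (x := 1 + √(2 * s * κ)) (by positivity)
            linarith
      _ = _ := by push_cast; ring
  rw [← mul_div_assoc, le_div_iff₀ hlog, mul_comm]
  exact h7.trans (mul_le_mul_of_nonneg_left h8 hch0)

/-- Permuting coordinates is a measurable equivalence that preserves the product measure, so `f`
need not be measurable. This allows the use for suprema over all trees. -/
theorem lintegral_pi_comp_perm {ι E : Type*} [Fintype ι] [MeasurableSpace E] (μ : Measure E)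
    [SigmaFinite μ] (σ : Equiv.Perm ι) (f : (ι → E) → ℝ≥0∞) :
    ∫⁻ x, f (x ∘ σ) ∂(Measure.pi fun _ => μ) = ∫⁻ x, f x ∂(Measure.pi fun _ => μ) := by
  have h := Measure.pi_map_piCongrLeft σ.symm (β := fun _ : ι => E) (fun _ => μ)
  conv_rhs => rw [← h, lintegral_map_equiv]
  refine lintegral_congr fun x => ?_
  congr 1
  ext i
  have := Equiv.piCongrLeft_apply_apply (fun _ : ι => E) σ.symm x (σ i)
  simp only [Equiv.symm_apply_apply] at this
  exact this.symm

theorem markedCount_comp_perm {d : ℕ} {ι : Type*} [Fintype ι] [DecidableEq ι] (x : ι → Cov d)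
    (mark : ℕ → ℕ → Prop) [∀ N M, Decidable (mark N M)] (σ : Equiv.Perm ι) (T : SplitTree d) :
    ∀ S R : Finset ι, markedCount (x ∘ σ) mark T S R =
      markedCount x mark T (S.map σ.toEmbedding) (R.map σ.toEmbedding) := by
  induction T with
  | leaf =>
    intro S R
    simp only [markedCount]
    rw [← Finset.map_inter, ← Finset.map_sdiff, Finset.card_map, Finset.card_map]
  | node j c l r ihl ihr =>
    intro S R
    simp only [markedCount, ihl, ihr]
    congr 2
    · rw [Finset.filter_map]; rfl
    · rw [Finset.filter_map]; rfl

theorem markedCount_le {d : ℕ} {ι : Type*} [Fintype ι] [DecidableEq ι] (x : ι → Cov d)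
    (mark : ℕ → ℕ → Prop) [∀ N M, Decidable (mark N M)] (T : SplitTree d) (S R : Finset ι) :
    markedCount x mark T S R ≤ Fintype.card ι := by
  classical
  rw [markedCount_eq]
  exact Finset.card_le_univ _

/-- The number of points in marked leaves of the worst tree. -/
noncomputable def maxMarked {d : ℕ} {ι : Type*} [Fintype ι] [DecidableEq ι]
    (mark : ℕ → ℕ → Prop) [∀ N M, Decidable (mark N M)] (x : ι → Cov d) (R : Finset ι) : ℕ :=
  sSup (Set.range fun T => markedCount x mark T Finset.univ R)

section MaxMarked

variable {d : ℕ} {ι : Type*} [Fintype ι] [DecidableEq ι] (mark : ℕ → ℕ → Prop)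
  [∀ N M, Decidable (mark N M)]

theorem bddAbove_markedCount (x : ι → Cov d) (R : Finset ι) :
    BddAbove (Set.range fun T => markedCount x mark T Finset.univ R) :=
  ⟨Fintype.card ι, by rintro _ ⟨T, rfl⟩; exact markedCount_le x mark T _ R⟩

theorem markedCount_le_maxMarked (x : ι → Cov d) (R : Finset ι) (T : SplitTree d) :
    markedCount x mark T Finset.univ R ≤ maxMarked mark x R :=
  le_csSup (bddAbove_markedCount mark x R) ⟨T, rfl⟩

theorem exists_markedCount_eq (x : ι → Cov d) (R : Finset ι) :
    ∃ T, markedCount x mark T Finset.univ R = maxMarked mark x R :=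
  have : Nonempty (SplitTree d) := ⟨SplitTree.leaf⟩
  Nat.sSup_mem (Set.range_nonempty fun T => markedCount x mark T Finset.univ R)
    (bddAbove_markedCount mark x R)

/-- The tree of a learner is fitted to the real points and has no symmetry in the pooled sample. The
worst tree has: permuting the points amounts to permuting the labels. -/
theorem maxMarked_comp_perm (x : ι → Cov d) (σ : Equiv.Perm ι) (R : Finset ι) :
    maxMarked mark (x ∘ σ) R = maxMarked mark x (R.map σ.toEmbedding) := by
  simp only [maxMarked, markedCount_comp_perm, Finset.map_univ_equiv]

/-- Symmetrization. -/
theorem lintegral_maxMarked_le {E : Type*} [MeasurableSpace E] (μ : Measure E)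
    [IsProbabilityMeasure μ] (f : E → Cov d) {s : ℕ} (hcard : Fintype.card ι = 2 * s) {K : ℝ}
    (hK : ∀ (x : ι → Cov d) (T : Finset ι → SplitTree d),
      ∑ R ∈ Finset.univ.powersetCard s, (markedCount x mark (T R) Finset.univ R : ℝ) ≤
        Nat.choose (2 * s) s * K) (R₀ : Finset ι) (hR₀ : R₀.card = s) :
    ∫⁻ x, (maxMarked mark (f ∘ x) R₀ : ℝ≥0∞) ∂(Measure.pi fun _ : ι => μ) ≤ ENNReal.ofReal K := by
  have hR : ∀ R ∈ (Finset.univ.powersetCard s : Finset (Finset ι)),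
      ∫⁻ x, (maxMarked mark (f ∘ x) R : ℝ≥0∞) ∂(Measure.pi fun _ : ι => μ) =
        ∫⁻ x, (maxMarked mark (f ∘ x) R₀ : ℝ≥0∞) ∂(Measure.pi fun _ : ι => μ) := by
    intro R hR
    rw [Finset.mem_powersetCard] at hR
    obtain ⟨σ, hσ⟩ : ∃ σ : Equiv.Perm ι, R₀.map σ.toEmbedding = R := by
      have e : {i // i ∈ R₀} ≃ {i // i ∈ R} := Fintype.equivOfCardEq (by simp [hR.2, hR₀])
      refine ⟨e.extendSubtype, ?_⟩
      refine Finset.eq_of_subset_of_card_le ?_ (by rw [Finset.card_map, hR.2, hR₀])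
      intro i hi
      rw [Finset.mem_map] at hi
      obtain ⟨j, hj, rfl⟩ := hi
      have := e.extendSubtype_mem j hj
      exact this
    rw [← lintegral_pi_comp_perm μ σ fun x => (maxMarked mark (f ∘ x) R₀ : ℝ≥0∞)]
    refine lintegral_congr fun x => ?_
    rw [← Function.comp_assoc, maxMarked_comp_perm, hσ]
  have hch : ((Finset.univ.powersetCard s : Finset (Finset ι)).card) = Nat.choose (2 * s) s := by
    rw [Finset.card_powersetCard, Finset.card_univ, hcard]
  have hchpos : 0 < Nat.choose (2 * s) s := Nat.choose_pos (by omega)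
  have h1 : (Nat.choose (2 * s) s : ℝ≥0∞) *
      ∫⁻ x, (maxMarked mark (f ∘ x) R₀ : ℝ≥0∞) ∂(Measure.pi fun _ : ι => μ) ≤
      Nat.choose (2 * s) s * ENNReal.ofReal K := by
    calc _ = ∑ R ∈ (Finset.univ.powersetCard s : Finset (Finset ι)),
          ∫⁻ x, (maxMarked mark (f ∘ x) R : ℝ≥0∞) ∂(Measure.pi fun _ : ι => μ) := by
          rw [Finset.sum_congr rfl hR, Finset.sum_const, hch, nsmul_eq_mul]
      _ ≤ ∫⁻ x, ∑ R ∈ (Finset.univ.powersetCard s : Finset (Finset ι)),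
          (maxMarked mark (f ∘ x) R : ℝ≥0∞) ∂(Measure.pi fun _ : ι => μ) := by
          -- Measurability of `maxMarked` is never needed, since the lower integral is superadditive
          -- for arbitrary functions and only this direction is used.
          induction (Finset.univ.powersetCard s : Finset (Finset ι)) using Finset.induction_on with
          | empty => simp
          | insert R A hRA ih =>
            simp only [Finset.sum_insert hRA]
            exact le_trans (add_le_add_right ih _) (le_lintegral_add _ _)
      _ ≤ ∫⁻ x, Nat.choose (2 * s) s * ENNReal.ofReal K ∂(Measure.pi fun _ : ι => μ) := by
          refine lintegral_mono fun x => ?_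
          -- A worst tree is chosen for each label set separately; `hK` permits trees that depend on
          -- `R`.
          choose T hT using exists_markedCount_eq mark (f ∘ x)
          have := hK (f ∘ x) T
          simp only [hT] at this
          rw [← ENNReal.ofReal_natCast (Nat.choose (2 * s) s),
            ← ENNReal.ofReal_mul (by positivity)]
          refine le_trans (le_of_eq ?_) (ENNReal.ofReal_le_ofReal this)
          rw [ENNReal.ofReal_sum_of_nonneg (fun _ _ => by positivity)]
          simp
      _ = _ := by simp
  have hne : (Nat.choose (2 * s) s : ℝ≥0∞) ≠ 0 := by exact_mod_cast hchpos.ne'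
  exact (ENNReal.mul_le_mul_iff_right hne (ENNReal.natCast_ne_top _)).1 h1

end MaxMarked

/-! ### Ghost points in the leaves of a base learner -/

section Learner

variable {d : ℕ} {Ξ : Type*} [MeasurableSpace Ξ] (T : BaseLearner d Ξ)

open Classical in
/-- The number of the `y` in the leaf of `x` of the tree built on the data `a` with seed `ξ`. -/
noncomputable def leafCount {m m' : ℕ} (ξ : Ξ) (a : Fin m → Cov d × ℝ) (x : Cov d)
    (y : Fin m' → Cov d × ℝ) : ℕ :=
  (Finset.univ.filter fun k => (y k).1 ∈ (T.tree m ξ a).leafAt x).card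

theorem leafCount_le {m m' : ℕ} (ξ : Ξ) (a : Fin m → Cov d × ℝ) (x : Cov d)
    (y : Fin m' → Cov d × ℝ) : leafCount T ξ a x y ≤ m' := by
  classical
  exact (Finset.card_le_univ _).trans (by simp)

theorem leafCount_pos {m : ℕ} (hm : 0 < m) (ξ : Ξ) (a : Fin m → Cov d × ℝ) (x : Cov d) :
    0 < leafCount T ξ a x a := by
  classical
  obtain ⟨r, hr⟩ := T.leaf_nonempty m ξ a hm x
  exact Finset.card_pos.2 ⟨r, by simpa using hr⟩

theorem measurableSet_mem_leafAt {β : Type*} [MeasurableSpace β] {m : ℕ} {f : β → Ξ}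
    {g : β → Fin m → Cov d × ℝ} {h h' : β → Cov d} (hf : Measurable f) (hg : Measurable g)
    (hh : Measurable h) (hh' : Measurable h') :
    MeasurableSet {b | h' b ∈ (T.tree m (f b) (g b)).leafAt (h b)} :=
  (T.measurable m).preimage ((hf.prodMk hg).prodMk (hh.prodMk hh'))

theorem measurable_leafCount {β : Type*} [MeasurableSpace β] {m m' : ℕ} {f : β → Ξ}
    {g : β → Fin m → Cov d × ℝ} {h : β → Cov d} {y : β → Fin m' → Cov d × ℝ}
    (hf : Measurable f) (hg : Measurable g) (hh : Measurable h) (hy : Measurable y) :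
    Measurable fun b => leafCount T (f b) (g b) (h b) (y b) := by
  classical
  simp only [leafCount, Finset.card_filter]
  refine Finset.measurable_sum _ fun k _ => Measurable.ite ?_ measurable_const measurable_const
  exact measurableSet_mem_leafAt T hf hg hh (measurable_fst.comp ((measurable_pi_apply k).comp hy))

/-- Ghost points in marked leaves. -/
theorem lintegral_card_marked_le (mark : ℕ → ℕ → Prop) [∀ N M, Decidable (mark N M)]
    (μ : Measure (Cov d × ℝ)) [IsProbabilityMeasure μ] (ρ : Measure Ξ) [IsProbabilityMeasure ρ]
    {s : ℕ} {K : ℝ}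
    (hK : ∀ (x : Fin s ⊕ Fin s → Cov d) (T : Finset (Fin s ⊕ Fin s) → SplitTree d),
      ∑ R ∈ Finset.univ.powersetCard s, (markedCount x mark (T R) Finset.univ R : ℝ) ≤
        Nat.choose (2 * s) s * K) :
    ∫⁻ p, ∑ k : Fin s, (if mark (leafCount T p.1.2 p.1.1 (p.2 k).1 p.1.1)
        (leafCount T p.1.2 p.1.1 (p.2 k).1 p.2) then 1 else 0)
      ∂(((Measure.pi fun _ : Fin s => μ).prod ρ).prod (Measure.pi fun _ : Fin s => μ)) ≤
        ENNReal.ofReal K := by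
  set F : ((Fin s → Cov d × ℝ) × Ξ) × (Fin s → Cov d × ℝ) → ℝ≥0∞ := fun p =>
    ∑ k : Fin s, (if mark (leafCount T p.1.2 p.1.1 (p.2 k).1 p.1.1)
        (leafCount T p.1.2 p.1.1 (p.2 k).1 p.2) then 1 else 0) with hF
  have hFm : Measurable F := by
    refine Finset.measurable_sum _ fun k _ => ?_
    have h1 : Measurable fun p : ((Fin s → Cov d × ℝ) × Ξ) × (Fin s → Cov d × ℝ) =>
        (leafCount T p.1.2 p.1.1 (p.2 k).1 p.1.1, leafCount T p.1.2 p.1.1 (p.2 k).1 p.2) :=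
      (measurable_leafCount T (by fun_prop) (by fun_prop) (by fun_prop) (by fun_prop)).prodMk
        (measurable_leafCount T (by fun_prop) (by fun_prop) (by fun_prop) (by fun_prop))
    exact (Measurable.of_discrete (f := fun q : ℕ × ℕ => if mark q.1 q.2 then (1 : ℝ≥0∞) else 0)).comp
      h1
  rw [lintegral_prod _ hFm.aemeasurable, lintegral_prod_symm]
  swap
  · exact (Measurable.lintegral_prod_right hFm).aemeasurable
  calc _ ≤ ∫⁻ _ : Ξ, ENNReal.ofReal K ∂ρ := by
        refine lintegral_mono fun ξ => ?_
        -- For a fixed seed, sample and ghost sample together are one i.i.d. sample indexed by `Fin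
        -- s ⊕ Fin s`, whose real points are the left summand. The tree of the learner is then
        -- replaced by the worst tree.
        have hmp := measurePreserving_sumPiEquivProdPi (fun _ : Fin s ⊕ Fin s => μ)
        have hG : Measurable fun q : (Fin s → Cov d × ℝ) × (Fin s → Cov d × ℝ) =>
            F ((q.1, ξ), q.2) := hFm.comp (by fun_prop)
        rw [← lintegral_prod (fun q : (Fin s → Cov d × ℝ) × (Fin s → Cov d × ℝ) =>
            F ((q.1, ξ), q.2)) hG.aemeasurable, ← hmp.lintegral_comp hG]
        refine le_trans (lintegral_mono fun x => ?_) (lintegral_maxMarked_le mark μ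
          (fun e => e.1) (ι := Fin s ⊕ Fin s) (by simp [two_mul]) hK
          (Finset.univ.map Function.Embedding.inl) (by simp))
        set a : Fin s → Cov d × ℝ := fun i => x (Sum.inl i)
        set y : Fin s → Cov d × ℝ := fun i => x (Sum.inr i)
        change F ((a, ξ), y) ≤ _
        classical
        refine le_trans (le_of_eq ?_) (Nat.cast_le.2 (markedCount_le_maxMarked mark _ _
          (T.tree s ξ a)))
        rw [markedCount_eq, hF, Finset.card_filter]
        have hsd : (Finset.univ : Finset (Fin s ⊕ Fin s)) \
            Finset.univ.map Function.Embedding.inl = Finset.univ.map Function.Embedding.inr := by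
          ext i; rcases i with i | i <;> simp
        have hN : ∀ v, ((Finset.univ ∩ Finset.univ.map Function.Embedding.inl).filter
            fun i : Fin s ⊕ Fin s => (x i).1 ∈ (T.tree s ξ a).leafAt v).card =
            leafCount T ξ a v a := by
          intro v
          rw [Finset.univ_inter, Finset.filter_map, Finset.card_map]
          rfl
        have hM : ∀ v, ((Finset.univ.map Function.Embedding.inr).filter
            fun i : Fin s ⊕ Fin s => (x i).1 ∈ (T.tree s ξ a).leafAt v).card =
            leafCount T ξ a v y := by
          intro v
          rw [Finset.filter_map, Finset.card_map]
          rfl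
        simp only [hsd, Function.comp_apply, hN, hM, Finset.sum_map]
        push_cast
        rfl
    _ = _ := by simp

end Learner

end Ghost

/-! ### Ghost mass against sample mass of the leaves -/

section Gap

/-- With b = exp θ and c = exp (-aθ), b^M c^N = exp (θ (M - aN)) is at least 1 when M > aN. To first
order b + c is 2 - (a - 1)θ; the chosen `θ` makes the second order terms at most half of the gain,
so b + c < 2. -/
theorem exists_chernoff {a : ℝ} (ha : 1 < a) : ∃ b c t : ℝ≥0, 1 < t ∧ (c + t * b) / 2 < 1 ∧
    ∀ N M : ℕ, a * N < M → 1 ≤ b ^ M * c ^ N := by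
  set θ : ℝ := (a - 1) / (2 * (1 + a ^ 2)) with hθ
  have hden : 0 < 2 * (1 + a ^ 2) := by positivity
  have hθ0 : 0 < θ := div_pos (by linarith) hden
  have hθe : θ * (2 * (1 + a ^ 2)) = a - 1 := by rw [hθ]; field_simp
  have hθ1 : a * θ ≤ 1 := by nlinarith
  have hθ2 : θ ≤ 1 := by nlinarith
  have e1 : Real.exp θ ≤ 1 + θ + θ ^ 2 := by
    have := Real.abs_exp_sub_one_sub_id_le (x := θ) (by rw [abs_of_pos hθ0]; exact hθ2)
    have := (abs_le.1 this).2
    linarith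
  have e2 : Real.exp (-(a * θ)) ≤ 1 - a * θ + (a * θ) ^ 2 := by
    have := Real.abs_exp_sub_one_sub_id_le (x := -(a * θ))
      (by rw [abs_neg, abs_of_pos (by positivity)]; exact hθ1)
    have := (abs_le.1 this).2
    nlinarith
  set b : ℝ := Real.exp θ
  set c : ℝ := Real.exp (-(a * θ))
  have hb : 0 < b := Real.exp_pos _
  have hc : 0 < c := Real.exp_pos _
  have hbc : c + b < 2 := by nlinarith
  -- Half of the slack `2 - c - b` is spent on pushing `t` above 1.
  set t : ℝ := 1 + (2 - c - b) / (2 * b) with htdef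
  have ht : 1 < t := by
    have : 0 < (2 - c - b) / (2 * b) := div_pos (by linarith) (by positivity)
    linarith
  have htb : t * b = b + (2 - c - b) / 2 := by rw [htdef]; field_simp
  refine ⟨⟨b, hb.le⟩, ⟨c, hc.le⟩, ⟨t, by linarith⟩, ?_, ?_, ?_⟩
  · exact_mod_cast ht
  · rw [← NNReal.coe_lt_coe]
    push_cast
    change (c + t * b) / 2 < 1
    rw [htb]; linarith
  · intro N M h
    rw [← NNReal.coe_le_coe]
    push_cast
    change 1 ≤ b ^ M * c ^ N
    rw [← Real.exp_nat_mul, ← Real.exp_nat_mul, ← Real.exp_add]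
    apply Real.one_le_exp
    nlinarith

variable {d : ℕ} {Ξ : Type*} [MeasurableSpace Ξ]

/-- The fixed point condition of the entropy bound is met with `C = (1 - z)⁻¹`, with the tail `Y` of
the geometric series from `n₀` on, and with `κ = (1 - z) ^ (2 * d) / (4 * d)`. The hypothesis
`hsmall` makes the linear term at most `κ / 2`, and the quadratic term equals `κ / 2`. -/
theorem lintegral_card_marked_le' (hd : 0 < d) (T : BaseLearner d Ξ) (mark : ℕ → ℕ → Prop)
    [∀ N M, Decidable (mark N M)]
    (μ : Measure (Cov d × ℝ)) [IsProbabilityMeasure μ] (ρ : Measure Ξ) [IsProbabilityMeasure ρ]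
    {s : ℕ} (hs : 0 < s) {t b c z : ℝ≥0} {n₀ : ℕ} (ht : 1 < t) (hz : 0 < z) (hz1 : z < 1)
    (h0 : ¬ mark 0 0)
    (hbc : ∀ N M, mark N M → 1 ≤ b ^ M * c ^ N) (hn₀ : ∀ N M, mark N M → n₀ ≤ N + M)
    (hr : (c + t * b) / 2 < 1)
    (hsmall : ((c + t * b) / 2) ^ n₀ * (8 * d) ≤ (1 - (c + t * b) / 2) * (1 - z) ^ (4 * d)) :
    ∫⁻ p, ∑ k : Fin s, (if mark (leafCount T p.1.2 p.1.1 (p.2 k).1 p.1.1)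
        (leafCount T p.1.2 p.1.1 (p.2 k).1 p.2) then 1 else 0)
      ∂(((Measure.pi fun _ : Fin s => μ).prod ρ).prod (Measure.pi fun _ : Fin s => μ)) ≤
        ENNReal.ofReal ((2 * s * ((z : ℝ)⁻¹ - 1) + 2 * √(2 * s * ((1 - z : ℝ) ^ (2 * d) / (4 * d)))) /
          Real.log t) := by
  set r : ℝ≥0 := (c + t * b) / 2
  have hz1' : 0 < 1 - z := tsub_pos_of_lt hz1
  have hr1' : 0 < 1 - r := tsub_pos_of_lt hr
  have hd' : (0 : ℝ≥0) < d := by exact_mod_cast hd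
  set κ : ℝ≥0 := (1 - z) ^ (2 * d) / (4 * d) with hκ
  have hgeom : ∀ {x : ℝ≥0}, x < 1 → ∀ n, ∑ p ∈ Finset.range n, x ^ p ≤ (1 - x)⁻¹ := by
    intro x hx n
    have hs := NNReal.hasSum_geometric hx
    exact sum_le_hasSum _ (fun _ _ => zero_le) hs
  have hκr : (κ : ℝ) = (1 - z : ℝ) ^ (2 * d) / (4 * d) := by
    rw [hκ]; push_cast [NNReal.coe_sub hz1.le]; rfl
  rw [← hκr]
  refine lintegral_card_marked_le T mark μ ρ fun x T' => ?_
  refine sum_markedCount_le x mark hs (by simp [two_mul]) ht hz h0 hbc hn₀ (hgeom hz1)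
    (Y := r ^ n₀ * (1 - r)⁻¹) (fun n => ?_) ?_ T'
  · calc ∑ m ∈ Finset.range n, z ^ m * (if n₀ ≤ m then r ^ m else 0)
        ≤ ∑ m ∈ Finset.range n, if n₀ ≤ m then r ^ m else 0 := by
          refine Finset.sum_le_sum fun m _ => ?_
          exact mul_le_of_le_one_left zero_le (pow_le_one₀ zero_le hz1.le)
      _ = ∑ m ∈ (Finset.range n).filter (n₀ ≤ ·), r ^ m := by rw [Finset.sum_filter]
      _ ≤ ∑ m ∈ Finset.Ico n₀ (n₀ + n), r ^ m := by
          refine Finset.sum_le_sum_of_subset fun m hm => ?_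
          simp only [Finset.mem_filter, Finset.mem_range, Finset.mem_Ico] at hm ⊢
          omega
      _ = r ^ n₀ * ∑ p ∈ Finset.range n, r ^ p := by
          rw [Finset.sum_Ico_eq_sum_range, Finset.mul_sum, Nat.add_sub_cancel_left]
          exact Finset.sum_congr rfl fun p _ => pow_add _ _ _
      _ ≤ _ := mul_le_mul_right (hgeom hr n) _
  · set u : ℝ≥0 := (1 - z) ^ (2 * d) with hu
    have hu0 : 0 < u := by positivity
    have hu2 : (1 - z) ^ (4 * d) = u ^ 2 := by rw [hu, ← pow_mul]; congr 1; ring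
    rw [hu2] at hsmall
    have e1 : r ^ n₀ * (1 - r)⁻¹ ≤ u ^ 2 / (8 * d) := by
      rw [← div_eq_mul_inv, div_le_div_iff₀ hr1' (by positivity), mul_comm (u ^ 2)]
      exact hsmall
    calc ((1 - z)⁻¹) ^ (2 * d) * (r ^ n₀ * (1 - r)⁻¹ + ((2 * d : ℕ) : ℝ≥0) * κ ^ 2)
        ≤ ((1 - z)⁻¹) ^ (2 * d) * (u ^ 2 / (8 * d) + ((2 * d : ℕ) : ℝ≥0) * κ ^ 2) := by gcongr
      _ = κ := by
        rw [inv_pow, ← hu, hκ]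
        push_cast
        rw [← NNReal.coe_inj]
        push_cast
        have : (u : ℝ) ≠ 0 := by exact_mod_cast hu0.ne'
        have : (d : ℝ) ≠ 0 := by exact_mod_cast hd.ne'
        field_simp
        norm_num

open Classical in
-- The accuracy `ε` fixes `z`, and then `K` is so large that `r ^ K` beats the power of `1 - z` in
-- the fixed point condition. Leaves with at least `K` sample points have at least `K` pooled
-- points, so `K` serves as `n₀`.
theorem exists_lintegral_marked_le (hd : 0 < d) {a ε : ℝ} (ha : 1 < a) (hε : 0 < ε) :
    ∃ K s₀ : ℕ, ∀ s, s₀ ≤ s → 0 < s → ∀ (T : BaseLearner d Ξ) (μ : Measure (Cov d × ℝ))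
      [IsProbabilityMeasure μ] (ρ : Measure Ξ) [IsProbabilityMeasure ρ],
    ∫⁻ p, ∑ k : Fin s, (if a * leafCount T p.1.2 p.1.1 (p.2 k).1 p.1.1 <
        leafCount T p.1.2 p.1.1 (p.2 k).1 p.2 ∧ K ≤ leafCount T p.1.2 p.1.1 (p.2 k).1 p.1.1
        then 1 else 0)
      ∂(((Measure.pi fun _ : Fin s => μ).prod ρ).prod (Measure.pi fun _ : Fin s => μ)) ≤
        ENNReal.ofReal (ε * s) := by
  obtain ⟨b, c, t, ht, hr, hbc⟩ := exists_chernoff ha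
  have hlog : 0 < Real.log t := Real.log_pos ht
  -- With `z⁻¹ - 1 = η`, the linear term is `2 * η * s`, and the square root term is at most that
  -- for `s ≥ s₀`; together they give `ε * s * Real.log t`.
  set η : ℝ := ε * Real.log t / 4 with hη
  have hη0 : 0 < η := by positivity
  set zr : ℝ := (1 + η)⁻¹ with hzr
  have hzr0 : 0 < zr := by positivity
  have hzr1 : zr < 1 := inv_lt_one_of_one_lt₀ (by linarith)
  set z : ℝ≥0 := ⟨zr, hzr0.le⟩
  have hz0 : 0 < z := hzr0
  have hz1 : z < 1 := hzr1
  set r : ℝ≥0 := (c + t * b) / 2 with hrdef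
  have hlim : Tendsto (fun n => r ^ n * (8 * d)) atTop (𝓝 0) := by
    have := (NNReal.tendsto_pow_atTop_nhds_zero_of_lt_one hr).mul_const (8 * (d : ℝ≥0))
    simpa using this
  have hpos : 0 < (1 - r) * (1 - z) ^ (4 * d) := by
    have h1 := tsub_pos_of_lt hz1
    have h2 := tsub_pos_of_lt hr
    exact mul_pos h2 (pow_pos h1 _)
  obtain ⟨K, hK1, hK⟩ := ((eventually_ge_atTop 1).and (hlim.eventually (gt_mem_nhds hpos))).exists
  obtain ⟨s₀, hs₀⟩ := exists_nat_ge (2 / η ^ 2)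
  refine ⟨K, s₀, fun s hs hspos T μ _ ρ _ => ?_⟩
  have := lintegral_card_marked_le' hd T (fun N M => a * N < M ∧ K ≤ N) μ ρ hspos ht hz0 hz1
    (n₀ := K) (fun h => absurd h.2 (by omega)) (fun N M h => hbc N M h.1) (fun N M h => h.2.trans le_self_add) hr
    hK.le
  refine this.trans (ENNReal.ofReal_le_ofReal ?_)
  rw [div_le_iff₀ hlog]
  have e1 : (z : ℝ)⁻¹ - 1 = η := by
    change zr⁻¹ - 1 = η
    rw [hzr, inv_inv]; ring
  have e2 : √(2 * s * ((1 - z : ℝ) ^ (2 * d) / (4 * d))) ≤ η * s := by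
    have hz0' : (0 : ℝ) ≤ 1 - z := sub_nonneg.2 hzr1.le
    have hz1' : (1 - z : ℝ) ≤ 1 := by
      have : (0 : ℝ) < z := hzr0
      linarith
    have hd1 : (1 : ℝ) ≤ d := by exact_mod_cast hd
    have h1 : (1 - z : ℝ) ^ (2 * d) / (4 * d) ≤ 1 :=
      div_le_one_of_le₀ ((pow_le_one₀ hz0' hz1').trans (by linarith)) (by positivity)
    apply Real.sqrt_le_iff.2
    refine ⟨by positivity, ?_⟩
    have hs' : 2 / η ^ 2 ≤ s := hs₀.trans (by exact_mod_cast hs)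
    rw [div_le_iff₀ (by positivity)] at hs'
    calc 2 * (s : ℝ) * ((1 - z : ℝ) ^ (2 * d) / (4 * d)) ≤ 2 * s * 1 := by gcongr
      _ = s * 2 := by ring
      _ ≤ s * (s * η ^ 2) := by gcongr
      _ = _ := by ring
  rw [e1]
  have : ε * s * Real.log t = 4 * (η * s) := by rw [hη]; ring
  rw [this]
  nlinarith

open Classical in
-- Leaves with few sample points are controlled through the large ratio instead: M > A N with N > 0
-- forces more than `A` pooled points, so `n₀ = A`. Since `r ^ A` beats every power of `A`, the
-- choice z = 1 - A^(-2) is admissible and yields a rate summable in `A`. The Chernoff constants are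
-- those of the ratio 2 and serve all `A` at once.
theorem exists_lintegral_marked_le_sq (hd : 0 < d) :
    ∃ (C : ℝ) (A₁ : ℕ), 0 < C ∧ ∀ A, A₁ ≤ A → ∀ s, 0 < s → ∀ (T : BaseLearner d Ξ)
      (μ : Measure (Cov d × ℝ)) [IsProbabilityMeasure μ] (ρ : Measure Ξ) [IsProbabilityMeasure ρ],
    ∫⁻ p, ∑ k : Fin s, (if (A : ℝ) * leafCount T p.1.2 p.1.1 (p.2 k).1 p.1.1 <
        leafCount T p.1.2 p.1.1 (p.2 k).1 p.2 ∧ 0 < leafCount T p.1.2 p.1.1 (p.2 k).1 p.1.1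
        then 1 else 0)
      ∂(((Measure.pi fun _ : Fin s => μ).prod ρ).prod (Measure.pi fun _ : Fin s => μ)) ≤
        ENNReal.ofReal (C * s * ((A : ℝ) ^ 2)⁻¹) := by
  obtain ⟨b, c, t, ht, hr, hbc⟩ := exists_chernoff (a := 2) (by norm_num)
  have hlog : 0 < Real.log t := Real.log_pos ht
  set r : ℝ≥0 := (c + t * b) / 2 with hrdef
  have hr0 : 0 < 1 - r := tsub_pos_of_lt hr
  have hlim : Tendsto (fun n : ℕ => (n : ℝ) ^ (8 * d) * (r : ℝ) ^ n) atTop (𝓝 0) :=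
    tendsto_pow_const_mul_const_pow_of_abs_lt_one (8 * d)
      (by rw [abs_of_nonneg (NNReal.coe_nonneg r)]; exact_mod_cast hr)
  have hpos : (0 : ℝ) < (1 - r : ℝ≥0) / (8 * d) := by positivity
  obtain ⟨A₁, hA₁⟩ := eventually_atTop.1 ((eventually_ge_atTop 2).and
    (hlim.eventually (gt_mem_nhds hpos)))
  refine ⟨8 / Real.log t, A₁, by positivity, fun A hA s hs T μ _ ρ _ => ?_⟩
  obtain ⟨hA2, hAr⟩ := hA₁ A hA
  have hA2' : (2 : ℝ) ≤ A := by exact_mod_cast hA2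
  have hAsq : (4 : ℝ) ≤ (A : ℝ) ^ 2 := by nlinarith
  set y : ℝ≥0 := ((A : ℝ≥0) ^ 2)⁻¹ with hy
  have hyr : (y : ℝ) = ((A : ℝ) ^ 2)⁻¹ := by rw [hy]; push_cast; rfl
  have hy0 : 0 < y := by
    have : 0 < A := by omega
    positivity
  have hy4 : (y : ℝ) ≤ 1 / 4 := by
    rw [hyr, one_div]; exact inv_anti₀ (by norm_num) hAsq
  have hy1 : y < 1 := by
    rw [← NNReal.coe_lt_coe]; push_cast; linarith
  have hz1 : 1 - y < 1 := tsub_lt_self one_pos hy0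
  have hz0 : 0 < 1 - y := tsub_pos_of_lt hy1
  have hzy : 1 - (1 - y) = y := tsub_tsub_cancel_of_le hy1.le
  have hzr : ((1 - y : ℝ≥0) : ℝ) = 1 - y := by rw [NNReal.coe_sub hy1.le]; rfl
  have := lintegral_card_marked_le' hd T (fun N M => (A : ℝ) * N < M ∧ 0 < N) μ ρ hs ht hz0 hz1
    (n₀ := A) (by simp) (fun N M h => hbc N M ?_) (fun N M h => ?_) hr ?_
  · refine this.trans (ENNReal.ofReal_le_ofReal ?_)
    rw [div_le_iff₀ hlog, hzr]
    have hs1 : (1 : ℝ) ≤ s := by exact_mod_cast hs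
    have hd1 : (1 : ℝ) ≤ d := by exact_mod_cast hd
    have hypos : (0 : ℝ) < y := hy0
    have e1 : (1 - (y : ℝ))⁻¹ - 1 ≤ 2 * y := by
      have h1 : 0 < 1 - (y : ℝ) := by linarith
      have : (1 - (y : ℝ))⁻¹ ≤ 1 + 2 * y := by
        rw [inv_le_iff_one_le_mul₀ h1]
        nlinarith
      linarith
    have e2 : √(2 * s * ((1 - (1 - (y : ℝ))) ^ (2 * d) / (4 * d))) ≤ s * y := by
      apply Real.sqrt_le_iff.2
      refine ⟨by positivity, ?_⟩
      rw [sub_sub_cancel]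
      have h1 : (y : ℝ) ^ (2 * d) ≤ y ^ 2 := pow_le_pow_of_le_one hypos.le (by linarith) (by omega)
      have h2 : (y : ℝ) ^ (2 * d) / (4 * d) ≤ y ^ 2 / 4 :=
        div_le_div₀ (by positivity) h1 (by norm_num) (by linarith)
      calc 2 * (s : ℝ) * ((y : ℝ) ^ (2 * d) / (4 * d)) ≤ 2 * s * (y ^ 2 / 4) := by gcongr
        _ ≤ 2 * (s * s) * (y ^ 2 / 4) := by gcongr; nlinarith
        _ ≤ _ := by nlinarith [mul_nonneg (mul_self_nonneg (s : ℝ)) (sq_nonneg (y : ℝ))]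
    rw [← hyr]
    have : 8 / Real.log t * s * y * Real.log t = 8 * (s * y) := by field_simp
    rw [this]
    nlinarith
  · have h1 : A * N < M := by exact_mod_cast h.1
    have : 2 * N < M := lt_of_le_of_lt (Nat.mul_le_mul_right N hA2) h1
    exact_mod_cast this
  · have h1 : A * N < M := by exact_mod_cast h.1
    have := Nat.le_mul_of_pos_right A h.2
    omega
  · rw [hzy, ← NNReal.coe_le_coe]
    push_cast
    rw [hyr, inv_pow, ← pow_mul]
    rw [lt_div_iff₀ (by positivity)] at hAr
    have hAp : (0 : ℝ) < (A : ℝ) ^ (8 * d) := by positivity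
    rw [show 2 * (4 * d) = 8 * d by ring, ← div_eq_mul_inv, le_div_iff₀ hAp]
    have : ((1 - r : ℝ≥0) : ℝ) = 1 - ↑r := by rw [NNReal.coe_sub hr.le]; rfl
    calc _ = (A : ℝ) ^ (8 * d) * (r : ℝ) ^ A * (8 * d) := by rw [hrdef]; push_cast; ring
      _ ≤ _ := hAr.le

open Classical in
-- If M/N exceeds 1 + ε, it is at most its ceiling, the number of levels j ≥ 0 with jN < M. The
-- levels above `A` are kept as indicators. The `A + 1` levels up to `A` are paid by the first
-- indicator if `K ≤ N`, and by the multiple of 1/N if N < K.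
theorem div_sub_one_le {N M s A K : ℕ} {ε : ℝ} (hN : 0 < N) (hM : M ≤ s) (hε : 0 ≤ ε) :
    ((M : ℝ≥0∞) / N) - 1 ≤ ENNReal.ofReal ε + (A + 1 : ℕ) * (if (1 + ε) * N < M ∧ K ≤ N then 1 else 0) +
      ((A + 1 : ℕ) * K : ℝ≥0) * (N : ℝ≥0∞)⁻¹ +
      ∑ j ∈ Finset.Ioo A (s + 1), if (j : ℝ) * N < M ∧ 0 < N then 1 else 0 := by
  rw [tsub_le_iff_right]
  have hN0 : (N : ℝ≥0∞) ≠ 0 := by exact_mod_cast hN.ne'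
  by_cases h : (M : ℝ) ≤ (1 + ε) * N
  · have h1 : (M : ℝ≥0∞) / N ≤ ENNReal.ofReal ε + 1 := by
      rw [ENNReal.div_le_iff hN0 (ENNReal.natCast_ne_top _)]
      rw [← ENNReal.ofReal_one, ← ENNReal.ofReal_add hε zero_le_one, ← ENNReal.ofReal_natCast,
        ← ENNReal.ofReal_natCast, ← ENNReal.ofReal_mul (by positivity)]
      exact ENNReal.ofReal_le_ofReal (by linarith)
    refine h1.trans (add_le_add_left ?_ 1)
    rw [add_assoc, add_assoc]
    exact le_self_add
  · push Not at h
    have h1 : ((M : ℝ≥0∞) / N) ≤ (A + 1 : ℕ) +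
        ∑ j ∈ Finset.Ioo A (s + 1), if (j : ℝ) * N < M ∧ 0 < N then 1 else 0 := by
      -- `q` is the ceiling of M/N.
      set q := (M + N - 1) / N with hq
      have hq1 : M ≤ q * N := by
        have h2 := Nat.div_add_mod (M + N - 1) N
        have h3 := Nat.mod_lt (M + N - 1) hN
        rw [← hq, mul_comm] at h2
        omega
      have hq2 : ∀ j, j < q → j * N < M := by
        intro j hj
        have h2 := Nat.div_mul_le_self (M + N - 1) N
        rw [← hq] at h2
        have h3 : (j + 1) * N ≤ q * N := Nat.mul_le_mul_right N hj
        rw [add_mul, one_mul] at h3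
        omega
      have hqs : q ≤ s := by
        rw [hq]
        refine Nat.div_le_of_le_mul ?_
        rcases Nat.eq_zero_or_pos M with h0 | h0
        · have : N * s ≥ 0 := Nat.zero_le _
          subst h0
          exfalso
          have : (0 : ℝ) ≤ (1 + ε) * N := by positivity
          push_cast at h
          linarith
        · have : 1 ≤ s := le_trans h0 hM
          have h5 : (N - 1) * 1 ≤ (N - 1) * s := Nat.mul_le_mul_left _ this
          have h6 : N * s = (N - 1) * s + s := by
            conv_lhs => rw [← Nat.sub_add_cancel hN]
            ring
          omega
      have h2 : ((M : ℝ≥0∞) / N) ≤ q := by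
        rw [ENNReal.div_le_iff hN0 (ENNReal.natCast_ne_top _)]
        exact_mod_cast hq1
      refine h2.trans ?_
      have h3 : ((q - (A + 1) : ℕ) : ℝ≥0∞) ≤
          ∑ j ∈ Finset.Ioo A (s + 1), if (j : ℝ) * N < M ∧ 0 < N then 1 else 0 := by
        calc ((q - (A + 1) : ℕ) : ℝ≥0∞) = ∑ j ∈ Finset.Ioo A q, 1 := by
              simp [Nat.sub_sub]
          _ = ∑ j ∈ Finset.Ioo A q, if (j : ℝ) * N < M ∧ 0 < N then 1 else 0 := by
              refine Finset.sum_congr rfl fun j hj => ?_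
              rw [Finset.mem_Ioo] at hj
              rw [if_pos ⟨by exact_mod_cast hq2 j hj.2, hN⟩]
          _ ≤ _ := by
              refine Finset.sum_le_sum_of_subset fun j hj => ?_
              rw [Finset.mem_Ioo] at hj ⊢
              omega
      refine le_trans ?_ (add_le_add_right h3 _)
      have : q ≤ A + 1 + (q - (A + 1)) := by omega
      exact_mod_cast this
    refine h1.trans ?_
    have h2 : ((A + 1 : ℕ) : ℝ≥0∞) ≤ (A + 1 : ℕ) * (if (1 + ε) * N < M ∧ K ≤ N then 1 else 0) +
      ((A + 1 : ℕ) * K : ℝ≥0) * (N : ℝ≥0∞)⁻¹ := by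
      by_cases hK : K ≤ N
      · rw [if_pos ⟨h, hK⟩, mul_one]; exact le_self_add
      · rw [ENNReal.coe_mul, mul_assoc]
        refine le_trans ?_ le_add_self
        have : (1 : ℝ≥0∞) ≤ ((K : ℝ≥0) : ℝ≥0∞) * (N : ℝ≥0∞)⁻¹ := by
          rw [← div_eq_mul_inv, ENNReal.le_div_iff_mul_le (Or.inl hN0)
            (Or.inl (ENNReal.natCast_ne_top _)), one_mul]
          push Not at hK
          simpa using hK.le
        calc ((A + 1 : ℕ) : ℝ≥0∞) = ((A + 1 : ℕ) : ℝ≥0∞) * 1 := (mul_one _).symm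
          _ ≤ _ := by
            rw [ENNReal.coe_natCast]
            gcongr
    calc _ ≤ (((A + 1 : ℕ) : ℝ≥0∞) * (if (1 + ε) * N < M ∧ K ≤ N then 1 else 0) +
          ((A + 1 : ℕ) * K : ℝ≥0) * (N : ℝ≥0∞)⁻¹) +
          ∑ j ∈ Finset.Ioo A (s + 1), (if (j : ℝ) * N < M ∧ 0 < N then 1 else 0) :=
          add_le_add_left h2 _
      _ ≤ (ENNReal.ofReal ε + 1) + ((((A + 1 : ℕ) : ℝ≥0∞) * (if (1 + ε) * N < M ∧ K ≤ N then 1 else 0) +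
          ((A + 1 : ℕ) * K : ℝ≥0) * (N : ℝ≥0∞)⁻¹) +
          ∑ j ∈ Finset.Ioo A (s + 1), (if (j : ℝ) * N < M ∧ 0 < N then 1 else 0)) := le_add_self
      _ = _ := by ring

/-- Trees with large leaves generalize: in the mean, the ghost sample puts at most the same mass on
a leaf as the sample, up to `ε` and a multiple of the mean inverse leaf size. -/
theorem exists_lintegral_div_sub_one_le (hd : 0 < d) {ε : ℝ} (hε : 0 < ε) :
    ∃ (K : ℝ≥0) (s₀ : ℕ), ∀ s, s₀ ≤ s → 0 < s → ∀ (T : BaseLearner d Ξ) (μ : Measure (Cov d × ℝ))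
      [IsProbabilityMeasure μ] (ρ : Measure Ξ) [IsProbabilityMeasure ρ],
    ∫⁻ p, ∑ k : Fin s, (((leafCount T p.1.2 p.1.1 (p.2 k).1 p.2 : ℝ≥0∞) /
        leafCount T p.1.2 p.1.1 (p.2 k).1 p.1.1) - 1)
      ∂(((Measure.pi fun _ : Fin s => μ).prod ρ).prod (Measure.pi fun _ : Fin s => μ)) ≤
        ENNReal.ofReal (ε * s) + K *
      ∫⁻ p, ∑ k : Fin s, (leafCount T p.1.2 p.1.1 (p.2 k).1 p.1.1 : ℝ≥0∞)⁻¹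
      ∂(((Measure.pi fun _ : Fin s => μ).prod ρ).prod (Measure.pi fun _ : Fin s => μ)) := by
  classical
  obtain ⟨C, A₁, hC, hA₁⟩ := exists_lintegral_marked_le_sq (Ξ := Ξ) hd
  -- From this level on, the tail of the sum of C/j² is at most `2 * C / (A + 1)`, hence at most `ε
  -- / 3`.
  obtain ⟨A₂, hA₂⟩ := exists_nat_ge (2 * C / (ε / 3))
  set A := max A₁ A₂ with hA
  -- The accuracy is divided by `A + 1` because the indicator of the moderate ratios enters with
  -- that multiplicity.
  obtain ⟨K, s₀, hK⟩ := exists_lintegral_marked_le (Ξ := Ξ) hd (a := 1 + ε / 3)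
    (ε := ε / 3 / (A + 1 : ℕ)) (by linarith) (by positivity)
  refine ⟨(A + 1 : ℕ) * K, s₀, fun s hs hspos T μ _ ρ _ => ?_⟩
  set ν := ((Measure.pi fun _ : Fin s => μ).prod ρ).prod (Measure.pi fun _ : Fin s => μ)
  have hpt : ∀ p : ((Fin s → Cov d × ℝ) × Ξ) × (Fin s → Cov d × ℝ),
      ∑ k : Fin s, (((leafCount T p.1.2 p.1.1 (p.2 k).1 p.2 : ℝ≥0∞) /
        leafCount T p.1.2 p.1.1 (p.2 k).1 p.1.1) - 1) ≤
      ENNReal.ofReal (ε / 3) * s +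
      (A + 1 : ℕ) * (∑ k : Fin s, if (1 + ε / 3) * leafCount T p.1.2 p.1.1 (p.2 k).1 p.1.1 <
        leafCount T p.1.2 p.1.1 (p.2 k).1 p.2 ∧ K ≤ leafCount T p.1.2 p.1.1 (p.2 k).1 p.1.1
        then 1 else 0) +
      ((A + 1 : ℕ) * K : ℝ≥0) *
        (∑ k : Fin s, (leafCount T p.1.2 p.1.1 (p.2 k).1 p.1.1 : ℝ≥0∞)⁻¹) +
      ∑ j ∈ Finset.Ioo A (s + 1), ∑ k : Fin s,
        if (j : ℝ) * leafCount T p.1.2 p.1.1 (p.2 k).1 p.1.1 <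
        leafCount T p.1.2 p.1.1 (p.2 k).1 p.2 ∧ 0 < leafCount T p.1.2 p.1.1 (p.2 k).1 p.1.1
        then 1 else 0 := by
    intro p
    refine (Finset.sum_le_sum fun k _ => div_sub_one_le (A := A) (K := K) (ε := ε / 3)
      (leafCount_pos T hspos p.1.2 p.1.1 (p.2 k).1)
      (leafCount_le T p.1.2 p.1.1 (p.2 k).1 p.2) (by positivity)).trans (le_of_eq ?_)
    simp only [Finset.sum_add_distrib, ← Finset.mul_sum]
    rw [Finset.sum_comm]
    simp [mul_comm]
  have hm1 : ∀ k : Fin s, Measurable fun p : ((Fin s → Cov d × ℝ) × Ξ) × (Fin s → Cov d × ℝ) =>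
      leafCount T p.1.2 p.1.1 (p.2 k).1 p.1.1 := fun k =>
    measurable_leafCount T (by fun_prop) (by fun_prop) (by fun_prop) (by fun_prop)
  have hm2 : ∀ k : Fin s, Measurable fun p : ((Fin s → Cov d × ℝ) × Ξ) × (Fin s → Cov d × ℝ) =>
      leafCount T p.1.2 p.1.1 (p.2 k).1 p.2 := fun k =>
    measurable_leafCount T (by fun_prop) (by fun_prop) (by fun_prop) (by fun_prop)
  have hm3 : ∀ (mark : ℕ → ℕ → Prop) [∀ N M, Decidable (mark N M)], Measurable
      fun p : ((Fin s → Cov d × ℝ) × Ξ) × (Fin s → Cov d × ℝ) =>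
      ∑ k : Fin s, if mark (leafCount T p.1.2 p.1.1 (p.2 k).1 p.1.1)
        (leafCount T p.1.2 p.1.1 (p.2 k).1 p.2) then (1 : ℝ≥0∞) else 0 := fun mark _ =>
    Finset.measurable_sum _ fun k _ =>
      (Measurable.of_discrete (f := fun q : ℕ × ℕ => if mark q.1 q.2 then (1 : ℝ≥0∞) else 0)).comp
        ((hm1 k).prodMk (hm2 k))
  have hm4 : Measurable fun p : ((Fin s → Cov d × ℝ) × Ξ) × (Fin s → Cov d × ℝ) =>
      ∑ k : Fin s, (leafCount T p.1.2 p.1.1 (p.2 k).1 p.1.1 : ℝ≥0∞)⁻¹ :=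
    Finset.measurable_sum _ fun k _ =>
      (Measurable.of_discrete (f := fun q : ℕ => (q : ℝ≥0∞)⁻¹)).comp (hm1 k)
  have hm5 : ∀ j : ℕ, Measurable _ := fun j => hm3 fun N M => (j : ℝ) * N < M ∧ 0 < N
  refine (lintegral_mono hpt).trans ?_
  rw [lintegral_add_right _ (Finset.measurable_sum _ fun j _ => hm5 j),
    lintegral_add_right _ (hm4.const_mul _),
    lintegral_add_right _ ((hm3 fun N M => (1 + ε / 3) * N < M ∧ K ≤ N).const_mul _),
    lintegral_const_mul _ (hm3 fun N M => (1 + ε / 3) * N < M ∧ K ≤ N),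
    lintegral_const_mul _ hm4, lintegral_finsetSum _ fun j _ => hm5 j,
    lintegral_const, measure_univ, mul_one]
  have b1 : ENNReal.ofReal (ε / 3) * s = ENNReal.ofReal (ε / 3 * s) := by
    rw [ENNReal.ofReal_mul (by positivity), ENNReal.ofReal_natCast]
  have b2 := hK s hs hspos T μ ρ
  have b2' : ((A + 1 : ℕ) : ℝ≥0∞) * ENNReal.ofReal (ε / 3 / (A + 1 : ℕ) * s) =
      ENNReal.ofReal (ε / 3 * s) := by
    rw [← ENNReal.ofReal_natCast, ← ENNReal.ofReal_mul (by positivity)]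
    congr 1
    field_simp
  have b3 : ∑ j ∈ Finset.Ioo A (s + 1), ENNReal.ofReal (C * s * ((j : ℝ) ^ 2)⁻¹) ≤
      ENNReal.ofReal (ε / 3 * s) := by
    rw [← ENNReal.ofReal_sum_of_nonneg (fun _ _ => by positivity), ← Finset.mul_sum]
    refine ENNReal.ofReal_le_ofReal ?_
    have h1 := sum_Ioo_inv_sq_le (α := ℝ) A (s + 1)
    have h2 : 2 / ((A : ℝ) + 1) * C ≤ ε / 3 := by
      have h3 : 2 * C / (ε / 3) ≤ (A : ℝ) + 1 := by
        have : (A₂ : ℝ) ≤ A := by exact_mod_cast le_max_right _ _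
        linarith
      rw [div_le_iff₀ (by positivity)] at h3
      rw [div_mul_eq_mul_div, div_le_iff₀ (by positivity)]
      linarith
    calc C * s * ∑ j ∈ Finset.Ioo A (s + 1), ((j : ℝ) ^ 2)⁻¹
        ≤ C * s * (2 / ((A : ℝ) + 1)) := by gcongr
      _ = (2 / ((A : ℝ) + 1) * C) * s := by ring
      _ ≤ _ := by gcongr
  calc _ ≤ ENNReal.ofReal (ε / 3 * s) + ENNReal.ofReal (ε / 3 * s) +
        ((A + 1 : ℕ) * K : ℝ≥0) * ∫⁻ p, ∑ k : Fin s,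
          (leafCount T p.1.2 p.1.1 (p.2 k).1 p.1.1 : ℝ≥0∞)⁻¹ ∂ν + ENNReal.ofReal (ε / 3 * s) := by
        gcongr
        · exact b1.le
        · rw [← b2']; gcongr
        · refine le_trans (Finset.sum_le_sum fun j hj => ?_) b3
          refine hA₁ j ?_ s hspos T μ ρ
          rw [Finset.mem_Ioo] at hj
          exact (le_max_left _ _).trans hj.1.le
    _ = _ := by
        have : ENNReal.ofReal (ε * s) = ENNReal.ofReal (ε / 3 * s) + ENNReal.ofReal (ε / 3 * s) +
            ENNReal.ofReal (ε / 3 * s) := by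
          rw [← ENNReal.ofReal_add (by positivity) (by positivity),
            ← ENNReal.ofReal_add (by positivity) (by positivity)]
          congr 1; ring
        rw [this]; ring

end Gap

/-! ### The laws of the two arms -/

section Population

variable {d : ℕ}

theorem measurable_observe : Measurable (observe : FullData d → ObsData d) := by
  have h : Measurable fun u : FullData d => u.2.2 u.2.1 := by
    have : (fun u : FullData d => u.2.2 u.2.1) =
        fun u => if u.2.1 = true then u.2.2 true else u.2.2 false := by
      ext u; rcases u with ⟨x, b, y⟩; cases b <;> simp
    rw [this]
    refine Measurable.ite ?_ (by fun_prop) (by fun_prop)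
    exact measurableSet_eq_fun (by fun_prop) measurable_const
  exact measurable_fst.prodMk ((measurable_fst.comp measurable_snd).prodMk h)

theorem measurableSet_arm (b : Bool) : MeasurableSet {o : ObsData d | o.2.1 = b} :=
  measurableSet_eq_fun (by fun_prop) measurable_const

variable (P : Measure (FullData d)) [IsProbabilityMeasure P]

instance isProbabilityMeasure_obsLaw : IsProbabilityMeasure (obsLaw P) :=
  Measure.isProbabilityMeasure_map measurable_observe.aemeasurable

instance isProbabilityMeasure_sampleLaw (n : ℕ) : IsProbabilityMeasure (sampleLaw P n) :=
  inferInstanceAs (IsProbabilityMeasure (Measure.pi fun _ : Fin n => obsLaw P))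

/-- The conditional probability of arm `b` given the covariates. -/
noncomputable def armProb (b : Bool) (x : Cov d) : ℝ≥0∞ := P.condKernel x {v | v.1 = b}

theorem measurable_armProb (b : Bool) : Measurable (armProb P b) :=
  Kernel.measurable_coe _ (measurableSet_eq_fun (by fun_prop) measurable_const)

theorem armProb_le_one (b : Bool) (x : Cov d) : armProb P b x ≤ 1 := prob_le_one

theorem armProb_add (x : Cov d) : armProb P true x + armProb P false x = 1 := by
  have h : {v : Bool × (Bool → ℝ) | v.1 = false} = {v | v.1 = true}ᶜ := by
    ext v; simp
  rw [armProb, armProb, h, measure_add_measure_compl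
    (measurableSet_eq_fun (by fun_prop) measurable_const), measure_univ]

/-- The law of an observation restricted to arm `b`. -/
noncomputable def subLaw (b : Bool) : Measure (ObsData d) :=
  (obsLaw P).restrict {o | o.2.1 = b}

/-- The law of the covariates restricted to arm `b`. -/
noncomputable def covSubLaw (b : Bool) : Measure (Cov d) := (subLaw P b).map Prod.fst

instance (b : Bool) : IsFiniteMeasure (subLaw P b) := by unfold subLaw; infer_instance

instance (b : Bool) : IsFiniteMeasure (covSubLaw P b) := by unfold covSubLaw; infer_instance

/-- The probability of arm `b`. -/
noncomputable def armMass (b : Bool) : ℝ≥0∞ := obsLaw P {o | o.2.1 = b}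

theorem armMass_ne_top (b : Bool) : armMass P b ≠ ∞ := measure_ne_top _ _

theorem armMass_le_one (b : Bool) : armMass P b ≤ 1 := prob_le_one

theorem covSubLaw_eq (b : Bool) : covSubLaw P b = P.fst.withDensity (armProb P b) := by
  ext A hA
  rw [withDensity_apply _ hA, covSubLaw, Measure.map_apply measurable_fst hA, subLaw,
    Measure.restrict_apply (measurable_fst hA), Measure.map_apply measurable_observe
      ((measurable_fst hA).inter (measurableSet_arm b))]
  have h : observe ⁻¹' (Prod.fst ⁻¹' A ∩ {o : ObsData d | o.2.1 = b}) =
      A ×ˢ {v : Bool × (Bool → ℝ) | v.1 = b} := by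
    ext u; simp [observe]
  rw [h]
  conv_lhs => rw [← P.disintegrate P.condKernel]
  rw [Measure.compProd_apply_prod hA (measurableSet_eq_fun (by fun_prop) measurable_const)]
  rfl

theorem covSubLaw_univ (b : Bool) : covSubLaw P b Set.univ = armMass P b := by
  rw [covSubLaw, Measure.map_apply measurable_fst MeasurableSet.univ, subLaw, Set.preimage_univ,
    Measure.restrict_apply MeasurableSet.univ, Set.univ_inter, armMass]

theorem covSubLaw_absolutelyContinuous (b : Bool) : covSubLaw P b ≪ P.fst := by
  rw [covSubLaw_eq]; exact withDensity_absolutelyContinuous _ _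

theorem exists_le_armProb (hP : BasicAssumption P) : ∃ η : ℝ≥0, 0 < η ∧ ∀ b : Bool,
    ∀ᵐ x ∂P.fst, η ≤ armProb P b x := by
  obtain ⟨η, hη, h⟩ := hP.overlap
  refine ⟨η.toNNReal, Real.toNNReal_pos.2 hη, fun b => ?_⟩
  filter_upwards [h] with x hx
  have e1 : propensity P x = (armProb P true x).toReal := rfl
  have hne : ∀ b, armProb P b x ≠ ∞ := fun b => ne_top_of_le_ne_top ENNReal.one_ne_top
    (armProb_le_one P b x)
  have e2 : (armProb P true x).toReal + (armProb P false x).toReal = 1 := by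
    rw [← ENNReal.toReal_add (hne _) (hne _), armProb_add, ENNReal.toReal_one]
  change ENNReal.ofReal η ≤ _
  rw [ENNReal.ofReal_le_iff_le_toReal (hne b)]
  cases b
  · linarith [hx.2]
  · linarith [hx.1]

theorem armMass_pos (hP : BasicAssumption P) (b : Bool) : 0 < armMass P b := by
  obtain ⟨η, hη, h⟩ := exists_le_armProb P hP
  rw [← covSubLaw_univ, covSubLaw_eq, withDensity_apply _ MeasurableSet.univ,
    Measure.restrict_univ]
  calc (0 : ℝ≥0∞) < η := by exact_mod_cast hη
    _ = ∫⁻ _, η ∂P.fst := by simp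
    _ ≤ _ := lintegral_mono_ae (h b)

/-- The ratio of the conditional probabilities of the opposite arm and of arm `b`. -/
noncomputable def armRatio (b : Bool) (x : Cov d) : ℝ≥0∞ := armProb P (!b) x / armProb P b x

theorem measurable_armRatio (b : Bool) : Measurable (armRatio P b) :=
  (measurable_armProb P _).div (measurable_armProb P _)

theorem densityRatio_eq (x : Cov d) (b : Bool) :
    densityRatio P x b = (armRatio P b x).toReal := by
  have hne : ∀ b, armProb P b x ≠ ∞ := fun b => ne_top_of_le_ne_top ENNReal.one_ne_top
    (armProb_le_one P b x)
  have e1 : propensity P x = (armProb P true x).toReal := rfl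
  have e2 : (armProb P true x).toReal + (armProb P false x).toReal = 1 := by
    rw [← ENNReal.toReal_add (hne _) (hne _), armProb_add, ENNReal.toReal_one]
  have e3 : 1 - propensity P x = (armProb P false x).toReal := by rw [e1]; linarith
  rw [densityRatio, e3, e1, armRatio, ENNReal.toReal_div]
  cases b <;> simp

theorem exists_armRatio_le (hP : BasicAssumption P) : ∃ R : ℝ≥0, ∀ b : Bool,
    ∀ᵐ x ∂P.fst, armRatio P b x ≤ R := by
  obtain ⟨η, hη, h⟩ := exists_le_armProb P hP
  refine ⟨η⁻¹, fun b => ?_⟩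
  filter_upwards [h b] with x hx
  rw [armRatio, ENNReal.coe_inv hη.ne', ← one_div]
  exact ENNReal.div_le_div (armProb_le_one P _ x) hx

/-- Both laws have densities with respect to the law of X, namely the conditional arm probabilities,
and by overlap their quotient is defined almost everywhere. This change of measure produces the
density ratio both in the cross term and in the second moment. -/
theorem covSubLaw_not (hP : BasicAssumption P) (b : Bool) :
    covSubLaw P (!b) = (covSubLaw P b).withDensity (armRatio P b) := by
  obtain ⟨η, hη, h⟩ := exists_le_armProb P hP
  rw [covSubLaw_eq, covSubLaw_eq, ← withDensity_mul _ (measurable_armProb P b)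
    (measurable_armRatio P b)]
  refine withDensity_congr_ae ?_
  filter_upwards [h b] with x hx
  have h0 : armProb P b x ≠ 0 := fun h0 => by
    rw [h0] at hx
    exact absurd hx (by simpa using hη.ne')
  rw [Pi.mul_apply, armRatio, ENNReal.mul_div_cancel h0
    (ne_top_of_le_ne_top ENNReal.one_ne_top (armProb_le_one P b x))]

theorem isProbabilityMeasure_cond_arm (hP : BasicAssumption P) (b : Bool) :
    IsProbabilityMeasure ((obsLaw P)[|{o | o.2.1 = b}]) :=
  cond_isProbabilityMeasure (armMass_pos P hP b).ne'

theorem subLaw_eq_smul (hP : BasicAssumption P) (b : Bool) :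
    subLaw P b = armMass P b • (obsLaw P)[|{o | o.2.1 = b}] := by
  rw [ProbabilityTheory.cond, smul_smul, ← armMass, ENNReal.mul_inv_cancel (armMass_pos P hP b).ne'
    (armMass_ne_top P b), one_smul, subLaw]

theorem measurable_forgetArm : Measurable fun o : ObsData d => (o.1, o.2.2) := by fun_prop

theorem isProbabilityMeasure_armLaw (hP : BasicAssumption P) (b : Bool) :
    IsProbabilityMeasure (armLaw P b) := by
  have := isProbabilityMeasure_cond_arm P hP b
  exact Measure.isProbabilityMeasure_map measurable_forgetArm.aemeasurable

theorem covSubLaw_eq_smul (hP : BasicAssumption P) (b : Bool) :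
    covSubLaw P b = armMass P b • (armLaw P b).fst := by
  rw [covSubLaw, subLaw_eq_smul P hP, Measure.map_smul, armLaw, Measure.fst,
    Measure.map_map measurable_fst measurable_forgetArm]
  rfl

theorem obsLaw_map_fst : (obsLaw P).map Prod.fst = P.fst := by
  rw [Measure.map_map measurable_fst measurable_observe, Measure.fst]
  rfl

theorem obsLaw_eq_sum : obsLaw P = ∑ b : Bool, subLaw P b := by
  have h : {o : ObsData d | o.2.1 = false} = {o | o.2.1 = true}ᶜ := by ext o; simp
  rw [Fintype.sum_bool, subLaw, subLaw, h, Measure.restrict_add_restrict_compl (measurableSet_arm _)]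

/-! ### Large deviations of the sizes of the arms -/

/-- Hoeffding's inequality for the negative indicators of the arm: their range has length 1, which
makes the centred variables sub-Gaussian with parameter 1/4. Taking `ε` equal to the arm probability
bounds the probability that the arm is empty. -/
theorem sampleLaw_card_arm_le (b : Bool) {ε : ℝ} (hε : 0 ≤ ε) (n : ℕ) :
    sampleLaw P n {z | ((arm z b).card : ℝ) ≤ ((armMass P b).toReal - ε) * n} ≤
      ENNReal.ofReal (Real.exp (-(2 * ε ^ 2) * n)) := by
  classical
  set f : ObsData d → ℝ := fun o => if o.2.1 = b then -1 else 0 with hf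
  have hfm : Measurable f := Measurable.ite (measurableSet_arm b) measurable_const measurable_const
  have hint : ∫ o, f o ∂obsLaw P = -(armMass P b).toReal := by
    have : f = Set.indicator {o : ObsData d | o.2.1 = b} (fun _ => (-1 : ℝ)) := by
      ext o; simp [f, Set.indicator]
    rw [this, integral_indicator_const _ (measurableSet_arm b)]
    simp [armMass, Measure.real]
  have hsub : HasSubgaussianMGF (fun o => f o - ∫ o, f o ∂obsLaw P)
      ((‖(0 : ℝ) - (-1)‖₊ / 2) ^ 2) (obsLaw P) :=
    hasSubgaussianMGF_of_mem_Icc hfm.aemeasurable (ae_of_all _ fun o => by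
      simp only [f]; split_ifs <;> simp)
  set X : Fin n → (Fin n → ObsData d) → ℝ := fun i z => f (z i) - ∫ o, f o ∂obsLaw P with hX
  have hind : iIndepFun X (sampleLaw P n) :=
    iIndepFun_pi (X := fun (_ : Fin n) o => f o - ∫ o, f o ∂obsLaw P)
      fun i => (hfm.sub_const _).aemeasurable
  have hXs : ∀ i ∈ Finset.univ, HasSubgaussianMGF (X i) ((‖(0 : ℝ) - (-1)‖₊ / 2) ^ 2)
      (sampleLaw P n) := by
    intro i _
    have hmp := measurePreserving_eval (fun _ : Fin n => obsLaw P) i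
    have : HasSubgaussianMGF (fun o => f o - ∫ o, f o ∂obsLaw P)
        ((‖(0 : ℝ) - (-1)‖₊ / 2) ^ 2) ((sampleLaw P n).map (Function.eval i)) := by
      rw [sampleLaw, hmp.map_eq]; exact hsub
    exact this.of_map hmp.measurable.aemeasurable
  have hH := HasSubgaussianMGF.measure_sum_ge_le_of_iIndepFun hind (s := Finset.univ) hXs
    (ε := ε * n) (by positivity)
  have hset : {z | ((arm z b).card : ℝ) ≤ ((armMass P b).toReal - ε) * n} =
      {z : Fin n → ObsData d | ε * n ≤ ∑ i, X i z} := by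
    ext z
    have hcard : ∑ i, f (z i) = -((arm z b).card : ℝ) := by
      simp only [f]
      rw [← Finset.sum_filter]
      simp [arm]
    simp only [Set.mem_ofPred_eq, X, Finset.sum_sub_distrib, hcard, hint, Finset.sum_const,
      Finset.card_univ, Fintype.card_fin, nsmul_eq_mul]
    constructor <;> intro h <;> nlinarith
  rw [hset, ← ENNReal.ofReal_toReal (measure_ne_top (sampleLaw P n) _)]
  refine ENNReal.ofReal_le_ofReal (hH.trans (Real.exp_le_exp.2 ?_))
  rcases Nat.eq_zero_or_pos n with rfl | hn
  · simp
  · have hn' : (0 : ℝ) < n := by exact_mod_cast hn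
    simp only [Finset.sum_const, Finset.card_univ, Fintype.card_fin, nsmul_eq_mul]
    push_cast
    rw [show ‖(0 : ℝ) - (-1)‖ = 1 by norm_num]
    apply le_of_eq
    field_simp

end Population

/-! ### Basic properties of the forest weights -/

section ForestBasic

variable {d : ℕ} {Ξ : Type*} [MeasurableSpace Ξ] {n : ℕ} (T : BaseLearner d Ξ)

/-- The covariates and outcomes of the units in `I`. -/
noncomputable def subsampleData (z : Fin n → ObsData d) (I : Finset (Fin n)) :
    Fin I.card → Cov d × ℝ :=
  fun r => ((z (I.orderEmbOfFin rfl r)).1, (z (I.orderEmbOfFin rfl r)).2.2)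

theorem forestLeaf_eq (z : Fin n → ObsData d) (v : Finset (Fin n) × Ξ) (x : Cov d) :
    forestLeaf T z v x = (T.tree v.1.card v.2 (subsampleData z v.1)).leafAt x := rfl

theorem mem_leafAt_self (t : SplitTree d) (x : Cov d) : x ∈ t.leafAt x := by
  induction t with
  | leaf => trivial
  | node j c l r ihl ihr =>
    simp only [SplitTree.leafAt]
    split_ifs with h
    · exact ⟨h, ihl⟩
    · exact ⟨not_le.1 h, ihr⟩

theorem leafAt_eq_of_mem (t : SplitTree d) {x y : Cov d} (h : y ∈ t.leafAt x) :
    t.leafAt y = t.leafAt x := by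
  induction t with
  | leaf => rfl
  | node j c l r ihl ihr =>
    simp only [SplitTree.leafAt] at h ⊢
    split_ifs at h with hx
    · have h1 : y j ≤ c := h.1
      rw [if_pos h1, if_pos hx, ihl h.2]
    · have h1 : ¬ y j ≤ c := not_le.2 h.1
      rw [if_neg h1, if_neg hx, ihr h.2]

theorem mem_leafAt_comm (t : SplitTree d) {x y : Cov d} : y ∈ t.leafAt x ↔ x ∈ t.leafAt y :=
  ⟨fun h => by rw [leafAt_eq_of_mem t h]; exact mem_leafAt_self t x,
    fun h => by rw [leafAt_eq_of_mem t h]; exact mem_leafAt_self t y⟩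

open Classical in
/-- The weight of a single tree. -/
noncomputable def treeWeight (z : Fin n → ObsData d) (v : Finset (Fin n) × Ξ) (i j : Fin n) : ℝ :=
  (if j ∈ v.1 ∧ (z j).1 ∈ forestLeaf T z v (z i).1 then (1 : ℝ) else 0) /
    ((v.1.filter fun k => (z k).1 ∈ forestLeaf T z v (z i).1).card : ℝ)

theorem forestWeight_eq {B : ℕ} (z : Fin n → ObsData d) (u : ForestRandomness n B Ξ)
    (i j : Fin n) : forestWeight T z u i j =
      (B : ℝ)⁻¹ * ∑ b : Fin B, treeWeight T z (u (b, !(z i).2.1)) i j := rfl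

theorem treeWeight_nonneg (z : Fin n → ObsData d) (v : Finset (Fin n) × Ξ) (i j : Fin n) :
    0 ≤ treeWeight T z v i j := by
  unfold treeWeight
  split_ifs <;> positivity

theorem forestWeight_nonneg {B : ℕ} (z : Fin n → ObsData d) (u : ForestRandomness n B Ξ)
    (i j : Fin n) : 0 ≤ forestWeight T z u i j := by
  rw [forestWeight_eq]
  exact mul_nonneg (by positivity) (Finset.sum_nonneg fun b _ => treeWeight_nonneg T _ _ _ _)

/-! #### Measurability -/

theorem measurable_subsampleData (I : Finset (Fin n)) :
    Measurable fun z : Fin n → ObsData d => subsampleData z I := by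
  unfold subsampleData
  fun_prop

theorem measurableSet_mem_forestLeaf {β : Type*} [MeasurableSpace β] {z : β → Fin n → ObsData d}
    {v : β → Finset (Fin n) × Ξ} {x y : β → Cov d} (hz : Measurable z) (hv : Measurable v)
    (hx : Measurable x) (hy : Measurable y) :
    MeasurableSet {b | y b ∈ forestLeaf T (z b) (v b) (x b)} := by
  have h : {b | y b ∈ forestLeaf T (z b) (v b) (x b)} = ⋃ I : Finset (Fin n),
      {b | (v b).1 = I} ∩
        {b | y b ∈ (T.tree I.card (v b).2 (subsampleData (z b) I)).leafAt (x b)} := by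
    ext b
    simp only [Set.mem_ofPred_eq, Set.mem_iUnion, Set.mem_inter_iff, exists_eq_left']
    rfl
  rw [h]
  refine MeasurableSet.iUnion fun I => MeasurableSet.inter ?_ ?_
  · exact measurableSet_eq_fun (measurable_fst.comp hv) measurable_const
  · exact measurableSet_mem_leafAt T (measurable_snd.comp hv)
      ((measurable_subsampleData I).comp hz) hx hy

theorem measurable_treeWeight {β : Type*} [MeasurableSpace β] {z : β → Fin n → ObsData d}
    {v : β → Finset (Fin n) × Ξ} (hz : Measurable z) (hv : Measurable v) (i j : Fin n) :
    Measurable fun b => treeWeight T (z b) (v b) i j := by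
  classical
  have hz' : ∀ k, Measurable fun b => (z b k).1 := fun k =>
    measurable_fst.comp ((measurable_pi_apply k).comp hz)
  have hmem : ∀ k, MeasurableSet {b | k ∈ (v b).1} := fun k =>
    (measurable_fst.comp hv) (MeasurableSet.of_discrete (s := {I : Finset (Fin n) | k ∈ I}))
  have hm : ∀ k, MeasurableSet {b | k ∈ (v b).1 ∧ (z b k).1 ∈ forestLeaf T (z b) (v b) (z b i).1} :=
    fun k => (hmem k).inter (measurableSet_mem_forestLeaf T hz hv (hz' i) (hz' k))
  unfold treeWeight
  refine Measurable.div (Measurable.ite (hm j) measurable_const measurable_const) ?_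
  have : ∀ b, (((v b).1.filter fun k => (z b k).1 ∈ forestLeaf T (z b) (v b) (z b i).1).card : ℝ) =
      ∑ k, if k ∈ (v b).1 ∧ (z b k).1 ∈ forestLeaf T (z b) (v b) (z b i).1 then (1 : ℝ) else 0 := by
    intro b
    rw [← Finset.sum_filter, Finset.sum_const, nsmul_eq_mul, mul_one]
    congr 2
    ext k; simp
  simp only [this]
  exact Finset.measurable_sum _ fun k _ => Measurable.ite (hm k) measurable_const measurable_const

theorem measurable_forestWeight {B : ℕ} : Measurable
    fun p : (Fin n → ObsData d) × ForestRandomness n B Ξ => forestWeight T p.1 p.2 := by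
  refine measurable_pi_lambda _ fun i => measurable_pi_lambda _ fun j => ?_
  simp only [forestWeight_eq]
  refine Measurable.const_mul (Finset.measurable_sum _ fun b _ => ?_) _
  refine measurable_treeWeight T measurable_fst ?_ i j
  have : (fun p : (Fin n → ObsData d) × ForestRandomness n B Ξ => p.2 (b, !(p.1 i).2.1)) =
      fun p => if (p.1 i).2.1 = true then p.2 (b, false) else p.2 (b, true) := by
    ext p : 1
    cases (p.1 i).2.1 <;> simp
  rw [this]
  exact Measurable.ite (measurableSet_eq_fun (by fun_prop) measurable_const) (by fun_prop)
    (by fun_prop)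

theorem measurable_forestWeight_right {B : ℕ} (z : Fin n → ObsData d) :
    Measurable fun u : ForestRandomness n B Ξ => forestWeight T z u := by
  refine measurable_pi_lambda _ fun i => measurable_pi_lambda _ fun j => ?_
  simp only [forestWeight_eq]
  exact Measurable.const_mul (Finset.measurable_sum _ fun b _ =>
    measurable_treeWeight T measurable_const (measurable_pi_apply _) i j) _

/-! #### Subsamples -/

theorem subsamples_nonempty (s : ℕ) (z : Fin n → ObsData d) (ω : Bool) :
    (subsamples s z ω).Nonempty :=
  Finset.powersetCard_nonempty.2 (min_le_right _ _)

/-- The law of the subsample and the seed of a tree. -/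
noncomputable def subsampleLaw (s : ℕ) (ρ : Measure Ξ) (z : Fin n → ObsData d) (ω : Bool) :
    Measure (Finset (Fin n) × Ξ) :=
  (uniformOn (subsamples s z ω : Set (Finset (Fin n)))).prod ρ

instance (s : ℕ) (z : Fin n → ObsData d) (ω : Bool) :
    IsProbabilityMeasure (uniformOn (subsamples s z ω : Set (Finset (Fin n)))) :=
  isProbabilityMeasure_uniformOn (Finset.finite_toSet _) (subsamples_nonempty s z ω)

variable (ρ : Measure Ξ) [IsProbabilityMeasure ρ]

instance (s : ℕ) (z : Fin n → ObsData d) (ω : Bool) :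
    IsProbabilityMeasure (subsampleLaw s ρ z ω) := by
  unfold subsampleLaw; infer_instance

theorem forestRandomnessLaw_eq (s B : ℕ) (z : Fin n → ObsData d) :
    forestRandomnessLaw s B ρ z = Measure.pi fun q : Fin B × Bool => subsampleLaw s ρ z q.2 := rfl

instance (s B : ℕ) (z : Fin n → ObsData d) :
    IsProbabilityMeasure (forestRandomnessLaw s B ρ z) := by
  rw [forestRandomnessLaw_eq]; infer_instance

instance (G : ForestDesign d Ξ) (n : ℕ+) (z : Fin n → ObsData d) :
    IsProbabilityMeasure (forestMatrix G ρ n z) :=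
  Measure.isProbabilityMeasure_map (measurable_forestWeight_right _ z).aemeasurable

theorem ae_subsampleLaw (s : ℕ) (z : Fin n → ObsData d) (ω : Bool) :
    ∀ᵐ v ∂subsampleLaw s ρ z ω, v.1 ∈ subsamples s z ω := by
  have h : ∀ᵐ I ∂uniformOn (subsamples s z ω : Set (Finset (Fin n))), I ∈ subsamples s z ω :=
    ae_cond_mem MeasurableSet.of_discrete
  exact Measure.quasiMeasurePreserving_fst.ae h

theorem ae_forestRandomnessLaw (s B : ℕ) (z : Fin n → ObsData d) :
    ∀ᵐ u ∂forestRandomnessLaw s B ρ z, ∀ q, (u q).1 ∈ subsamples s z q.2 := by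
  rw [forestRandomnessLaw_eq, ae_all_iff]
  intro q
  exact (measurePreserving_eval (fun q : Fin B × Bool => subsampleLaw s ρ z q.2) q
    ).quasiMeasurePreserving.ae (ae_subsampleLaw ρ s z q.2)

theorem lintegral_subsampleLaw (s : ℕ) (z : Fin n → ObsData d) (ω : Bool)
    {f : Finset (Fin n) × Ξ → ℝ≥0∞} (hf : Measurable f) :
    ∫⁻ v, f v ∂subsampleLaw s ρ z ω = ((subsamples s z ω).card : ℝ≥0∞)⁻¹ *
      ∑ I ∈ subsamples s z ω, ∫⁻ ξ, f (I, ξ) ∂ρ := by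
  rw [subsampleLaw, lintegral_prod _ hf.aemeasurable, uniformOn, ProbabilityTheory.cond,
    lintegral_smul_measure, lintegral_finset]
  simp

/-- Every leaf contains a data point by `leaf_nonempty`, so the denominator is positive and the
default value of 0/0 never enters. -/
theorem sum_treeWeight {s : ℕ} (hs : 0 < s) {z : Fin n → ObsData d} {v : Finset (Fin n) × Ξ}
    {ω : Bool} (hv : v.1 ∈ subsamples s z ω) (hω : (arm z ω).Nonempty) (i : Fin n) :
    ∑ j with (z j).2.1 = ω, treeWeight T z v i j = 1 := by
  classical
  rw [subsamples, Finset.mem_powersetCard] at hv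
  have hcard : 0 < v.1.card := by
    rw [hv.2]; exact lt_min hs (Finset.card_pos.2 hω)
  obtain ⟨r, hr⟩ := T.leaf_nonempty v.1.card v.2 (subsampleData z v.1) hcard (z i).1
  have hpos : 0 < (v.1.filter fun k => (z k).1 ∈ forestLeaf T z v (z i).1).card :=
    Finset.card_pos.2 ⟨v.1.orderEmbOfFin rfl r, Finset.mem_filter.2
      ⟨Finset.orderEmbOfFin_mem _ _ _, hr⟩⟩
  simp only [treeWeight]
  rw [← Finset.sum_div, ← Finset.sum_filter, Finset.sum_const, nsmul_eq_mul, mul_one]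
  rw [div_eq_one_iff_eq (by positivity)]
  congr 2
  ext k
  simp only [Finset.mem_filter, Finset.mem_univ, true_and]
  constructor
  · exact fun h => h.2
  · intro h
    refine ⟨?_, h⟩
    have := hv.1 h.1
    simpa [arm] using this

theorem rowSum_forestWeight {s B : ℕ} (hs : 0 < s) (hB : 0 < B) {z : Fin n → ObsData d}
    {u : ForestRandomness n B Ξ} (hu : ∀ q, (u q).1 ∈ subsamples s z q.2) (i : Fin n)
    (hi : ∃ j, (z j).2.1 = !(z i).2.1) : rowSum z (forestWeight T z u) i = 1 := by
  have hne : (arm z (!(z i).2.1)).Nonempty := by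
    obtain ⟨j, hj⟩ := hi
    exact ⟨j, by simp [arm, hj]⟩
  simp only [rowSum, forestWeight_eq]
  rw [← Finset.mul_sum, Finset.sum_comm,
    Finset.sum_congr rfl fun b _ => sum_treeWeight T hs (hu (b, !(z i).2.1)) hne i]
  have : (B : ℝ) ≠ 0 := by exact_mod_cast hB.ne'
  simp [this]

theorem lintegral_forestMatrix (G : ForestDesign d Ξ) (n : ℕ+) (z : Fin n → ObsData d)
    {F : (Fin n → Fin n → ℝ) → ℝ≥0∞} (hF : Measurable F) :
    ∫⁻ W, F W ∂forestMatrix G ρ n z =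
      ∫⁻ u, F (forestWeight (G.learner n) z u) ∂forestRandomnessLaw (G.s n) (G.B n) ρ z :=
  lintegral_map hF (measurable_forestWeight_right _ z)

theorem ae_forestMatrix_nonneg (G : ForestDesign d Ξ) (n : ℕ+) (z : Fin n → ObsData d) :
    ∀ᵐ W ∂forestMatrix G ρ n z, (∀ i j, 0 ≤ W i j) ∧
      ∀ i, (∃ j, (z j).2.1 = !(z i).2.1) → rowSum z W i = 1 := by
  rw [forestMatrix, ae_map_iff (measurable_forestWeight_right _ z).aemeasurable]
  · filter_upwards [ae_forestRandomnessLaw ρ (G.s n) (G.B n) z] with u hu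
    exact ⟨fun i j => forestWeight_nonneg _ z u i j, fun i hi =>
      rowSum_forestWeight _ (G.s n).pos (G.B n).pos hu i hi⟩
  · have hm : ∀ i j, Measurable fun W : Fin n → Fin n → ℝ => W i j := fun i j =>
      (measurable_pi_apply j).comp (measurable_pi_apply i)
    have h1 : MeasurableSet {W : Fin n → Fin n → ℝ | ∀ i j, 0 ≤ W i j} := by
      simp only [Set.ofPred_forall]
      exact MeasurableSet.iInter fun i => MeasurableSet.iInter fun j =>
        measurableSet_le measurable_const (hm i j)
    have h2 : MeasurableSet {W : Fin n → Fin n → ℝ |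
        ∀ i, (∃ j, (z j).2.1 = !(z i).2.1) → rowSum z W i = 1} := by
      simp only [Set.ofPred_forall]
      refine MeasurableSet.iInter fun i => MeasurableSet.iInter fun _ => ?_
      exact measurableSet_eq_fun (Finset.measurable_sum _ fun j _ => hm i j) measurable_const
    exact h1.inter h2

/-! #### Permutations of the sample -/

theorem uniformOn_map_equiv {α : Type*} [MeasurableSpace α] [DiscreteMeasurableSpace α]
    (e : α ≃ α) (S : Set α) : (uniformOn S).map e = uniformOn (e '' S) := by
  ext A hA
  rw [Measure.map_apply Measurable.of_discrete hA, uniformOn, uniformOn,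
    cond_apply MeasurableSet.of_discrete, cond_apply MeasurableSet.of_discrete,
    Measure.count_injective_image e.injective,
    ← Measure.count_injective_image e.injective (S ∩ e ⁻¹' A), Set.image_inter_preimage]

theorem arm_comp_perm (z : Fin n → ObsData d) (π : Equiv.Perm (Fin n)) (ω : Bool) :
    (arm (z ∘ π) ω).map π.toEmbedding = arm z ω := by
  ext i
  simp only [arm, Finset.mem_map, Finset.mem_filter, Finset.mem_univ, true_and,
    Function.comp_apply, Equiv.coe_toEmbedding]
  constructor
  · rintro ⟨j, hj, rfl⟩; exact hj
  · intro h; exact ⟨π.symm i, by simpa using h, by simp⟩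

theorem subsamples_comp_perm (s : ℕ) (z : Fin n → ObsData d) (π : Equiv.Perm (Fin n)) (ω : Bool) :
    π.finsetCongr '' (subsamples s (z ∘ π) ω : Set (Finset (Fin n))) = subsamples s z ω := by
  have h : subsamples s z ω = (subsamples s (z ∘ π) ω).map π.finsetCongr.toEmbedding := by
    simp only [subsamples]
    rw [← arm_comp_perm z π ω, Finset.powersetCard_map, Finset.card_map]
    rfl
  rw [h]
  ext I
  simp

theorem tree_congr_equiv {m m' : ℕ} (ξ : Ξ) (a : Fin m → Cov d × ℝ) (a' : Fin m' → Cov d × ℝ)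
    (e : Fin m ≃ Fin m') (h : ∀ r, a r = a' (e r)) : T.tree m ξ a = T.tree m' ξ a' := by
  obtain rfl : m = m' := by simpa using Fintype.card_congr e
  rw [← T.symmetric m ξ a' e]
  congr 1
  ext r : 1
  exact h r

/-- The tree reads a subsample in increasing order of the indices, which `π` need not preserve; the
symmetry of the learner absorbs the reordering. -/
theorem forestLeaf_comp_perm (z : Fin n → ObsData d) (π : Equiv.Perm (Fin n))
    (I : Finset (Fin n)) (ξ : Ξ) (x : Cov d) :
    forestLeaf T z (I.map π.toEmbedding, ξ) x = forestLeaf T (z ∘ π) (I, ξ) x := by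
  rw [forestLeaf_eq, forestLeaf_eq]
  congr 1
  refine (tree_congr_equiv T ξ _ _ (((I.orderIsoOfFin rfl).toEquiv.trans
    (π.subtypeEquiv (q := (· ∈ I.map π.toEmbedding)) (p := (· ∈ I)) fun a => by simp)).trans
    ((I.map π.toEmbedding).orderIsoOfFin rfl).symm.toEquiv) fun r => ?_).symm
  have h : ((I.map π.toEmbedding).orderEmbOfFin rfl
      (((I.map π.toEmbedding).orderIsoOfFin rfl).symm
        ((π.subtypeEquiv (q := (· ∈ I.map π.toEmbedding)) (p := (· ∈ I)) fun a => by simp) (I.orderIsoOfFin rfl r)))) = π (I.orderEmbOfFin rfl r) := by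
    rw [← Finset.coe_orderIsoOfFin_apply, OrderIso.apply_symm_apply]
    rfl
  change _ = ((z ((I.map π.toEmbedding).orderEmbOfFin rfl _)).1, _)
  simp only [subsampleData, Equiv.trans_apply, RelIso.coe_fn_toEquiv, h]
  rfl

theorem treeWeight_comp_perm (z : Fin n → ObsData d) (π : Equiv.Perm (Fin n))
    (I : Finset (Fin n)) (ξ : Ξ) (i j : Fin n) :
    treeWeight T z (I.map π.toEmbedding, ξ) (π i) (π j) = treeWeight T (z ∘ π) (I, ξ) i j := by
  classical
  simp only [treeWeight, forestLeaf_comp_perm, Function.comp_apply]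
  rw [Finset.filter_map, Finset.card_map]
  congr 2
  have : (π j ∈ I.map π.toEmbedding) = (j ∈ I) := by simp
  simp only [this]

/-- Relabelling the units in the subsamples. -/
noncomputable def relabel {B : ℕ} (π : Equiv.Perm (Fin n)) (u : ForestRandomness n B Ξ) :
    ForestRandomness n B Ξ := fun q => Prod.map π.finsetCongr id (u q)

theorem measurable_relabel {B : ℕ} (π : Equiv.Perm (Fin n)) :
    Measurable (relabel π : ForestRandomness n B Ξ → _) := by
  have h : Measurable (Prod.map (β₁ := Ξ) π.finsetCongr id) :=
    (Measurable.of_discrete (f := π.finsetCongr)).prodMap measurable_id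
  exact measurable_pi_lambda _ fun q => h.comp (measurable_pi_apply q)

theorem subsampleLaw_relabel (s : ℕ) (z : Fin n → ObsData d) (π : Equiv.Perm (Fin n)) (ω : Bool) :
    (subsampleLaw s ρ (z ∘ π) ω).map (Prod.map π.finsetCongr id) = subsampleLaw s ρ z ω := by
  rw [subsampleLaw, ← Measure.map_prod_map _ _ Measurable.of_discrete measurable_id,
    uniformOn_map_equiv, subsamples_comp_perm, Measure.map_id, subsampleLaw]

theorem forestRandomnessLaw_relabel (s B : ℕ) (z : Fin n → ObsData d) (π : Equiv.Perm (Fin n)) :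
    (forestRandomnessLaw s B ρ (z ∘ π)).map (relabel π) = forestRandomnessLaw s B ρ z := by
  have h : Measurable (Prod.map (β₁ := Ξ) π.finsetCongr id) :=
    (Measurable.of_discrete (f := π.finsetCongr)).prodMap measurable_id
  have hsf : ∀ q : Fin B × Bool, SigmaFinite
      ((subsampleLaw s ρ (z ∘ π) q.2).map (Prod.map π.finsetCongr id)) := by
    intro q; rw [subsampleLaw_relabel]; infer_instance
  rw [forestRandomnessLaw_eq, forestRandomnessLaw_eq]
  simp only [← subsampleLaw_relabel ρ s z π]
  exact Measure.pi_map_pi (μ := fun q : Fin B × Bool => subsampleLaw s ρ (z ∘ π) q.2)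
    (f := fun _ => Prod.map π.finsetCongr id) fun q => h.aemeasurable

theorem forestWeight_relabel {B : ℕ} (z : Fin n → ObsData d) (π : Equiv.Perm (Fin n))
    (u : ForestRandomness n B Ξ) (i j : Fin n) :
    forestWeight T z (relabel π u) (π i) (π j) = forestWeight T (z ∘ π) u i j := by
  simp only [forestWeight_eq]
  congr 1
  refine Finset.sum_congr rfl fun b _ => ?_
  exact treeWeight_comp_perm T z π _ _ i j

theorem permutationInvariant_forestMatrix (G : ForestDesign d Ξ) :
    PermutationInvariant (forestMatrix G ρ) := by
  intro n z π
  have hm : Measurable fun (W : Fin n → Fin n → ℝ) i j => W (π i) (π j) := by fun_prop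
  rw [forestMatrix, forestMatrix, Measure.map_map hm (measurable_forestWeight_right _ z),
    ← forestRandomnessLaw_relabel ρ (G.s n) (G.B n) z π,
    Measure.map_map (hm.comp (measurable_forestWeight_right _ z)) (measurable_relabel π)]
  congr 1
  ext u i j
  exact (forestWeight_relabel (G.learner n) z π u i j).symm

theorem outcomeFree_forestMatrix (G : ForestDesign d Ξ) (hG : G.Honest) :
    OutcomeFree (forestMatrix G ρ) := by
  classical
  intro n z z' hx hD
  have hleaf : ∀ v x, forestLeaf (G.learner n) z v x = forestLeaf (G.learner n) z' v x := by
    intro v x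
    rw [forestLeaf_eq, forestLeaf_eq]
    congr 1
    exact hG n _ _ _ _ fun r => hx _
  have hw : forestWeight (B := G.B n) (G.learner n) z = forestWeight (G.learner n) z' := by
    have ht : ∀ v i j, treeWeight (G.learner n) z v i j = treeWeight (G.learner n) z' v i j := by
      intro v i j
      have h : ∀ k, (z k).1 ∈ forestLeaf (G.learner n) z v (z i).1 ↔
          (z' k).1 ∈ forestLeaf (G.learner n) z' v (z' i).1 := fun k => by rw [hleaf, hx, hx]
      unfold treeWeight
      congr 1
      · exact if_congr (and_congr_right fun _ => h j) rfl rfl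
      · exact congrArg _ (congrArg _ (Finset.filter_congr fun k _ => h k))
    ext u i j
    rw [forestWeight_eq, forestWeight_eq]
    simp only [ht]
    rw [hD i]
  have harm : ∀ ω, arm z ω = arm z' ω := by intro ω; simp only [arm, hD]
  have hl : forestRandomnessLaw (G.s n) (G.B n) ρ z = forestRandomnessLaw (G.s n) (G.B n) ρ z' := by
    simp only [forestRandomnessLaw, subsamples, harm]
  rw [forestMatrix, forestMatrix, hw, hl]

/-! #### Expectations -/

/-- The law depends on the sample through the treatments only and thus takes finitely many values;
`rep δ` is a sample with treatments `δ`. On each piece the measure is fixed. -/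
theorem measurable_lintegral_forestRandomnessLaw (s B : ℕ)
    {f : (Fin n → ObsData d) × ForestRandomness n B Ξ → ℝ≥0∞} (hf : Measurable f) :
    Measurable fun z => ∫⁻ u, f (z, u) ∂forestRandomnessLaw s B ρ z := by
  classical
  let rep : (Fin n → Bool) → Fin n → ObsData d := fun δ i => (0, δ i, 0)
  have h : (fun z => ∫⁻ u, f (z, u) ∂forestRandomnessLaw s B ρ z) = fun z =>
      ∑ δ : Fin n → Bool, if (fun i => (z i).2.1) = δ then
        ∫⁻ u, f (z, u) ∂forestRandomnessLaw s B ρ (rep δ) else 0 := by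
    ext z
    rw [Finset.sum_ite_eq Finset.univ (fun i => (z i).2.1)
      (fun δ => ∫⁻ u, f (z, u) ∂forestRandomnessLaw s B ρ (rep δ)), if_pos (Finset.mem_univ _)]
    have : forestRandomnessLaw s B ρ (rep fun i => (z i).2.1) = forestRandomnessLaw s B ρ z := by
      simp only [forestRandomnessLaw, subsamples, arm, rep]
    rw [this]
  rw [h]
  refine Finset.measurable_sum _ fun δ _ => Measurable.ite ?_ ?_ measurable_const
  · exact measurableSet_eq_fun (by fun_prop) measurable_const
  · exact hf.lintegral_prod_right'

theorem measurable_lintegral_forestMatrix (G : ForestDesign d Ξ) (n : ℕ+)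
    {F : (Fin n → ObsData d) → (Fin n → Fin n → ℝ) → ℝ≥0∞}
    (hF : Measurable (Function.uncurry F)) :
    Measurable fun z => ∫⁻ W, F z W ∂forestMatrix G ρ n z := by
  have h : (fun z => ∫⁻ W, F z W ∂forestMatrix G ρ n z) = fun z =>
      ∫⁻ u, F z (forestWeight (G.learner n) z u) ∂forestRandomnessLaw (G.s n) (G.B n) ρ z := by
    ext z
    exact lintegral_forestMatrix ρ G n z (hF.comp measurable_prodMk_left)
  rw [h]
  exact measurable_lintegral_forestRandomnessLaw ρ _ _
    (f := fun p => Function.uncurry F (p.1, forestWeight (G.learner n) p.1 p.2))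
    (hF.comp (measurable_fst.prodMk (measurable_forestWeight _)))

variable (P : Measure (FullData d)) [IsProbabilityMeasure P]

theorem expect_finset_sum (G : ForestDesign d Ξ) (n : ℕ+) {κ : Type*} (S : Finset κ)
    {F : κ → (Fin n → ObsData d) → (Fin n → Fin n → ℝ) → ℝ≥0∞}
    (hF : ∀ k, Measurable (Function.uncurry (F k))) :
    expect P (forestMatrix G ρ) n (fun z W => ∑ k ∈ S, F k z W) =
      ∑ k ∈ S, expect P (forestMatrix G ρ) n (F k) := by
  simp only [expect]
  rw [← lintegral_finsetSum _ fun k _ => measurable_lintegral_forestMatrix ρ G n (hF k)]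
  refine lintegral_congr fun z => ?_
  exact lintegral_finsetSum _ fun k _ => (hF k).comp measurable_prodMk_left

theorem expect_add (G : ForestDesign d Ξ) (n : ℕ+)
    {F F' : (Fin n → ObsData d) → (Fin n → Fin n → ℝ) → ℝ≥0∞}
    (hF : Measurable (Function.uncurry F)) (hF' : Measurable (Function.uncurry F')) :
    expect P (forestMatrix G ρ) n (fun z W => F z W + F' z W) =
      expect P (forestMatrix G ρ) n F + expect P (forestMatrix G ρ) n F' := by
  have := expect_finset_sum ρ P G n (Finset.univ : Finset Bool)
    (F := fun b => if b = true then F else F') (fun b => by cases b <;> simpa)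
  simpa using this

theorem expect_mono (G : ForestDesign d Ξ) (n : ℕ+)
    {F F' : (Fin n → ObsData d) → (Fin n → Fin n → ℝ) → ℝ≥0∞}
    (h : ∀ᵐ z ∂sampleLaw P n, ∀ᵐ W ∂forestMatrix G ρ n z, F z W ≤ F' z W) :
    expect P (forestMatrix G ρ) n F ≤ expect P (forestMatrix G ρ) n F' := by
  refine lintegral_mono_ae ?_
  filter_upwards [h] with z hz
  exact lintegral_mono_ae hz

/-- The i.i.d. law of the sample and the conditional law of the weights are both equivariant under
relabelling, so units may be exchanged inside an expectation. -/
theorem expect_comp_perm {w : SmoothingMatrix d} (hw : PermutationInvariant w) (n : ℕ+)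
    (F : (Fin n → ObsData d) → (Fin n → Fin n → ℝ) → ℝ≥0∞) (π : Equiv.Perm (Fin n)) :
    expect P w n (fun z W => F (z ∘ π) fun i j => W (π i) (π j)) = expect P w n F := by
  let e : (Fin n → Fin n → ℝ) ≃ᵐ (Fin n → Fin n → ℝ) :=
    { toFun := fun W i j => W (π i) (π j)
      invFun := fun W i j => W (π.symm i) (π.symm j)
      left_inv := fun W => by ext i j; simp
      right_inv := fun W => by ext i j; simp
      measurable_toFun := by simp only [Equiv.coe_fn_mk]; fun_prop
      measurable_invFun := by simp only [Equiv.coe_fn_symm_mk]; fun_prop }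
  simp only [expect]
  rw [← lintegral_pi_comp_perm (obsLaw P) π fun z => ∫⁻ W, F z W ∂w n z]
  refine lintegral_congr fun z => ?_
  rw [hw n z π]
  exact (lintegral_map_equiv (F (z ∘ π)) e).symm

theorem measurableSet_arm_eq {n : ℕ} (i j : Fin n) :
    MeasurableSet {z : Fin n → ObsData d | (z j).2.1 = !(z i).2.1} :=
  measurableSet_eq_fun (by fun_prop) ((Measurable.of_discrete (f := Bool.not)).comp (by fun_prop))

theorem measurable_weight_term {n : ℕ} (i j k l : Fin n) {φ : ObsData d × ObsData d → ℝ≥0∞}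
    (hφ : Measurable φ) :
    Measurable (Function.uncurry fun (z : Fin n → ObsData d) (W : Fin n → Fin n → ℝ) =>
      if (z j).2.1 = !(z i).2.1 then ENNReal.ofReal (W k l) * φ (z i, z j) else 0) := by
  refine Measurable.ite (measurable_fst (measurableSet_arm_eq i j)) ?_ measurable_const
  refine Measurable.mul ?_ (hφ.comp (by fun_prop))
  exact ENNReal.measurable_ofReal.comp ((measurable_pi_apply l).comp
    ((measurable_pi_apply k).comp measurable_snd))

/-- Exchanging the roles of the units in the weights. -/
theorem expect_col_eq_row (G : ForestDesign d Ξ) (n : ℕ+) {φ : ObsData d × ObsData d → ℝ≥0∞}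
    (hφ : Measurable φ) :
    expect P (forestMatrix G ρ) n (fun z W => ∑ j, if (z j).2.1 = !(z 0).2.1 then
      ENNReal.ofReal (W j 0) * φ (z 0, z j) else 0) =
    expect P (forestMatrix G ρ) n (fun z W => ∑ j, if (z j).2.1 = !(z 0).2.1 then
      ENNReal.ofReal (W 0 j) * φ (z j, z 0) else 0) := by
  have hφ' : Measurable fun q : ObsData d × ObsData d => φ (q.2, q.1) :=
    hφ.comp measurable_swap
  rw [expect_finset_sum ρ P G n _ fun j => measurable_weight_term 0 j j 0 hφ,
    expect_finset_sum ρ P G n _ fun j => measurable_weight_term 0 j 0 j hφ']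
  refine Finset.sum_congr rfl fun j _ => ?_
  -- The transposition of units 0 and `j` turns `W j 0` into `W 0 j`, and the condition of lying in
  -- opposite arms is symmetric.
  rw [← expect_comp_perm P (permutationInvariant_forestMatrix ρ G) n _ (Equiv.swap 0 j)]
  congr 1
  ext z W
  simp only [Function.comp_apply, Equiv.swap_apply_left, Equiv.swap_apply_right]
  have : ((z 0).2.1 = !(z j).2.1) ↔ ((z j).2.1 = !(z 0).2.1) := by
    cases (z 0).2.1 <;> cases (z j).2.1 <;> simp
  simp only [this]

theorem enorm_colSum_le {n : ℕ} (z : Fin n → ObsData d) {W : Fin n → Fin n → ℝ}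
    (hW : ∀ i j, 0 ≤ W i j) (i : Fin n) : ‖colSum z W i‖ₑ =
      ∑ j, if (z j).2.1 = !(z i).2.1 then ENNReal.ofReal (W j i) else 0 := by
  rw [colSum, Real.enorm_eq_ofReal (Finset.sum_nonneg fun j _ => hW j i),
    ENNReal.ofReal_sum_of_nonneg fun j _ => hW j i, Finset.sum_filter]

theorem ofReal_rowSum {n : ℕ} (z : Fin n → ObsData d) {W : Fin n → Fin n → ℝ}
    (hW : ∀ i j, 0 ≤ W i j) (i : Fin n) : ENNReal.ofReal (rowSum z W i) =
      ∑ j, if (z j).2.1 = !(z i).2.1 then ENNReal.ofReal (W i j) else 0 := by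
  rw [rowSum, ENNReal.ofReal_sum_of_nonneg fun j _ => hW i j, Finset.sum_filter]

theorem rowSum_eq_zero {n : ℕ} (z : Fin n → ObsData d) (W : Fin n → Fin n → ℝ) (i : Fin n)
    (h : ¬ ∃ j, (z j).2.1 = !(z i).2.1) : rowSum z W i = 0 := by
  push Not at h
  exact Finset.sum_eq_zero fun j hj => absurd (Finset.mem_filter.1 hj).2 (h j)

/-- By exchangeability the expected column sum equals the expected row sum, and a row sum is 0 or 1.
-/
theorem colSumBounded_forestMatrix (G : ForestDesign d Ξ) :
    ColSumBounded P (forestMatrix G ρ) := by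
  refine ⟨1, fun n => ?_⟩
  calc _ ≤ expect P (forestMatrix G ρ) n (fun z W => ∑ j, if (z j).2.1 = !(z 0).2.1 then
          ENNReal.ofReal (W j 0) * 1 else 0) := by
        refine expect_mono ρ P G n (ae_of_all _ fun z => ?_)
        filter_upwards [ae_forestMatrix_nonneg ρ G n z] with W hW
        rw [enorm_colSum_le z hW.1]
        simp
    _ = expect P (forestMatrix G ρ) n (fun z W => ∑ j, if (z j).2.1 = !(z 0).2.1 then
          ENNReal.ofReal (W 0 j) * 1 else 0) :=
        expect_col_eq_row ρ P G n (φ := fun _ => 1) measurable_const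
    _ ≤ expect P (forestMatrix G ρ) n (fun _ _ => 1) := by
        refine expect_mono ρ P G n (ae_of_all _ fun z => ?_)
        filter_upwards [ae_forestMatrix_nonneg ρ G n z] with W hW
        simp only [mul_one]
        rw [← ofReal_rowSum z hW.1]
        by_cases h : ∃ j, (z j).2.1 = !(z 0).2.1
        · rw [hW.2 0 h]; simp
        · rw [rowSum_eq_zero z W 0 h]; simp
    _ ≤ _ := by simp [expect]

end ForestBasic

/-! ### Conditioning on the treatments -/

section Marginals

variable {ι κ κ' α : Type*} [Fintype ι] [Fintype κ] [Fintype κ'] [MeasurableSpace α]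

theorem pi_map_comp_injective (μ : ι → Measure α) [∀ i, IsProbabilityMeasure (μ i)] {e : κ → ι}
    (he : Function.Injective e) :
    (Measure.pi μ).map (fun z l => z (e l)) = Measure.pi fun l => μ (e l) := by
  refine (Measure.pi_eq fun t ht => ?_).symm
  rw [Measure.map_apply (by fun_prop) (MeasurableSet.univ_pi ht)]
  have h : (fun (z : ι → α) l => z (e l)) ⁻¹' Set.univ.pi t =
      Set.univ.pi (Function.extend e t fun _ => Set.univ) := by
    ext z
    simp only [Set.mem_preimage, Set.mem_pi, Set.mem_univ, true_implies]
    constructor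
    · intro hz i
      by_cases hi : ∃ l, e l = i
      · obtain ⟨l, rfl⟩ := hi
        rw [he.extend_apply]; exact hz l
      · rw [Function.extend_apply' _ _ _ hi]; trivial
    · intro hz l
      have := hz (e l)
      rwa [he.extend_apply] at this
  rw [h, Measure.pi_pi]
  refine (Fintype.prod_of_injective e he _ _ (fun i hi => ?_) fun l => ?_).symm
  · rw [Function.extend_apply' _ _ _ (by simpa using hi), measure_univ]
  · rw [he.extend_apply]

theorem pi_map_comp_prod (μ : ι → Measure α) [∀ i, IsProbabilityMeasure (μ i)] {e : κ → ι}
    {e' : κ' → ι} (he : Function.Injective (Sum.elim e e')) :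
    (Measure.pi μ).map (fun z => ((fun l => z (e l)), fun l => z (e' l))) =
      (Measure.pi fun l => μ (e l)).prod (Measure.pi fun l => μ (e' l)) := by
  have h1 := pi_map_comp_injective μ he
  have h2 := (measurePreserving_sumPiEquivProdPi (X := fun _ : κ ⊕ κ' => α)
    fun l => μ (Sum.elim e e' l)).map_eq
  rw [← h1, Measure.map_map (MeasurableEquiv.measurable _) (by fun_prop)] at h2
  exact h2

theorem pi_smul_measure (μ : ι → Measure α) [∀ i, IsProbabilityMeasure (μ i)] (c : ι → ℝ≥0∞)
    (hc : ∀ i, c i ≠ ∞) : (Measure.pi fun i => c i • μ i) = (∏ i, c i) • Measure.pi μ := by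
  have : ∀ i, IsFiniteMeasure (c i • μ i) := fun i => Measure.smul_finite _ (hc i)
  refine Measure.pi_eq fun t ht => ?_
  simp [Measure.pi_pi, Finset.prod_mul_distrib]

end Marginals

/-! ### Reduction to one tree and independent units of the opposite arm -/

section Reduction

variable {d : ℕ} (P : Measure (FullData d)) [IsProbabilityMeasure P]

/-- Given the treatments, the units are independent, each with the law of its arm; the sample law is
the mixture over the treatment vectors `δ`. -/
theorem sampleLaw_eq_sum (hP : BasicAssumption P) (n : ℕ) : sampleLaw P n =
    ∑ δ : Fin n → Bool, (∏ i, armMass P (δ i)) •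
      Measure.pi fun i => (obsLaw P)[|{o | o.2.1 = δ i}] := by
  have := isProbabilityMeasure_cond_arm P hP
  refine Measure.pi_eq fun t ht => ?_
  simp only [Measure.coe_finsetSum, Finset.sum_apply, Measure.smul_apply, Measure.pi_pi,
    smul_eq_mul, ← Finset.prod_mul_distrib]
  have : ∀ i, obsLaw P (t i) =
      ∑ b : Bool, armMass P b * (obsLaw P)[|{o | o.2.1 = b}] (t i) := by
    intro i
    conv_lhs => rw [obsLaw_eq_sum]
    simp [subLaw_eq_smul P hP]
  simp only [this]
  rw [Finset.prod_univ_sum, Fintype.piFinset_univ]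

theorem ae_pi_cond_arm (hP : BasicAssumption P) {n : ℕ} (δ : Fin n → Bool) :
    ∀ᵐ z ∂Measure.pi (fun i => (obsLaw P)[|{o : ObsData d | o.2.1 = δ i}]),
      ∀ i, (z i).2.1 = δ i := by
  have := isProbabilityMeasure_cond_arm P hP
  rw [ae_all_iff]
  intro i
  exact (measurePreserving_eval (fun i => (obsLaw P)[|{o : ObsData d | o.2.1 = δ i}]) i
    ).quasiMeasurePreserving.ae (ae_cond_mem (measurableSet_arm (δ i)))

theorem lintegral_sampleLaw_eq_sum (hP : BasicAssumption P) (n : ℕ)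
    (F : (Fin n → ObsData d) → ℝ≥0∞) : ∫⁻ z, F z ∂sampleLaw P n =
      ∑ δ : Fin n → Bool, (∏ i, armMass P (δ i)) *
        ∫⁻ z, F z ∂Measure.pi fun i => (obsLaw P)[|{o | o.2.1 = δ i}] := by
  rw [sampleLaw_eq_sum P hP n, lintegral_finsetSum_measure]
  simp

theorem sum_prod_armMass (hP : BasicAssumption P) {n k : ℕ} {e : Fin k → Fin n}
    (he : Function.Injective e) (ω : Bool) :
    (∑ δ : Fin n → Bool, if ∀ l, δ (e l) = ω then ∏ i, armMass P (δ i) else 0) =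
      armMass P ω ^ k := by
  have := isProbabilityMeasure_cond_arm P hP
  have hm : Measurable fun (z : Fin n → ObsData d) l => z (e l) := by fun_prop
  have hS : MeasurableSet (Set.univ.pi fun _ : Fin k => {o : ObsData d | o.2.1 = ω}) :=
    MeasurableSet.univ_pi fun _ => measurableSet_arm ω
  have h1 : (sampleLaw P n).map (fun z l => z (e l))
      (Set.univ.pi fun _ : Fin k => {o : ObsData d | o.2.1 = ω}) = armMass P ω ^ k := by
    rw [pi_map_comp_injective (fun _ => obsLaw P) he, Measure.pi_pi]
    simp [armMass]
  rw [← h1, Measure.map_apply hm hS, ← lintegral_indicator_one (hm hS),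
    lintegral_sampleLaw_eq_sum P hP]
  refine Finset.sum_congr rfl fun δ _ => ?_
  have : ∫⁻ z, ((fun (z : Fin n → ObsData d) l => z (e l)) ⁻¹'
      (Set.univ.pi fun _ : Fin k => {o : ObsData d | o.2.1 = ω})).indicator 1 z
        ∂(Measure.pi fun i => (obsLaw P)[|{o | o.2.1 = δ i}]) =
      ∫⁻ _, (if ∀ l, δ (e l) = ω then 1 else 0)
        ∂(Measure.pi fun i => (obsLaw P)[|{o : ObsData d | o.2.1 = δ i}]) := by
    refine lintegral_congr_ae ?_
    filter_upwards [ae_pi_cond_arm P hP δ] with z hz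
    have h : z ∈ (fun (z : Fin n → ObsData d) l => z (e l)) ⁻¹'
        (Set.univ.pi fun _ : Fin k => {o : ObsData d | o.2.1 = ω}) ↔ ∀ l, δ (e l) = ω := by
      simp [hz]
    by_cases hl : ∀ l, δ (e l) = ω
    · rw [Set.indicator_of_mem (h.2 hl), if_pos hl, Pi.one_apply]
    · rw [Set.indicator_of_notMem (fun hz => hl (h.1 hz)), if_neg hl]
  rw [this, lintegral_const, measure_univ, mul_one]
  split_ifs <;> simp

variable {Ξ : Type*} [MeasurableSpace Ξ] (ρ : Measure Ξ) [IsProbabilityMeasure ρ]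

/-- The units `e l` and those of `I` lie in different arms, so they are disjoint sets of coordinates
and hence independent given the treatments. The value is the same for all subsamples of size `s`. -/
theorem lintegral_pi_cond_subsample (hP : BasicAssumption P) {n k s : ℕ} (ω : Bool)
    {e : Fin k → Fin n} (he : Function.Injective e) {δ : Fin n → Bool} (hδ : ∀ l, δ (e l) = !ω)
    {I : Finset (Fin n)} (hI : ∀ i ∈ I, δ i = ω) (hs : I.card = s)
    {Φ : (m : ℕ) → (Fin k → Cov d) → (Fin m → Cov d × ℝ) → Ξ → ℝ≥0∞}
    (hΦ : ∀ m, Measurable fun q : (Fin k → Cov d) × (Fin m → Cov d × ℝ) × Ξ => Φ m q.1 q.2.1 q.2.2) :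
    ∫⁻ z, ∫⁻ ξ, Φ I.card (fun l => (z (e l)).1) (subsampleData z I) ξ ∂ρ
        ∂(Measure.pi fun i => (obsLaw P)[|{o | o.2.1 = δ i}]) =
      ∫⁻ x, ∫⁻ q, Φ s x q.1 q.2 ∂treeLaw P ρ s ω
        ∂(Measure.pi fun _ : Fin k => (armLaw P (!ω)).fst) := by
  subst hs
  have := isProbabilityMeasure_cond_arm P hP
  have := isProbabilityMeasure_armLaw P hP
  let ι : Fin I.card → Fin n := fun r => I.orderEmbOfFin rfl r
  have hι : ∀ r, δ (ι r) = ω := fun r => hI _ (Finset.orderEmbOfFin_mem _ _ _)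
  have hinj : Function.Injective (Sum.elim e ι) := by
    refine he.sumElim (I.orderEmbOfFin rfl).injective fun a b hab => ?_
    have h1 := hδ a
    rw [hab, hι b] at h1
    cases ω <;> simp at h1
  have hmap : (Measure.pi fun i => (obsLaw P)[|{o : ObsData d | o.2.1 = δ i}]).map
      (fun z => ((fun l => (z (e l)).1), subsampleData z I)) =
      (Measure.pi fun _ : Fin k => (armLaw P (!ω)).fst).prod
        (Measure.pi fun _ : Fin I.card => armLaw P ω) := by
    have h1 := pi_map_comp_prod (fun i => (obsLaw P)[|{o : ObsData d | o.2.1 = δ i}]) hinj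
    simp only [hδ, hι] at h1
    have e1 : (Measure.pi fun _ : Fin k => (armLaw P (!ω)).fst) =
        (Measure.pi fun _ : Fin k => (obsLaw P)[|{o : ObsData d | o.2.1 = !ω}]).map
          (fun z l => (z l).1) := by
      have hf : (armLaw P (!ω)).fst = ((obsLaw P)[|{o : ObsData d | o.2.1 = !ω}]).map Prod.fst := by
        rw [armLaw, Measure.fst, Measure.map_map measurable_fst measurable_forgetArm]; rfl
      have hp : IsProbabilityMeasure (((obsLaw P)[|{o : ObsData d | o.2.1 = !ω}]).map Prod.fst) :=
        hf ▸ inferInstance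
      rw [hf]
      exact (Measure.pi_map_pi (μ := fun _ : Fin k => (obsLaw P)[|{o : ObsData d | o.2.1 = !ω}])
        (f := fun _ => Prod.fst) fun _ => measurable_fst.aemeasurable).symm
    have e2 : (Measure.pi fun _ : Fin I.card => armLaw P ω) =
        (Measure.pi fun _ : Fin I.card => (obsLaw P)[|{o : ObsData d | o.2.1 = ω}]).map
          (fun z l => ((z l).1, (z l).2.2)) := by
      have hp : IsProbabilityMeasure (((obsLaw P)[|{o : ObsData d | o.2.1 = ω}]).map
          fun o => (o.1, o.2.2)) := this ω
      exact (Measure.pi_map_pi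
        (μ := fun _ : Fin I.card => (obsLaw P)[|{o : ObsData d | o.2.1 = ω}])
        (f := fun _ o => (o.1, o.2.2)) fun _ => measurable_forgetArm.aemeasurable).symm
    rw [e1, e2, Measure.map_prod_map _ _ (by fun_prop) (by fun_prop), ← h1,
      Measure.map_map (by fun_prop) (by fun_prop)]
    rfl
  have hmeas : Measurable fun z : Fin n → ObsData d =>
      ((fun l => (z (e l)).1), subsampleData z I) :=
    Measurable.prodMk (by fun_prop) (measurable_subsampleData I)
  have hΦ2 : Measurable fun q : (Fin k → Cov d) × (Fin I.card → Cov d × ℝ) =>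
      ∫⁻ ξ, Φ I.card q.1 q.2 ξ ∂ρ := by
    refine Measurable.lintegral_prod_right' (f := fun w : ((Fin k → Cov d) ×
      (Fin I.card → Cov d × ℝ)) × Ξ => Φ I.card w.1.1 w.1.2 w.2) ?_
    exact (hΦ I.card).comp (g := fun q : (Fin k → Cov d) × (Fin I.card → Cov d × ℝ) × Ξ =>
      Φ I.card q.1 q.2.1 q.2.2) (f := fun w : ((Fin k → Cov d) ×
      (Fin I.card → Cov d × ℝ)) × Ξ => (w.1.1, w.1.2, w.2)) (by fun_prop)
  calc _ = ∫⁻ q, ∫⁻ ξ, Φ I.card q.1 q.2 ξ ∂ρ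
        ∂((Measure.pi fun i => (obsLaw P)[|{o : ObsData d | o.2.1 = δ i}]).map
      (fun z => ((fun l => (z (e l)).1), subsampleData z I))) := (lintegral_map hΦ2 hmeas).symm
    _ = _ := by
      rw [hmap, lintegral_prod _ hΦ2.aemeasurable]
      refine lintegral_congr fun x => ?_
      have h : Measurable fun q : (Fin I.card → Cov d × ℝ) × Ξ => Φ I.card x q.1 q.2 :=
        (hΦ I.card).comp measurable_prodMk_left
      rw [treeLaw, lintegral_prod _ h.aemeasurable]

/-- Given the treatments, every subsample contributes the same integral, so the uniform choice plays
no role. The inequality comes from discarding the event that the arm has at least `s` units; the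
unnormalized `covSubLaw` carries the probability that the `k` units are in the arm `!ω`. -/
theorem lintegral_subsample_le (hP : BasicAssumption P) {n k : ℕ} (s : ℕ) (ω : Bool)
    {e : Fin k → Fin n} (he : Function.Injective e)
    {Φ : (m : ℕ) → (Fin k → Cov d) → (Fin m → Cov d × ℝ) → Ξ → ℝ≥0∞}
    (hΦ : ∀ m, Measurable fun q : (Fin k → Cov d) × (Fin m → Cov d × ℝ) × Ξ => Φ m q.1 q.2.1 q.2.2) :
    ∫⁻ z, (if (∀ l, (z (e l)).2.1 = !ω) ∧ s ≤ (arm z ω).card then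
        ∫⁻ v, Φ v.1.card (fun l => (z (e l)).1) (subsampleData z v.1) v.2 ∂subsampleLaw s ρ z ω
        else 0) ∂sampleLaw P n ≤
      ∫⁻ x, ∫⁻ q, Φ s x q.1 q.2 ∂treeLaw P ρ s ω
        ∂(Measure.pi fun _ : Fin k => covSubLaw P (!ω)) := by
  have := isProbabilityMeasure_cond_arm P hP
  have := isProbabilityMeasure_armLaw P hP
  set V := ∫⁻ x, ∫⁻ q, Φ s x q.1 q.2 ∂treeLaw P ρ s ω
        ∂(Measure.pi fun _ : Fin k => (armLaw P (!ω)).fst) with hV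
  have hR : ∫⁻ x, ∫⁻ q, Φ s x q.1 q.2 ∂treeLaw P ρ s ω
        ∂(Measure.pi fun _ : Fin k => covSubLaw P (!ω)) = armMass P (!ω) ^ k * V := by
    simp only [covSubLaw_eq_smul P hP]
    rw [pi_smul_measure _ _ fun _ => armMass_ne_top P (!ω), lintegral_smul_measure]
    simp [hV]
  rw [hR, lintegral_sampleLaw_eq_sum P hP, ← sum_prod_armMass P hP he, Finset.sum_mul]
  refine Finset.sum_le_sum fun δ _ => ?_
  let J : Finset (Fin n) := {i | δ i = ω}
  let S := J.powersetCard s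
  have hmeasΦ : ∀ I : Finset (Fin n), Measurable fun w : (Fin n → ObsData d) × Ξ =>
      Φ I.card (fun l => (w.1 (e l)).1) (subsampleData w.1 I) w.2 := by
    intro I
    have h1 : Measurable fun w : (Fin n → ObsData d) × Ξ => subsampleData w.1 I :=
      (measurable_subsampleData I).comp measurable_fst
    have h2 : Measurable fun w : (Fin n → ObsData d) × Ξ => ((fun l => (w.1 (e l)).1),
      subsampleData w.1 I, w.2) := Measurable.prodMk (by fun_prop) (h1.prodMk measurable_snd)
    exact (hΦ I.card).comp h2
  by_cases hδ : ∀ l, δ (e l) = !ω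
  swap
  · have : ∫⁻ z, (if (∀ l, (z (e l)).2.1 = !ω) ∧ s ≤ (arm z ω).card then
        ∫⁻ v, Φ v.1.card (fun l => (z (e l)).1) (subsampleData z v.1) v.2 ∂subsampleLaw s ρ z ω
        else 0) ∂(Measure.pi fun i => (obsLaw P)[|{o : ObsData d | o.2.1 = δ i}]) =
        ∫⁻ z, 0 ∂(Measure.pi fun i => (obsLaw P)[|{o : ObsData d | o.2.1 = δ i}]) := by
      refine lintegral_congr_ae ?_
      filter_upwards [ae_pi_cond_arm P hP δ] with z hz
      rw [if_neg fun h => hδ fun l => (hz (e l)).symm.trans (h.1 l)]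
    rw [this]; simp
  rw [if_pos hδ]
  gcongr
  calc _ ≤ ∫⁻ z, (S.card : ℝ≥0∞)⁻¹ * ∑ I ∈ S,
        ∫⁻ ξ, Φ I.card (fun l => (z (e l)).1) (subsampleData z I) ξ ∂ρ
        ∂(Measure.pi fun i => (obsLaw P)[|{o : ObsData d | o.2.1 = δ i}]) := by
        refine lintegral_mono_ae ?_
        filter_upwards [ae_pi_cond_arm P hP δ] with z hz
        split_ifs with h
        · have hJ : arm z ω = J := by ext i; simp [arm, J, hz]
          have hS : subsamples s z ω = S := by
            rw [subsamples, min_eq_left h.2, hJ]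
          rw [lintegral_subsampleLaw, hS]
          have hm2 : Measurable fun p : Finset (Fin n) × Ξ =>
              Φ p.1.card (fun l => (z (e l)).1) (subsampleData z p.1) p.2 :=
            measurable_from_prod_countable_right fun I => (hmeasΦ I).comp measurable_prodMk_left
          exact hm2
        · exact zero_le
    _ = (S.card : ℝ≥0∞)⁻¹ * ∑ I ∈ S, V := by
        rw [lintegral_const_mul _ (Finset.measurable_fun_sum _ fun I _ =>
          (hmeasΦ I).lintegral_prod_right'), lintegral_finsetSum _ fun I _ =>
          (hmeasΦ I).lintegral_prod_right']
        congr 1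
        refine Finset.sum_congr rfl fun I hI => ?_
        rw [Finset.mem_powersetCard] at hI
        exact lintegral_pi_cond_subsample P ρ hP ω he hδ
          (fun i hi => (Finset.mem_filter.1 (hI.1 hi)).2) hI.2 hΦ
    _ ≤ V := by
        rw [Finset.sum_const, nsmul_eq_mul, ← mul_assoc]
        exact mul_le_of_le_one_left' (ENNReal.inv_mul_le_one _)

end Reduction

/-! ### Pairs of points in the same leaf -/

section Pairs

variable {d : ℕ} {Ξ : Type*} [MeasurableSpace Ξ] (T : BaseLearner d Ξ)

open Classical in
/-- The inverse size of the leaf of `x` if `y` is in this leaf, and zero otherwise. -/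
noncomputable def leafShare {m : ℕ} (ξ : Ξ) (a : Fin m → Cov d × ℝ) (x y : Cov d) : ℝ≥0∞ :=
  if y ∈ (T.tree m ξ a).leafAt x then (leafCount T ξ a x a : ℝ≥0∞)⁻¹ else 0

theorem leafShare_le {m : ℕ} (ξ : Ξ) (a : Fin m → Cov d × ℝ) (x y : Cov d) :
    leafShare T ξ a x y ≤ (leafCount T ξ a x a : ℝ≥0∞)⁻¹ := by
  unfold leafShare
  split_ifs <;> simp

theorem leafShare_comm {m : ℕ} (ξ : Ξ) (a : Fin m → Cov d × ℝ) (x y : Cov d) :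
    leafShare T ξ a x y = leafShare T ξ a y x := by
  classical
  unfold leafShare
  by_cases h : y ∈ (T.tree m ξ a).leafAt x
  · rw [if_pos h, if_pos ((mem_leafAt_comm _).1 h)]
    simp only [leafCount, leafAt_eq_of_mem _ h]
  · rw [if_neg h, if_neg fun h' => h ((mem_leafAt_comm _).1 h')]

theorem measurable_leafShare {β : Type*} [MeasurableSpace β] {m : ℕ} {f : β → Ξ}
    {g : β → Fin m → Cov d × ℝ} {h h' : β → Cov d} (hf : Measurable f) (hg : Measurable g)
    (hh : Measurable h) (hh' : Measurable h') :
    Measurable fun b => leafShare T (f b) (g b) (h b) (h' b) := by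
  classical
  unfold leafShare
  refine Measurable.ite (measurableSet_mem_leafAt T hf hg hh hh') ?_ measurable_const
  exact ((Measurable.of_discrete (f := fun k : ℕ => (k : ℝ≥0∞))).comp
    (measurable_leafCount T hf hg hh hg)).inv

theorem measurable_leafCount_inv {β : Type*} [MeasurableSpace β] {m : ℕ} {f : β → Ξ}
    {g : β → Fin m → Cov d × ℝ} {h : β → Cov d} (hf : Measurable f) (hg : Measurable g)
    (hh : Measurable h) :
    Measurable fun b => (leafCount T (f b) (g b) (h b) (g b) : ℝ≥0∞)⁻¹ :=
  ((Measurable.of_discrete (f := fun k : ℕ => (k : ℝ≥0∞))).comp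
    (measurable_leafCount T hf hg hh hg)).inv

theorem sum_leafShare {m m' : ℕ} (ξ : Ξ) (a : Fin m → Cov d × ℝ) (x : Cov d)
    (y : Fin m' → Cov d × ℝ) : ∑ k, leafShare T ξ a x (y k).1 =
      (leafCount T ξ a x y : ℝ≥0∞) / leafCount T ξ a x a := by
  classical
  simp only [leafShare]
  rw [← Finset.sum_filter, Finset.sum_const, nsmul_eq_mul, div_eq_mul_inv]
  rfl

theorem lintegral_pi_pair {α : Type*} [MeasurableSpace α] (μ : Measure α) [IsProbabilityMeasure μ]
    {s : ℕ} {k k' : Fin s} (h : k ≠ k') {f : α → α → ℝ≥0∞} (hf : Measurable (Function.uncurry f)) :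
    ∫⁻ y, f (y k) (y k') ∂(Measure.pi fun _ : Fin s => μ) = ∫⁻ x, ∫⁻ y, f x y ∂μ ∂μ := by
  have hind : IndepFun (fun y : Fin s → α => y k) (fun y => y k')
      (Measure.pi fun _ : Fin s => μ) :=
    (iIndepFun_pi (X := fun (_ : Fin s) (x : α) => x) (μ := fun _ => μ)
      fun _ => aemeasurable_id).indepFun h
  rw [indepFun_iff_map_prod_eq_prod_map_map (measurable_pi_apply k).aemeasurable
      (measurable_pi_apply k').aemeasurable,
    (measurePreserving_eval (fun _ : Fin s => μ) k).map_eq,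
    (measurePreserving_eval (fun _ : Fin s => μ) k').map_eq] at hind
  have h2 := lintegral_prod (μ := μ) (ν := μ) (Function.uncurry f) hf.aemeasurable
  rw [← hind, lintegral_map hf (by fun_prop)] at h2
  exact h2

theorem mul_le_half_sq_add (a b : ℝ≥0∞) : 2 * (a * b) ≤ a ^ 2 + b ^ 2 := by
  rcases le_total a b with h | h
  · obtain ⟨c, rfl⟩ := exists_add_of_le h
    exact le_of_le_of_eq (le_self_add (a := 2 * (a * (a + c))) (b := c ^ 2)) (by ring)
  · obtain ⟨c, rfl⟩ := exists_add_of_le h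
    exact le_of_le_of_eq (le_self_add (a := 2 * ((b + c) * b)) (b := c ^ 2)) (by ring)

/-- The probability that two points are in the same leaf, weighted with its inverse size. -/
theorem card_mul_lintegral_leafShare_le (μ : Measure (Cov d × ℝ)) [IsProbabilityMeasure μ]
    (ρ : Measure Ξ) [IsProbabilityMeasure ρ] {s : ℕ} (hs : 0 < s) {r : Cov d → ℝ≥0∞}
    (hr : Measurable r) {R : ℝ≥0} (hR : ∀ x, r x ≤ R) :
    (s : ℝ≥0∞) * ∫⁻ x, ∫⁻ y, ∫⁻ q, r x ^ 2 * leafShare T q.2 q.1 x y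
      ∂((Measure.pi fun _ : Fin s => μ).prod ρ) ∂μ.fst ∂μ.fst ≤
    ∫⁻ x, r x ^ 2 ∂μ.fst + R ^ 2 * ((s : ℝ≥0∞)⁻¹ *
      ∫⁻ p, ∑ k : Fin s, (((leafCount T p.1.2 p.1.1 (p.2 k).1 p.2 : ℝ≥0∞) /
        leafCount T p.1.2 p.1.1 (p.2 k).1 p.1.1) - 1)
      ∂(((Measure.pi fun _ : Fin s => μ).prod ρ).prod (Measure.pi fun _ : Fin s => μ))) := by
  set Q := (Measure.pi fun _ : Fin s => μ).prod ρ
  set π := Measure.pi fun _ : Fin s => μ with hπ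
  set J := ∫⁻ x, ∫⁻ y, ∫⁻ q, r x ^ 2 * leafShare T q.2 q.1 x y ∂Q ∂μ.fst ∂μ.fst with hJ
  set Γ := ∫⁻ p, ∑ k : Fin s, (((leafCount T p.1.2 p.1.1 (p.2 k).1 p.2 : ℝ≥0∞) /
        leafCount T p.1.2 p.1.1 (p.2 k).1 p.1.1) - 1) ∂(Q.prod π) with hΓ
  have hs0 : (s : ℝ≥0∞) ≠ 0 := by exact_mod_cast hs.ne'
  have hst : (s : ℝ≥0∞) ≠ ∞ := ENNReal.natCast_ne_top s
  have hm3 : Measurable fun w : ((Cov d × ℝ) × (Cov d × ℝ)) × ((Fin s → Cov d × ℝ) × Ξ) =>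
      r w.1.1.1 ^ 2 * leafShare T w.2.2 w.2.1 w.1.1.1 w.1.2.1 :=
    ((hr.comp (by fun_prop)).pow_const 2).mul (measurable_leafShare T (by fun_prop) (by fun_prop)
      (by fun_prop) (by fun_prop))
  have hm2 : Measurable fun w : (Cov d × ℝ) × (Cov d × ℝ) =>
      ∫⁻ q, r w.1.1 ^ 2 * leafShare T q.2 q.1 w.1.1 w.2.1 ∂Q := hm3.lintegral_prod_right'
  have hm2' : Measurable fun w : Cov d × Cov d =>
      ∫⁻ q, r w.1 ^ 2 * leafShare T q.2 q.1 w.1 w.2 ∂Q := by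
    refine Measurable.lintegral_prod_right' (f := fun w : (Cov d × Cov d) ×
      ((Fin s → Cov d × ℝ) × Ξ) => r w.1.1 ^ 2 * leafShare T w.2.2 w.2.1 w.1.1 w.1.2) ?_
    exact ((hr.comp (by fun_prop)).pow_const 2).mul (measurable_leafShare T (by fun_prop)
      (by fun_prop) (by fun_prop) (by fun_prop))
  have hJ' : J = ∫⁻ x, ∫⁻ y, ∫⁻ q, r x.1 ^ 2 * leafShare T q.2 q.1 x.1 y.1 ∂Q ∂μ ∂μ := by
    rw [hJ, Measure.fst, lintegral_map hm2'.lintegral_prod_right' measurable_fst]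
    refine lintegral_congr fun x => ?_
    exact lintegral_map (hm2'.comp (measurable_prodMk_left (x := x.1))) measurable_fst
  have hswap : ∀ k k' : Fin s, ∫⁻ y, ∫⁻ q, r (y k).1 ^ 2 *
      leafShare T q.2 q.1 (y k).1 (y k').1 ∂Q ∂π = ∫⁻ p, r (p.2 k).1 ^ 2 *
      leafShare T p.1.2 p.1.1 (p.2 k).1 (p.2 k').1 ∂(Q.prod π) := by
    intro k k'
    rw [lintegral_prod_symm]
    exact (((hr.comp (by fun_prop)).pow_const 2).mul (measurable_leafShare T (by fun_prop)
      (by fun_prop) (by fun_prop) (by fun_prop))).aemeasurable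
  -- For different indices the two points are independent and equality holds. For equal indices the
  -- point shares its leaf with itself, which is the largest possible share.
  have hterm : ∀ k k' : Fin s, J ≤ ∫⁻ p, r (p.2 k).1 ^ 2 *
      leafShare T p.1.2 p.1.1 (p.2 k).1 (p.2 k').1 ∂(Q.prod π) := by
    intro k k'
    rw [← hswap, hJ']
    by_cases h : k = k'
    · subst h
      have h1 : Measurable fun x : Cov d × ℝ =>
          ∫⁻ q, r x.1 ^ 2 * leafShare T q.2 q.1 x.1 x.1 ∂Q := hm2.comp (measurable_id.prodMk measurable_id)
      rw [(measurePreserving_eval (fun _ : Fin s => μ) k).lintegral_comp h1]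
      refine lintegral_mono fun x => ?_
      calc _ ≤ ∫⁻ _ : Cov d × ℝ, ∫⁻ q, r x.1 ^ 2 * leafShare T q.2 q.1 x.1 x.1 ∂Q ∂μ := by
            refine lintegral_mono fun y => lintegral_mono fun q => ?_
            gcongr
            refine (leafShare_le _ _ _ _ _).trans (le_of_eq ?_)
            rw [leafShare, if_pos (mem_leafAt_self _ _)]
        _ = _ := by simp
    · rw [lintegral_pi_pair μ h (f := fun x y =>
        ∫⁻ q, r x.1 ^ 2 * leafShare T q.2 q.1 x.1 y.1 ∂Q) hm2]
  -- Summing the shares over the ghost points gives M/N for the leaf of the `k`-th ghost point,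
  -- which is at most 1 plus the truncated difference `M/N - 1`. The 1 yields the main term, the
  -- excess is bounded by means of `R`.
  have hmain : (s : ℝ≥0∞) * (s * J) ≤ s * ∫⁻ x, r x ^ 2 ∂μ.fst + R ^ 2 * Γ := by
    calc (s : ℝ≥0∞) * (s * J) = ∑ _k : Fin s, ∑ _k' : Fin s, J := by simp
      _ ≤ ∑ k : Fin s, ∑ k' : Fin s, ∫⁻ p, r (p.2 k).1 ^ 2 *
          leafShare T p.1.2 p.1.1 (p.2 k).1 (p.2 k').1 ∂(Q.prod π) :=
        Finset.sum_le_sum fun k _ => Finset.sum_le_sum fun k' _ => hterm k k'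
      _ = ∫⁻ p, ∑ k : Fin s, r (p.2 k).1 ^ 2 * ((leafCount T p.1.2 p.1.1 (p.2 k).1 p.2 : ℝ≥0∞) /
            leafCount T p.1.2 p.1.1 (p.2 k).1 p.1.1) ∂(Q.prod π) := by
        have hmm : ∀ k k' : Fin s, Measurable fun p : ((Fin s → Cov d × ℝ) × Ξ) ×
            (Fin s → Cov d × ℝ) => r (p.2 k).1 ^ 2 *
            leafShare T p.1.2 p.1.1 (p.2 k).1 (p.2 k').1 := fun k k' =>
          ((hr.comp (by fun_prop)).pow_const 2).mul (measurable_leafShare T (by fun_prop)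
            (by fun_prop) (by fun_prop) (by fun_prop))
        simp only [← sum_leafShare, Finset.mul_sum]
        rw [lintegral_finsetSum _ fun k _ => Finset.measurable_fun_sum _ fun k' _ => hmm k k']
        refine Finset.sum_congr rfl fun k _ => ?_
        rw [lintegral_finsetSum _ fun k' _ => hmm k k']
      _ ≤ ∫⁻ p, ∑ k : Fin s, r (p.2 k).1 ^ 2 + R ^ 2 *
            ∑ k : Fin s, ((leafCount T p.1.2 p.1.1 (p.2 k).1 p.2 : ℝ≥0∞) /
            leafCount T p.1.2 p.1.1 (p.2 k).1 p.1.1 - 1) ∂(Q.prod π) := by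
        refine lintegral_mono fun p => ?_
        rw [Finset.mul_sum, ← Finset.sum_add_distrib]
        refine Finset.sum_le_sum fun k _ => ?_
        calc _ ≤ r (p.2 k).1 ^ 2 * (1 + ((leafCount T p.1.2 p.1.1 (p.2 k).1 p.2 : ℝ≥0∞) /
              leafCount T p.1.2 p.1.1 (p.2 k).1 p.1.1 - 1)) := by
              gcongr
              exact le_add_tsub
          _ ≤ _ := by
              rw [mul_add, mul_one]
              gcongr
              exact hR _
      _ = s * ∫⁻ x, r x ^ 2 ∂μ.fst + R ^ 2 * Γ := by
        have hm4 : ∀ k : Fin s, Measurable fun p : ((Fin s → Cov d × ℝ) × Ξ) ×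
            (Fin s → Cov d × ℝ) => r (p.2 k).1 ^ 2 := fun k => (hr.comp (by fun_prop)).pow_const 2
        rw [lintegral_add_left (Finset.measurable_fun_sum _ fun k _ => hm4 k),
          lintegral_finsetSum _ fun k _ => hm4 k]
        congr 1
        · have : ∀ k : Fin s, ∫⁻ p, r (p.2 k).1 ^ 2 ∂(Q.prod π) = ∫⁻ x, r x ^ 2 ∂μ.fst := by
            intro k
            have h1 : Measurable fun x : Cov d × ℝ => r x.1 ^ 2 :=
              (hr.comp measurable_fst).pow_const 2
            have h2 := (measurePreserving_snd (μ := Q) (ν := π)).lintegral_comp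
              (h1.comp (measurable_pi_apply k))
            rw [Measure.fst, lintegral_map (hr.pow_const 2) measurable_fst,
              ← (measurePreserving_eval (fun _ : Fin s => μ) k).lintegral_comp h1]
            exact h2
          simp [this]
        · rw [lintegral_const_mul' _ _ (by simp)]
  rw [← ENNReal.mul_le_mul_iff_right hs0 hst]
  refine hmain.trans (le_of_eq ?_)
  have : (s : ℝ≥0∞) * (s : ℝ≥0∞)⁻¹ = 1 := ENNReal.mul_inv_cancel hs0 hst
  calc _ = s * ∫⁻ x, r x ^ 2 ∂μ.fst + R ^ 2 * Γ * (s * (s : ℝ≥0∞)⁻¹) := by rw [this, mul_one]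
    _ = _ := by ring

end Pairs

/-! ### Pairs of units in one leaf of a tree of the opposite arm -/

section PairMass

variable {d : ℕ} (P : Measure (FullData d)) [IsProbabilityMeasure P]
  {Ξ : Type*} [MeasurableSpace Ξ] (ρ : Measure Ξ) [IsProbabilityMeasure ρ] (G : ForestDesign d Ξ)

theorem isProbabilityMeasure_treeLaw (hP : BasicAssumption P) (s : ℕ) (ω : Bool) :
    IsProbabilityMeasure (treeLaw P ρ s ω) := by
  have := isProbabilityMeasure_armLaw P hP
  unfold treeLaw; infer_instance

theorem lintegral_leafCount_inv_le (ω : Bool) (n : ℕ+) (x : Cov d) :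
    ∫⁻ q, (leafCount (G.learner n) q.2 q.1 x q.1 : ℝ≥0∞)⁻¹ ∂treeLaw P ρ (G.s n) ω ≤
      invMinLeafSize P ρ G ω n := by
  refine lintegral_mono fun q => ENNReal.inv_le_inv.2 ?_
  exact iInf_le _ x

/-- A leaf contains at most all `s` data. Hence vanishing inverse leaf sizes force the subsample
size to infinity. -/
theorem inv_subsample_le (hP : BasicAssumption P) (ω : Bool) (n : ℕ+) :
    ((G.s n : ℕ) : ℝ≥0∞)⁻¹ ≤ invMinLeafSize P ρ G ω n := by
  have := isProbabilityMeasure_treeLaw P ρ hP (G.s n) ω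
  calc ((G.s n : ℕ) : ℝ≥0∞)⁻¹ = ∫⁻ _, ((G.s n : ℕ) : ℝ≥0∞)⁻¹ ∂treeLaw P ρ (G.s n) ω := by simp
    _ ≤ ∫⁻ q, (leafCount (G.learner n) q.2 q.1 0 q.1 : ℝ≥0∞)⁻¹ ∂treeLaw P ρ (G.s n) ω := by
        refine lintegral_mono fun q => ENNReal.inv_le_inv.2 ?_
        exact_mod_cast leafCount_le _ _ _ _ _
    _ ≤ _ := lintegral_leafCount_inv_le P ρ G ω n 0

theorem tendsto_subsample (hP : BasicAssumption P) {ω : Bool}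
    (h : Tendsto (invMinLeafSize P ρ G ω) atTop (𝓝 0)) :
    Tendsto (fun n => (G.s n : ℕ)) atTop atTop := by
  have h1 : Tendsto (fun n => ((G.s n : ℕ) : ℝ≥0∞)⁻¹) atTop (𝓝 0) :=
    tendsto_of_tendsto_of_tendsto_of_le_of_le tendsto_const_nhds h (fun _ => zero_le)
      fun n => inv_subsample_le P ρ G hP ω n
  have h2 : Tendsto (fun n => ((G.s n : ℕ) : ℝ≥0∞)) atTop (𝓝 ∞) := by
    simpa using tendsto_inv_iff.2 h1
  refine tendsto_atTop.2 fun N => ?_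
  filter_upwards [h2.eventually (lt_mem_nhds (ENNReal.natCast_lt_top N))] with n hn
  exact_mod_cast hn.le

/-- The probability that two units of the arm opposite to `ω` are in the same leaf, weighted with
its inverse size. -/
noncomputable def pairMass (ω : Bool) (n : ℕ+) : ℝ≥0∞ :=
  ∫⁻ x, ∫⁻ q, leafShare (G.learner n) q.2 q.1 (x 0) (x 1) ∂treeLaw P ρ (G.s n) ω
    ∂(Measure.pi fun _ : Fin 2 => covSubLaw P (!ω))

/-- Moving both points from the opposite arm to the arm of the tree creates the factor r(x) r(y). It
is at most half of r(x)² + r(y)², and as `leafShare` is symmetric both squares contribute equally.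
The points are now distributed like the data of the tree, so the ghost sample bound applies. -/
theorem pairMass_le (hP : BasicAssumption P) (ω : Bool) (n : ℕ+) {r : Cov d → ℝ≥0∞}
    (hr : Measurable r) (hr' : armRatio P ω =ᵐ[P.fst] r) :
    pairMass P ρ G ω n ≤ armMass P ω ^ 2 * ∫⁻ x, ∫⁻ y, ∫⁻ q, r x ^ 2 *
      leafShare (G.learner n) q.2 q.1 x y ∂treeLaw P ρ (G.s n) ω ∂(armLaw P ω).fst
        ∂(armLaw P ω).fst := by
  have := isProbabilityMeasure_treeLaw P ρ hP (G.s n) ω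
  have := isProbabilityMeasure_armLaw P hP ω
  set Q := treeLaw P ρ (G.s n) ω
  set g : Cov d → Cov d → ℝ≥0∞ := fun x y => ∫⁻ q, leafShare (G.learner n) q.2 q.1 x y ∂Q with hg
  have hgm : Measurable (Function.uncurry g) := by
    refine Measurable.lintegral_prod_right' (f := fun w : (Cov d × Cov d) ×
      ((Fin (G.s n) → Cov d × ℝ) × Ξ) => leafShare (G.learner n) w.2.2 w.2.1 w.1.1 w.1.2) ?_
    exact measurable_leafShare _ (by fun_prop) (by fun_prop) (by fun_prop) (by fun_prop)
  have hcomm : ∀ x y, g x y = g y x := fun x y => lintegral_congr fun q => leafShare_comm _ _ _ _ _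
  have hν : covSubLaw P (!ω) = (covSubLaw P ω).withDensity r := by
    rw [covSubLaw_not P hP]
    exact withDensity_congr_ae (covSubLaw_absolutelyContinuous P ω hr')
  set ν := covSubLaw P ω
  have hgx : ∀ x, Measurable (g x) := fun x => hgm.comp measurable_prodMk_left
  have h1 : pairMass P ρ G ω n = ∫⁻ x, ∫⁻ y, g x y ∂covSubLaw P (!ω) ∂covSubLaw P (!ω) := by
    have h := (measurePreserving_piFinTwo fun _ : Fin 2 => covSubLaw P (!ω)).lintegral_comp hgm
    rw [lintegral_prod _ hgm.aemeasurable] at h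
    exact h
  have h2 : ∫⁻ x, ∫⁻ y, g x y ∂covSubLaw P (!ω) ∂covSubLaw P (!ω) =
      ∫⁻ x, ∫⁻ y, r x * r y * g x y ∂ν ∂ν := by
    rw [hν, lintegral_withDensity_eq_lintegral_mul _ hr]
    · refine lintegral_congr fun x => ?_
      rw [Pi.mul_apply, lintegral_withDensity_eq_lintegral_mul _ hr (hgx x),
        ← lintegral_const_mul _ (hr.mul (hgx x))]
      simp only [Pi.mul_apply, mul_assoc]
    · exact hgm.lintegral_prod_right'
  have hm : Measurable fun w : Cov d × Cov d => r w.1 ^ 2 * g w.1 w.2 :=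
    ((hr.comp measurable_fst).pow_const 2).mul hgm
  have h3 : 2 * ∫⁻ x, ∫⁻ y, r x * r y * g x y ∂ν ∂ν ≤ 2 * ∫⁻ x, ∫⁻ y, r x ^ 2 * g x y ∂ν ∂ν := by
    calc 2 * ∫⁻ x, ∫⁻ y, r x * r y * g x y ∂ν ∂ν =
        ∫⁻ x, ∫⁻ y, 2 * (r x * r y) * g x y ∂ν ∂ν := by
          rw [← lintegral_const_mul' _ _ (by simp)]
          refine lintegral_congr fun x => ?_
          rw [← lintegral_const_mul' _ _ (by simp)]
          simp only [mul_assoc]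
      _ ≤ ∫⁻ x, ∫⁻ y, (r x ^ 2 * g x y + r y ^ 2 * g y x) ∂ν ∂ν := by
          refine lintegral_mono fun x => lintegral_mono fun y => ?_
          rw [hcomm y x, ← add_mul]
          gcongr
          exact mul_le_half_sq_add _ _
      _ = ∫⁻ x, ∫⁻ y, r x ^ 2 * g x y ∂ν ∂ν + ∫⁻ x, ∫⁻ y, r y ^ 2 * g y x ∂ν ∂ν := by
          rw [← lintegral_add_left hm.lintegral_prod_right']
          refine lintegral_congr fun x => ?_
          exact lintegral_add_left (hm.comp measurable_prodMk_left) _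
      _ = _ := by
          rw [two_mul]
          congr 1
          exact lintegral_lintegral_swap (f := fun x y => r y ^ 2 * g y x)
            (hm.comp measurable_swap).aemeasurable
  rw [ENNReal.mul_le_mul_iff_right (by simp) (by simp)] at h3
  rw [h1, h2]
  refine h3.trans (le_of_eq ?_)
  have hν2 : ν = armMass P ω • (armLaw P ω).fst := covSubLaw_eq_smul P hP ω
  have hrg : ∀ x y, r x ^ 2 * g x y =
      ∫⁻ q, r x ^ 2 * leafShare (G.learner n) q.2 q.1 x y ∂Q := fun x y => by
    rw [hg, lintegral_const_mul _ (measurable_leafShare _ (by fun_prop) (by fun_prop) (by fun_prop)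
      (by fun_prop))]
  simp only [← hrg, hν2, lintegral_smul_measure, smul_eq_mul]
  rw [lintegral_const_mul _ hm.lintegral_prod_right', sq, mul_assoc]

theorem eventually_pairMass_le (hd : 0 < d) (hP : BasicAssumption P) {ω : Bool}
    (h : Tendsto (invMinLeafSize P ρ G ω) atTop (𝓝 0)) {ε : ℝ≥0} (hε : 0 < ε) :
    ∀ᶠ n : ℕ+ in atTop, ((G.s n : ℕ) : ℝ≥0∞) * pairMass P ρ G ω n ≤
      armMass P ω * ∫⁻ x, armRatio P ω x ^ 2 ∂covSubLaw P ω + ε := by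
  have := isProbabilityMeasure_armLaw P hP ω
  obtain ⟨R, hR⟩ := exists_armRatio_le P hP
  -- The ratio is bounded almost everywhere only; the cutoff changes it on a null set and makes the
  -- bound hold at every point.
  set r : Cov d → ℝ≥0∞ := fun x => min (armRatio P ω x) R with hr
  have hrm : Measurable r := (measurable_armRatio P ω).min measurable_const
  have hr' : armRatio P ω =ᵐ[P.fst] r := by
    filter_upwards [hR ω] with x hx
    exact (min_eq_left hx).symm
  have hrR : ∀ x, r x ≤ R := fun x => min_le_right _ _
  set ε' : ℝ≥0 := ε / (2 * (R ^ 2 + 1)) with hε'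
  have hε'0 : 0 < ε' := by positivity
  obtain ⟨K, s₀, hK⟩ := exists_lintegral_div_sub_one_le (Ξ := Ξ) hd (ε := ε') (by exact_mod_cast hε'0)
  have hsm : ∀ᶠ n : ℕ+ in atTop, K * invMinLeafSize P ρ G ω n < ε' := by
    have : Tendsto (fun n => K * invMinLeafSize P ρ G ω n) atTop (𝓝 0) := by
      simpa using ENNReal.Tendsto.const_mul h (Or.inr (ENNReal.coe_ne_top (r := K)))
    exact this.eventually_lt_const (by exact_mod_cast hε'0)
  filter_upwards [hsm, (tendsto_subsample P ρ G hP h).eventually_ge_atTop s₀] with n hn hs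
  have hK' := hK (G.s n) hs (G.s n).pos (G.learner n) (armLaw P ω) ρ
  set s : ℕ := (G.s n : ℕ) with hsdef
  have hs0 : 0 < s := (G.s n).pos
  have hs1 : (s : ℝ≥0∞) ≠ 0 := by exact_mod_cast hs0.ne'
  have hs2 : (s : ℝ≥0∞) ≠ ∞ := ENNReal.natCast_ne_top s
  have hcard := card_mul_lintegral_leafShare_le (G.learner n) (armLaw P ω) ρ hs0 hrm hrR
  set Γ := ∫⁻ p, ∑ k : Fin s, (((leafCount (G.learner n) p.1.2 p.1.1 (p.2 k).1 p.2 : ℝ≥0∞) /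
        leafCount (G.learner n) p.1.2 p.1.1 (p.2 k).1 p.1.1) - 1)
      ∂(((Measure.pi fun _ : Fin s => armLaw P ω).prod ρ).prod
        (Measure.pi fun _ : Fin s => armLaw P ω))
  have hinv : ∫⁻ p, ∑ k : Fin s, (leafCount (G.learner n) p.1.2 p.1.1 (p.2 k).1 p.1.1 : ℝ≥0∞)⁻¹
      ∂(((Measure.pi fun _ : Fin s => armLaw P ω).prod ρ).prod
        (Measure.pi fun _ : Fin s => armLaw P ω)) ≤ s * invMinLeafSize P ρ G ω n := by
    have hmk : ∀ k : Fin s, Measurable fun p : ((Fin s → Cov d × ℝ) × Ξ) × (Fin s → Cov d × ℝ) =>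
        (leafCount (G.learner n) p.1.2 p.1.1 (p.2 k).1 p.1.1 : ℝ≥0∞)⁻¹ := fun k =>
      measurable_leafCount_inv _ (by fun_prop) (by fun_prop) (by fun_prop)
    rw [lintegral_finsetSum _ fun k _ => hmk k]
    calc _ ≤ ∑ _k : Fin s, invMinLeafSize P ρ G ω n := by
          refine Finset.sum_le_sum fun k _ => ?_
          rw [lintegral_prod_symm _ (hmk k).aemeasurable]
          calc _ ≤ ∫⁻ _, invMinLeafSize P ρ G ω n ∂(Measure.pi fun _ : Fin s => armLaw P ω) :=
                lintegral_mono fun y => lintegral_leafCount_inv_le P ρ G ω n (y k).1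
            _ = _ := by simp
      _ = _ := by simp
  have hΓ : (s : ℝ≥0∞)⁻¹ * Γ ≤ 2 * ε' := by
    calc (s : ℝ≥0∞)⁻¹ * Γ ≤ (s : ℝ≥0∞)⁻¹ *
          (s * ε' + K * (s * invMinLeafSize P ρ G ω n)) := by
          gcongr
          refine hK'.trans ?_
          gcongr
          rw [ENNReal.ofReal_mul (by positivity), ENNReal.ofReal_natCast, mul_comm]
          simp
      _ = (s : ℝ≥0∞)⁻¹ * s * (ε' + K * invMinLeafSize P ρ G ω n) := by ring
      _ ≤ 1 * (ε' + ε') := by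
          gcongr
          exact ENNReal.inv_mul_le_one _
      _ = _ := by rw [one_mul, two_mul]
  have hR2 : (R : ℝ≥0∞) ^ 2 * (2 * ε') ≤ ε := by
    have : R ^ 2 * (2 * ε') ≤ ε := by
      rw [hε', ← NNReal.coe_le_coe]
      push_cast
      have hpos : (0 : ℝ) < 2 * (R ^ 2 + 1) := by positivity
      rw [mul_div_assoc', mul_div_assoc', div_le_iff₀ hpos]
      nlinarith [ε.2, R.2, mul_nonneg ε.2 (sq_nonneg (R : ℝ))]
    exact_mod_cast this
  calc (s : ℝ≥0∞) * pairMass P ρ G ω n ≤ s * (armMass P ω ^ 2 * ∫⁻ x, ∫⁻ y, ∫⁻ q, r x ^ 2 *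
        leafShare (G.learner n) q.2 q.1 x y ∂treeLaw P ρ s ω ∂(armLaw P ω).fst
        ∂(armLaw P ω).fst) := by
        gcongr
        exact pairMass_le P ρ G hP ω n hrm hr'
    _ = armMass P ω ^ 2 * (s * ∫⁻ x, ∫⁻ y, ∫⁻ q, r x ^ 2 *
        leafShare (G.learner n) q.2 q.1 x y ∂treeLaw P ρ s ω ∂(armLaw P ω).fst
        ∂(armLaw P ω).fst) := by ring
    _ ≤ armMass P ω ^ 2 * (∫⁻ x, r x ^ 2 ∂(armLaw P ω).fst + R ^ 2 * ((s : ℝ≥0∞)⁻¹ * Γ)) := by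
        gcongr
        exact hcard
    _ ≤ armMass P ω ^ 2 * (∫⁻ x, r x ^ 2 ∂(armLaw P ω).fst + R ^ 2 * (2 * ε')) := by gcongr
    _ = armMass P ω * (armMass P ω * ∫⁻ x, r x ^ 2 ∂(armLaw P ω).fst) +
        armMass P ω ^ 2 * (R ^ 2 * (2 * ε')) := by ring
    _ ≤ armMass P ω * ∫⁻ x, armRatio P ω x ^ 2 ∂covSubLaw P ω + 1 ^ 2 * ε := by
        gcongr
        · refine le_of_eq ?_
          rw [covSubLaw_eq_smul P hP, lintegral_smul_measure, smul_eq_mul]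
          congr 1
          refine lintegral_congr_ae ?_
          have hac : (armLaw P ω).fst ≪ P.fst := by
            have h1 := covSubLaw_absolutelyContinuous P ω
            rw [covSubLaw_eq_smul P hP] at h1
            exact (Measure.absolutelyContinuous_smul (armMass_pos P hP ω).ne').trans h1
          filter_upwards [hac hr'] with x hx
          rw [hx]
        · exact armMass_le_one P ω
    _ = _ := by simp

end PairMass

/-! ### Second moments of the column sums -/

section SecondMoment

/-- The diagonal contributes 1/B times the second moment. Off the diagonal the factors are
independent and vanish outside `E`, so Cauchy–Schwarz improves the squared mean by the factor `μ E`;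
it is used in the form 2 a(x) a(y) ≤ a(x)² 1_E(y) + 1_E(x) a(y)². -/
theorem lintegral_mean_sq_le {β : Type*} [MeasurableSpace β] (μ : Measure β)
    [IsProbabilityMeasure μ] {a : β → ℝ≥0∞} (ha : Measurable a) {E : Set β} (hE : MeasurableSet E)
    (h0 : ∀ v, v ∉ E → a v = 0) {B : ℕ} (hB : 0 < B) :
    ∫⁻ u, ((B : ℝ≥0∞)⁻¹ * ∑ b, a (u b)) ^ 2 ∂(Measure.pi fun _ : Fin B => μ) ≤
      ((B : ℝ≥0∞)⁻¹ + μ E) * ∫⁻ v, a v ^ 2 ∂μ := by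
  set I := ∫⁻ v, a v ^ 2 ∂μ with hI
  have hab : ∀ b : Fin B, Measurable fun u : Fin B → β => a (u b) := fun b =>
    ha.comp (measurable_pi_apply b)
  have hpair : ∀ b b' : Fin B, b ≠ b' →
      ∫⁻ u, a (u b) * a (u b') ∂(Measure.pi fun _ : Fin B => μ) ≤ μ E * I := by
    intro b b' h
    have hm : Measurable (Function.uncurry fun x y => a x * a y) :=
      (ha.comp measurable_fst).mul (ha.comp measurable_snd)
    rw [lintegral_pi_pair μ h hm]
    rw [← ENNReal.mul_le_mul_iff_right (a := 2) (by simp) (by simp)]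
    have hi : Measurable (E.indicator (1 : β → ℝ≥0∞)) := measurable_one.indicator hE
    have ha2 : Measurable fun x => a x ^ 2 := ha.pow_const 2
    calc 2 * ∫⁻ x, ∫⁻ y, a x * a y ∂μ ∂μ = ∫⁻ x, ∫⁻ y, 2 * (a x * a y) ∂μ ∂μ := by
          rw [← lintegral_const_mul' _ _ (by simp)]
          refine lintegral_congr fun x => ?_
          rw [← lintegral_const_mul' _ _ (by simp)]
      _ ≤ ∫⁻ x, ∫⁻ y, (a x ^ 2 * E.indicator 1 y + E.indicator 1 x * a y ^ 2) ∂μ ∂μ := by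
          refine lintegral_mono fun x => lintegral_mono fun y => ?_
          by_cases hx : x ∈ E
          · by_cases hy : y ∈ E
            · simpa [hx, hy] using mul_le_half_sq_add (a x) (a y)
            · simp [h0 y hy]
          · simp [h0 x hx]
      _ = ∫⁻ x, (a x ^ 2 * μ E + E.indicator 1 x * I) ∂μ := by
          refine lintegral_congr fun x => ?_
          rw [lintegral_add_left (hi.const_mul _), lintegral_const_mul _ hi,
            lintegral_const_mul _ ha2, lintegral_indicator_one hE]
      _ = 2 * (μ E * I) := by
          rw [lintegral_add_left (ha2.mul_const _), lintegral_mul_const _ ha2,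
            lintegral_mul_const _ hi, lintegral_indicator_one hE, two_mul, mul_comm]
  have hB1 : (B : ℝ≥0∞)⁻¹ * B = 1 :=
    ENNReal.inv_mul_cancel (by exact_mod_cast hB.ne') (ENNReal.natCast_ne_top B)
  calc _ = (B : ℝ≥0∞)⁻¹ ^ 2 * ∑ b, ∑ b', ∫⁻ u, a (u b) * a (u b')
        ∂(Measure.pi fun _ : Fin B => μ) := by
        simp only [mul_pow]
        rw [lintegral_const_mul _ ((Finset.measurable_fun_sum _ fun b _ => hab b).pow_const 2)]
        simp only [sq (∑ b, _), Finset.sum_mul_sum]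
        have hmm : ∀ b b' : Fin B, Measurable fun u : Fin B → β => a (u b) * a (u b') :=
          fun b b' => (hab b).mul (hab b')
        rw [lintegral_finsetSum _ fun b _ => Finset.measurable_fun_sum _ fun b' _ => hmm b b']
        congr 1
        refine Finset.sum_congr rfl fun b _ => ?_
        exact lintegral_finsetSum _ fun b' _ => hmm b b'
    _ ≤ (B : ℝ≥0∞)⁻¹ ^ 2 * ∑ b : Fin B, ∑ b' : Fin B, ((if b = b' then I else 0) + μ E * I) := by
        gcongr with b _ b' _
        split_ifs with h
        · subst h
          refine le_add_right (le_of_eq ?_)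
          simp only [← sq]
          exact (measurePreserving_eval (fun _ : Fin B => μ) b).lintegral_comp (ha.pow_const 2)
        · rw [zero_add]
          exact hpair b b' h
    _ = (B : ℝ≥0∞)⁻¹ * B * (B : ℝ≥0∞)⁻¹ * I +
          ((B : ℝ≥0∞)⁻¹ * B) * ((B : ℝ≥0∞)⁻¹ * B) * (μ E * I) := by
        simp [Finset.sum_add_distrib]
        ring
    _ = _ := by rw [hB1]; ring

theorem card_powersetCard_filter_mem {α : Type*} [DecidableEq α] {J : Finset α} {i : α}
    (hi : i ∈ J) (s : ℕ) :
    ((J.powersetCard s).filter fun I => i ∈ I).card * J.card = s * (J.powersetCard s).card := by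
  cases s with
  | zero => simp
  | succ s =>
    have h1 : (J.powersetCard (s + 1)).filter (fun I => i ∈ I) =
        ((J.erase i).powersetCard s).image (insert i) := by
      conv_lhs => rw [← Finset.insert_erase hi]
      rw [Finset.powersetCard_succ_insert (Finset.notMem_erase i J), Finset.filter_union]
      rw [Finset.filter_false_of_mem, Finset.empty_union, Finset.filter_true_of_mem]
      · intro I hI
        obtain ⟨I', -, rfl⟩ := Finset.mem_image.1 hI
        exact Finset.mem_insert_self _ _
      · intro I hI hmem
        exact Finset.notMem_erase i J ((Finset.mem_powersetCard.1 hI).1 hmem)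
    have h2 : (((J.erase i).powersetCard s).image (insert i)).card =
        ((J.erase i).powersetCard s).card := by
      refine Finset.card_image_of_injOn fun I hI I' hI' h => ?_
      have hn : ∀ I ∈ ((J.erase i).powersetCard s), i ∉ I := fun I hI hmem =>
        Finset.notMem_erase i J ((Finset.mem_powersetCard.1 hI).1 hmem)
      rw [← Finset.erase_insert (hn I hI), ← Finset.erase_insert (hn I' hI')]
      exact congrArg (fun K => K.erase i) h
    rw [h1, h2, Finset.card_powersetCard, Finset.card_powersetCard, Finset.card_erase_of_mem hi]
    obtain ⟨m, hm⟩ : ∃ m, J.card = m + 1 :=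
      ⟨J.card - 1, (Nat.succ_pred_eq_of_pos (Finset.card_pos.2 ⟨i, hi⟩)).symm⟩
    rw [hm, Nat.add_sub_cancel, mul_comm, Nat.add_one_mul_choose_eq, mul_comm]

end SecondMoment

/-! ### Column sums of a single tree -/

section TreeColumn

variable {d : ℕ} {Ξ : Type*} [MeasurableSpace Ξ] {n : ℕ} (T : BaseLearner d Ξ)

/-- The column sum of a single tree. -/
noncomputable def treeCol (z : Fin n → ObsData d) (v : Finset (Fin n) × Ξ) (i : Fin n) : ℝ :=
  ∑ j with (z j).2.1 = !(z i).2.1, treeWeight T z v j i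

theorem treeCol_nonneg (z : Fin n → ObsData d) (v : Finset (Fin n) × Ξ) (i : Fin n) :
    0 ≤ treeCol T z v i := Finset.sum_nonneg fun j _ => treeWeight_nonneg T z v j i

theorem treeCol_eq_zero {z : Fin n → ObsData d} {v : Finset (Fin n) × Ξ} {i : Fin n}
    (h : i ∉ v.1) : treeCol T z v i = 0 :=
  Finset.sum_eq_zero fun j _ => by simp [treeWeight, h]

theorem measurable_treeCol : Measurable
    fun p : (Fin n → ObsData d) × (Finset (Fin n) × Ξ) => fun i => treeCol T p.1 p.2 i := by
  refine measurable_pi_lambda _ fun i => ?_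
  simp only [treeCol, Finset.sum_filter]
  refine Finset.measurable_sum _ fun j _ => Measurable.ite ?_
    (measurable_treeWeight T measurable_fst measurable_snd j i) measurable_const
  exact measurable_fst (measurableSet_arm_eq i j)

theorem measurable_treeCol_right (z : Fin n → ObsData d) (i : Fin n) :
    Measurable fun v : Finset (Fin n) × Ξ => treeCol T z v i :=
  Finset.measurable_sum _ fun j _ => measurable_treeWeight T measurable_const measurable_id j i

theorem colSum_forestWeight {B : ℕ} (z : Fin n → ObsData d) (u : ForestRandomness n B Ξ)
    (i : Fin n) : colSum z (forestWeight T z u) i =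
      (B : ℝ)⁻¹ * ∑ b, treeCol T z (u (b, (z i).2.1)) i := by
  simp only [colSum, forestWeight_eq, treeCol]
  rw [← Finset.mul_sum, Finset.sum_comm]
  congr 1
  refine Finset.sum_congr rfl fun b _ => Finset.sum_congr rfl fun j hj => ?_
  rw [(Finset.mem_filter.1 hj).2, Bool.not_not]

theorem filter_card_eq_leafCount (z : Fin n → ObsData d)
    (v : Finset (Fin n) × Ξ) (x : Cov d) [DecidablePred fun k => (z k).1 ∈ forestLeaf T z v x] :
    (v.1.filter fun k => (z k).1 ∈ forestLeaf T z v x).card =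
      leafCount T v.2 (subsampleData z v.1) x (subsampleData z v.1) := by
  classical
  have h : v.1.filter (fun k => (z k).1 ∈ forestLeaf T z v x) =
      (Finset.univ.filter fun r => (subsampleData z v.1 r).1 ∈
        (T.tree v.1.card v.2 (subsampleData z v.1)).leafAt x).map
        (v.1.orderEmbOfFin rfl).toEmbedding := by
    ext k
    simp only [Finset.mem_filter, Finset.mem_map, Finset.mem_univ, true_and]
    constructor
    · rintro ⟨hk, hx⟩
      obtain ⟨r, rfl⟩ : k ∈ Set.range (v.1.orderEmbOfFin rfl) := by simpa using hk
      exact ⟨r, hx, rfl⟩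
    · rintro ⟨r, hr, rfl⟩
      exact ⟨Finset.orderEmbOfFin_mem _ _ _, hr⟩
  rw [h, Finset.card_map, leafCount]

theorem ofReal_treeWeight (z : Fin n → ObsData d) (v : Finset (Fin n) × Ξ) (i j : Fin n) :
    ENNReal.ofReal (treeWeight T z v i j) =
      if j ∈ v.1 then leafShare T v.2 (subsampleData z v.1) (z i).1 (z j).1 else 0 := by
  classical
  rw [treeWeight, filter_card_eq_leafCount]
  by_cases hj : j ∈ v.1
  · by_cases hx : (z j).1 ∈ forestLeaf T z v (z i).1
    · have hpos : 0 < leafCount T v.2 (subsampleData z v.1) (z i).1 (subsampleData z v.1) := by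
        rw [← filter_card_eq_leafCount]
        exact Finset.card_pos.2 ⟨j, Finset.mem_filter.2 ⟨hj, hx⟩⟩
      rw [forestLeaf_eq] at hx
      rw [if_pos ⟨hj, hx⟩, if_pos hj, leafShare, if_pos hx,
        ENNReal.ofReal_div_of_pos (by exact_mod_cast hpos)]
      simp
    · rw [forestLeaf_eq] at hx
      rw [if_neg fun h => hx h.2, if_pos hj, leafShare, if_neg hx]
      simp
  · simp [hj]

/-- In the expanded square, `j` and `k` both give weight to `i` only if all three lie in one leaf,
and then the weight of `k` is the share of the pair `j`, `k`. The remaining weights of `j` sum to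
one over `i`. -/
theorem sum_sq_treeCol_le {s : ℕ} (hs : 0 < s) {z : Fin n → ObsData d} {v : Finset (Fin n) × Ξ}
    {ω : Bool} (hv : v.1 ∈ subsamples s z ω) :
    ∑ i with (z i).2.1 = ω, ENNReal.ofReal (treeCol T z v i ^ 2) ≤
      ∑ j with (z j).2.1 = !ω, ∑ k with (z k).2.1 = !ω,
        leafShare T v.2 (subsampleData z v.1) (z j).1 (z k).1 := by
  classical
  rcases (arm z ω).eq_empty_or_nonempty with hω | hω
  · rw [show (Finset.univ.filter fun i => (z i).2.1 = ω) = ∅ from hω]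
    simp
  set τ : Fin n → Fin n → ℝ≥0∞ := fun j i => ENNReal.ofReal (treeWeight T z v j i) with hτ
  set Λ : Fin n → Fin n → ℝ≥0∞ := fun j k =>
    leafShare T v.2 (subsampleData z v.1) (z j).1 (z k).1 with hΛ
  have hττ : ∀ i j k, τ j i * τ k i ≤ τ j i * Λ j k := by
    intro i j k
    simp only [hτ, hΛ, ofReal_treeWeight]
    by_cases hi : i ∈ v.1
    · simp only [if_pos hi]
      by_cases hj : (z i).1 ∈ (T.tree v.1.card v.2 (subsampleData z v.1)).leafAt (z j).1
      · by_cases hk : (z i).1 ∈ (T.tree v.1.card v.2 (subsampleData z v.1)).leafAt (z k).1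
        · have hjk : (T.tree v.1.card v.2 (subsampleData z v.1)).leafAt (z k).1 =
              (T.tree v.1.card v.2 (subsampleData z v.1)).leafAt (z j).1 := by
            rw [← leafAt_eq_of_mem _ hj, leafAt_eq_of_mem _ hk]
          have hmem : (z k).1 ∈ (T.tree v.1.card v.2 (subsampleData z v.1)).leafAt (z j).1 :=
            hjk ▸ mem_leafAt_self _ _
          gcongr
          rw [leafShare, leafShare, if_pos hk, if_pos hmem]
          simp only [leafCount, hjk, le_refl]
        · rw [leafShare, leafShare, if_neg hk]
          simp
      · rw [leafShare, if_neg hj]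
        simp
    · simp [hi]
  have hsum : ∀ j, ∑ i with (z i).2.1 = ω, τ j i = 1 := by
    intro j
    rw [hτ, ← ENNReal.ofReal_sum_of_nonneg fun i _ => treeWeight_nonneg T z v j i,
      sum_treeWeight T hs hv hω, ENNReal.ofReal_one]
  have hsq : ∀ i, (z i).2.1 = ω → ENNReal.ofReal (treeCol T z v i ^ 2) =
      ∑ j with (z j).2.1 = !ω, ∑ k with (z k).2.1 = !ω, τ j i * τ k i := by
    intro i hi
    rw [ENNReal.ofReal_pow (treeCol_nonneg T z v i), treeCol, hi,
      ENNReal.ofReal_sum_of_nonneg fun j _ => treeWeight_nonneg T z v j i, sq, Finset.sum_mul_sum]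
  rw [Finset.sum_congr rfl fun i hi => hsq i (Finset.mem_filter.1 hi).2, Finset.sum_comm]
  refine Finset.sum_le_sum fun j _ => ?_
  rw [Finset.sum_comm]
  refine Finset.sum_le_sum fun k _ => ?_
  calc _ ≤ ∑ i with (z i).2.1 = ω, τ j i * Λ j k := Finset.sum_le_sum fun i _ => hττ i j k
    _ = Λ j k := by rw [← Finset.sum_mul, hsum, one_mul]

variable (ρ : Measure Ξ) [IsProbabilityMeasure ρ]

theorem subsampleLaw_mem_le {s : ℕ} {z : Fin n → ObsData d} {ω : Bool} (hs : s ≤ (arm z ω).card)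
    {i : Fin n} (hi : (z i).2.1 = ω) :
    subsampleLaw s ρ z ω {v | i ∈ v.1} ≤ s * ((arm z ω).card : ℝ≥0∞)⁻¹ := by
  classical
  have hmem : MeasurableSet {v : Finset (Fin n) × Ξ | i ∈ v.1} :=
    measurable_fst (MeasurableSet.of_discrete (s := {I : Finset (Fin n) | i ∈ I}))
  have hia : i ∈ arm z ω := by simp [arm, hi]
  have hS : subsamples s z ω = (arm z ω).powersetCard s := by rw [subsamples, min_eq_left hs]
  rw [← lintegral_indicator_one hmem, lintegral_subsampleLaw ρ s z ω
    (measurable_one.indicator hmem), hS]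
  have h1 : ∀ I, ∫⁻ ξ, {v : Finset (Fin n) × Ξ | i ∈ v.1}.indicator 1 (I, ξ) ∂ρ =
      if i ∈ I then (1 : ℝ≥0∞) else 0 := by
    intro I
    by_cases h : i ∈ I <;> simp [h]
  simp only [h1]
  rw [← Finset.sum_filter, Finset.sum_const, nsmul_eq_mul, mul_one]
  have hc := card_powersetCard_filter_mem hia s
  have ha : ((arm z ω).card : ℝ≥0∞) ≠ 0 := by
    exact_mod_cast (Finset.card_pos.2 ⟨i, hia⟩).ne'
  have hc0 : (((arm z ω).powersetCard s).card : ℝ≥0∞) ≠ 0 := by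
    exact_mod_cast (Finset.card_pos.2 (Finset.powersetCard_nonempty.2 hs)).ne'
  rw [← div_eq_mul_inv, ENNReal.le_div_iff_mul_le (Or.inl ha) (Or.inl (by simp)), mul_assoc,
    ← Nat.cast_mul, hc, Nat.cast_mul, mul_comm (s : ℝ≥0∞), ← mul_assoc,
    ENNReal.inv_mul_cancel hc0 (by simp), one_mul]

/-- The column sum averages i.i.d. trees of the arm of unit `i`, and a tree contributes only if its
subsample contains `i`. With `s` possibly small compared to the arm, this is what keeps the second
moment bounded. -/
theorem lintegral_sq_colSum_le {s B : ℕ} (hB : 0 < B) {z : Fin n → ObsData d} {i : Fin n}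
    (hs : s ≤ (arm z (z i).2.1).card) :
    ∫⁻ u, ENNReal.ofReal (colSum z (forestWeight T z u) i ^ 2) ∂forestRandomnessLaw s B ρ z ≤
      ((B : ℝ≥0∞)⁻¹ + s * ((arm z (z i).2.1).card : ℝ≥0∞)⁻¹) *
        ∫⁻ v, ENNReal.ofReal (treeCol T z v i ^ 2) ∂subsampleLaw s ρ z (z i).2.1 := by
  set ω := (z i).2.1 with hω
  set a : Finset (Fin n) × Ξ → ℝ≥0∞ := fun v => ENNReal.ofReal (treeCol T z v i) with ha
  have ham : Measurable a := ENNReal.measurable_ofReal.comp (measurable_treeCol_right T z i)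
  have hmem : MeasurableSet {v : Finset (Fin n) × Ξ | i ∈ v.1} :=
    measurable_fst (MeasurableSet.of_discrete (s := {I : Finset (Fin n) | i ∈ I}))
  have h1 : ∀ u : ForestRandomness n B Ξ,
      ENNReal.ofReal (colSum z (forestWeight T z u) i ^ 2) =
      ((B : ℝ≥0∞)⁻¹ * ∑ b, a (u (b, ω))) ^ 2 := by
    intro u
    have hpos : 0 ≤ ∑ b, treeCol T z (u (b, ω)) i :=
      Finset.sum_nonneg fun b _ => treeCol_nonneg T z _ i
    have hB' : (0 : ℝ) < B := by exact_mod_cast hB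
    rw [colSum_forestWeight, ENNReal.ofReal_pow (by positivity), ENNReal.ofReal_mul (by positivity),
      ENNReal.ofReal_inv_of_pos hB', ENNReal.ofReal_natCast,
      ENNReal.ofReal_sum_of_nonneg fun b _ => treeCol_nonneg T z _ i]
  have hinj : Function.Injective fun b : Fin B => (b, ω) := fun b b' h => (Prod.mk.inj h).1
  have hmap := pi_map_comp_injective (fun q : Fin B × Bool => subsampleLaw s ρ z q.2) hinj
  have hm : Measurable fun u : Fin B → Finset (Fin n) × Ξ =>
      ((B : ℝ≥0∞)⁻¹ * ∑ b, a (u b)) ^ 2 :=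
    ((Finset.measurable_fun_sum _ fun b _ => ham.comp (measurable_pi_apply b)).const_mul _).pow_const
      2
  calc _ = ∫⁻ u, ((B : ℝ≥0∞)⁻¹ * ∑ b, a (u b)) ^ 2
        ∂(Measure.pi fun _ : Fin B => subsampleLaw s ρ z ω) := by
        rw [← hmap, lintegral_map hm (by fun_prop)]
        exact lintegral_congr h1
    _ ≤ ((B : ℝ≥0∞)⁻¹ + subsampleLaw s ρ z ω {v | i ∈ v.1}) *
          ∫⁻ v, a v ^ 2 ∂subsampleLaw s ρ z ω :=
        lintegral_mean_sq_le _ ham hmem (fun v hv => by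
          simp only [ha, treeCol_eq_zero T (z := z) hv, ENNReal.ofReal_zero]) hB
    _ ≤ _ := by
        gcongr
        · exact subsampleLaw_mem_le ρ hs rfl
        · rw [ha, ENNReal.ofReal_pow (treeCol_nonneg T z _ i)]

/-! #### Exchangeability -/

theorem measurable_lintegral_subsampleLaw (s : ℕ) (ω : Bool)
    {f : (Fin n → ObsData d) × (Finset (Fin n) × Ξ) → ℝ≥0∞} (hf : Measurable f) :
    Measurable fun z => ∫⁻ v, f (z, v) ∂subsampleLaw s ρ z ω := by
  classical
  let rep : (Fin n → Bool) → Fin n → ObsData d := fun δ i => (0, δ i, 0)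
  have h : (fun z => ∫⁻ v, f (z, v) ∂subsampleLaw s ρ z ω) = fun z =>
      ∑ δ : Fin n → Bool, if (fun i => (z i).2.1) = δ then
        ∫⁻ v, f (z, v) ∂subsampleLaw s ρ (rep δ) ω else 0 := by
    ext z
    rw [Finset.sum_ite_eq Finset.univ (fun i => (z i).2.1)
      (fun δ => ∫⁻ v, f (z, v) ∂subsampleLaw s ρ (rep δ) ω), if_pos (Finset.mem_univ _)]
    have : subsampleLaw s ρ (rep fun i => (z i).2.1) ω = subsampleLaw s ρ z ω := by
      simp only [subsampleLaw, subsamples, arm, rep]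
    rw [this]
  rw [h]
  refine Finset.measurable_sum _ fun δ _ => Measurable.ite ?_ ?_ measurable_const
  · exact measurableSet_eq_fun (by fun_prop) measurable_const
  · exact hf.lintegral_prod_right'

theorem measurableSet_le_card_arm (s : ℕ) (ω : Bool) :
    MeasurableSet {z : Fin n → ObsData d | s ≤ (arm z ω).card} := by
  have : Measurable fun z : Fin n → ObsData d => (arm z ω).card := by
    simp only [arm, Finset.card_filter]
    exact Finset.measurable_fun_sum _ fun i _ => Measurable.ite
      (measurableSet_eq_fun (by fun_prop) measurable_const) measurable_const measurable_const
  exact measurableSet_le measurable_const this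

theorem lintegral_treeCol_comp_perm (s : ℕ) (ω : Bool) (z : Fin n → ObsData d)
    (π : Equiv.Perm (Fin n)) (i : Fin n) :
    ∫⁻ v, ENNReal.ofReal (treeCol T (z ∘ π) v i ^ 2) ∂subsampleLaw s ρ (z ∘ π) ω =
      ∫⁻ v, ENNReal.ofReal (treeCol T z v (π i) ^ 2) ∂subsampleLaw s ρ z ω := by
  have h : Measurable (Prod.map (β₁ := Ξ) π.finsetCongr id) :=
    (Measurable.of_discrete (f := π.finsetCongr)).prodMap measurable_id
  have hm : Measurable fun v : Finset (Fin n) × Ξ =>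
      ENNReal.ofReal (treeCol T z v (π i) ^ 2) :=
    ENNReal.measurable_ofReal.comp ((measurable_treeCol_right T z (π i)).pow_const 2)
  rw [← subsampleLaw_relabel ρ s z π ω, lintegral_map hm h]
  refine lintegral_congr fun v => ?_
  congr 2
  simp only [treeCol, Function.comp_apply]
  refine Finset.sum_bij (fun j _ => π j) (fun j hj => ?_) (fun _ _ _ _ h => π.injective h)
    (fun j hj => ⟨π.symm j, ?_, π.apply_symm_apply j⟩) fun j _ => ?_
  · simpa using hj
  · simpa using hj
  · exact (treeWeight_comp_perm T z π v.1 v.2 j i).symm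

variable (P : Measure (FullData d)) [IsProbabilityMeasure P]

theorem lintegral_sq_treeCol_exchange (s : ℕ) (ω : Bool) (i i' : Fin n) :
    ∫⁻ z, (if (z i).2.1 = ω ∧ s ≤ (arm z ω).card then
      ∫⁻ v, ENNReal.ofReal (treeCol T z v i ^ 2) ∂subsampleLaw s ρ z ω else 0) ∂sampleLaw P n =
    ∫⁻ z, (if (z i').2.1 = ω ∧ s ≤ (arm z ω).card then
      ∫⁻ v, ENNReal.ofReal (treeCol T z v i' ^ 2) ∂subsampleLaw s ρ z ω else 0)
        ∂sampleLaw P n := by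
  rw [← lintegral_pi_comp_perm (obsLaw P) (Equiv.swap i i')]
  refine lintegral_congr fun z => ?_
  have hc : (arm (z ∘ Equiv.swap i i') ω).card = (arm z ω).card := by
    rw [← arm_comp_perm z (Equiv.swap i i') ω, Finset.card_map]
  rw [lintegral_treeCol_comp_perm, hc]
  simp

end TreeColumn

/-! ### Second moments through pairs of units -/

section ColumnMoment

variable {d : ℕ} {Ξ : Type*} [MeasurableSpace Ξ] (ρ : Measure Ξ) [IsProbabilityMeasure ρ]
  (P : Measure (FullData d)) [IsProbabilityMeasure P] (G : ForestDesign d Ξ)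

theorem lintegral_leafShare_subsample_le (hP : BasicAssumption P) (ω : Bool) (n : ℕ+)
    {j k : Fin n} (hjk : j ≠ k) :
    ∫⁻ z, (if ((z j).2.1 = !ω ∧ (z k).2.1 = !ω) ∧ (G.s n : ℕ) ≤ (arm z ω).card then
      ∫⁻ v, leafShare (G.learner n) v.2 (subsampleData z v.1) (z j).1 (z k).1
        ∂subsampleLaw (G.s n) ρ z ω else 0) ∂sampleLaw P n ≤ pairMass P ρ G ω n := by
  have he : Function.Injective ![j, k] := by
    intro a b h
    fin_cases a <;> fin_cases b <;> simp_all
  refine le_of_eq_of_le ?_ (lintegral_subsample_le P ρ hP (G.s n) ω he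
    (Φ := fun m x a ξ => leafShare (G.learner n) ξ a (x 0) (x 1)) fun m =>
      measurable_leafShare _ (by fun_prop) (by fun_prop) (by fun_prop) (by fun_prop))
  refine lintegral_congr fun z => ?_
  simp [Fin.forall_fin_two]

theorem lintegral_leafShare_self_subsample_le (hP : BasicAssumption P) (ω : Bool) (n : ℕ+)
    (j : Fin n) :
    ∫⁻ z, (if (z j).2.1 = !ω ∧ (G.s n : ℕ) ≤ (arm z ω).card then
      ∫⁻ v, leafShare (G.learner n) v.2 (subsampleData z v.1) (z j).1 (z j).1
        ∂subsampleLaw (G.s n) ρ z ω else 0) ∂sampleLaw P n ≤ invMinLeafSize P ρ G ω n := by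
  have he : Function.Injective fun _ : Fin 1 => j := Function.injective_of_subsingleton _
  have h := lintegral_subsample_le P ρ hP (G.s n) ω he
    (Φ := fun m x a ξ => leafShare (G.learner n) ξ a (x 0) (x 0)) fun m =>
      measurable_leafShare _ (by fun_prop) (by fun_prop) (by fun_prop) (by fun_prop)
  calc _ ≤ _ := by simpa using h
    _ ≤ ∫⁻ _, invMinLeafSize P ρ G ω n ∂(Measure.pi fun _ : Fin 1 => covSubLaw P (!ω)) := by
        refine lintegral_mono fun x => ?_
        refine le_trans (lintegral_mono fun q => ?_)
          (lintegral_leafCount_inv_le P ρ G ω n (x 0))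
        exact leafShare_le _ _ _ _ _
    _ ≤ _ := by
        rw [lintegral_const, Measure.pi_univ]
        simp only [covSubLaw_univ, Finset.prod_const]
        exact mul_le_of_le_one_right' (pow_le_one₀ zero_le (armMass_le_one P _))

/-- By exchangeability, n times the left side is the sum over all units, which `sum_sq_treeCol_le`
bounds by a sum over pairs. The n diagonal pairs give the inverse leaf size, the others `pairMass`.
-/
theorem lintegral_sq_treeCol_le (hP : BasicAssumption P) (ω : Bool) (n : ℕ+) (i : Fin n) :
    ∫⁻ z, (if (z i).2.1 = ω ∧ (G.s n : ℕ) ≤ (arm z ω).card then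
      ∫⁻ v, ENNReal.ofReal (treeCol (G.learner n) z v i ^ 2) ∂subsampleLaw (G.s n) ρ z ω else 0)
        ∂sampleLaw P n ≤ invMinLeafSize P ρ G ω n + ((n : ℕ) : ℝ≥0∞) * pairMass P ρ G ω n := by
  set T := G.learner n
  set s : ℕ := (G.s n : ℕ) with hs
  have hn0 : ((n : ℕ) : ℝ≥0∞) ≠ 0 := by exact_mod_cast n.pos.ne'
  have hnt : ((n : ℕ) : ℝ≥0∞) ≠ ∞ := ENNReal.natCast_ne_top _
  rw [← ENNReal.mul_le_mul_iff_right hn0 hnt]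
  have hmA : ∀ i : Fin n, MeasurableSet
      {z : Fin n → ObsData d | (z i).2.1 = ω ∧ s ≤ (arm z ω).card} := fun i =>
    (measurableSet_eq_fun (by fun_prop) measurable_const).inter (measurableSet_le_card_arm s ω)
  have hm1 : ∀ i : Fin n, Measurable fun z : Fin n → ObsData d =>
      if (z i).2.1 = ω ∧ s ≤ (arm z ω).card then
      ∫⁻ v, ENNReal.ofReal (treeCol T z v i ^ 2) ∂subsampleLaw s ρ z ω else 0 := by
    intro i
    refine Measurable.ite (hmA i) ?_ measurable_const
    refine measurable_lintegral_subsampleLaw ρ s ω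
      (f := fun p => ENNReal.ofReal (treeCol T p.1 p.2 i ^ 2)) ?_
    exact ENNReal.measurable_ofReal.comp
      (((measurable_pi_apply i).comp (measurable_treeCol T)).pow_const 2)
  have hmL : ∀ j k : Fin n, Measurable fun p : (Fin n → ObsData d) × (Finset (Fin n) × Ξ) =>
      leafShare T p.2.2 (subsampleData p.1 p.2.1) (p.1 j).1 (p.1 k).1 := by
    intro j k
    have h : Measurable fun p : Finset (Fin n) × ((Fin n → ObsData d) × Ξ) =>
        leafShare T p.2.2 (subsampleData p.2.1 p.1) (p.2.1 j).1 (p.2.1 k).1 := by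
      refine measurable_from_prod_countable_right fun I => ?_
      exact measurable_leafShare T (by fun_prop)
        ((measurable_subsampleData I).comp measurable_fst) (by fun_prop) (by fun_prop)
    exact h.comp (g := fun p : Finset (Fin n) × ((Fin n → ObsData d) × Ξ) =>
        leafShare T p.2.2 (subsampleData p.2.1 p.1) (p.2.1 j).1 (p.2.1 k).1)
      (f := fun p : (Fin n → ObsData d) × (Finset (Fin n) × Ξ) => (p.2.1, p.1, p.2.2))
      (by fun_prop)
  set Λ : Fin n → Fin n → (Fin n → ObsData d) → ℝ≥0∞ := fun j k z =>
    if ((z j).2.1 = !ω ∧ (z k).2.1 = !ω) ∧ s ≤ (arm z ω).card then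
      ∫⁻ v, leafShare T v.2 (subsampleData z v.1) (z j).1 (z k).1 ∂subsampleLaw s ρ z ω else 0
    with hΛ
  have hmΛ : ∀ j k, Measurable (Λ j k) := by
    intro j k
    refine Measurable.ite ?_ (measurable_lintegral_subsampleLaw ρ s ω (hmL j k)) measurable_const
    exact ((measurableSet_eq_fun (by fun_prop) measurable_const).inter
      (measurableSet_eq_fun (by fun_prop) measurable_const)).inter (measurableSet_le_card_arm s ω)
  calc _ = ∑ i' : Fin n, ∫⁻ z, (if (z i').2.1 = ω ∧ s ≤ (arm z ω).card then
      ∫⁻ v, ENNReal.ofReal (treeCol T z v i' ^ 2) ∂subsampleLaw s ρ z ω else 0)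
        ∂sampleLaw P n := by
        rw [Finset.sum_congr rfl fun i' _ => lintegral_sq_treeCol_exchange T ρ P s ω i' i]
        simp
    _ = ∫⁻ z, ∑ i' : Fin n, (if (z i').2.1 = ω ∧ s ≤ (arm z ω).card then
      ∫⁻ v, ENNReal.ofReal (treeCol T z v i' ^ 2) ∂subsampleLaw s ρ z ω else 0)
        ∂sampleLaw P n := (lintegral_finsetSum _ fun i' _ => hm1 i').symm
    _ ≤ ∫⁻ z, ∑ j, ∑ k, Λ j k z ∂sampleLaw P n := by
        refine lintegral_mono fun z => ?_
        by_cases hc : s ≤ (arm z ω).card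
        · simp only [hc, and_true, hΛ]
          have hmt : ∀ i', Measurable fun v : Finset (Fin n) × Ξ =>
              ENNReal.ofReal (treeCol T z v i' ^ 2) := fun i' =>
            ENNReal.measurable_ofReal.comp ((measurable_treeCol_right T z i').pow_const 2)
          rw [← Finset.sum_filter, ← lintegral_finsetSum _ fun i' _ => hmt i']
          refine (lintegral_mono_ae ((ae_subsampleLaw ρ s z ω).mono fun v hv =>
            sum_sq_treeCol_le T (G.s n).pos hv)).trans (le_of_eq ?_)
          have hmv : ∀ j k, Measurable fun v : Finset (Fin n) × Ξ =>
              leafShare T v.2 (subsampleData z v.1) (z j).1 (z k).1 := fun j k =>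
            (hmL j k).comp measurable_prodMk_left
          rw [lintegral_finsetSum _ fun j _ => Finset.measurable_fun_sum _ fun k _ => hmv j k,
            Finset.sum_filter]
          refine Finset.sum_congr rfl fun j _ => ?_
          by_cases hj : (z j).2.1 = !ω
          · simp only [hj, true_and, if_true]
            rw [lintegral_finsetSum _ fun k _ => hmv j k, Finset.sum_filter]
          · simp [hj]
        · simp [hc]
    _ = ∑ j, ∑ k, ∫⁻ z, Λ j k z ∂sampleLaw P n := by
        rw [lintegral_finsetSum _ fun j _ => Finset.measurable_fun_sum _ fun k _ => hmΛ j k]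
        exact Finset.sum_congr rfl fun j _ => lintegral_finsetSum _ fun k _ => hmΛ j k
    _ ≤ ∑ j : Fin n, ∑ k : Fin n,
          ((if j = k then invMinLeafSize P ρ G ω n else 0) + pairMass P ρ G ω n) := by
        refine Finset.sum_le_sum fun j _ => Finset.sum_le_sum fun k _ => ?_
        split_ifs with h
        · subst h
          refine le_add_right (le_of_eq_of_le ?_
            (lintegral_leafShare_self_subsample_le ρ P G hP ω n j))
          simp only [hΛ, and_self]
          rfl
        · rw [zero_add]
          exact lintegral_leafShare_subsample_le ρ P G hP ω n h
    _ = _ := by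
        simp [Finset.sum_add_distrib]
        ring

/-- Each weight is at most the row sum that contains it. This crude bound is used on the rare event
that an arm is small. -/
theorem colSum_le {n : ℕ} (z : Fin n → ObsData d) {W : Fin n → Fin n → ℝ}
    (hW : ∀ i j, 0 ≤ W i j) (h1 : ∀ i, (∃ j, (z j).2.1 = !(z i).2.1) → rowSum z W i = 1)
    (i : Fin n) : colSum z W i ≤ n := by
  calc colSum z W i ≤ ∑ j with (z j).2.1 = !(z i).2.1, (1 : ℝ) := by
        refine Finset.sum_le_sum fun j hj => ?_
        have hji : (z i).2.1 = !(z j).2.1 := by rw [(Finset.mem_filter.1 hj).2, Bool.not_not]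
        rw [← h1 j ⟨i, hji⟩]
        exact Finset.single_le_sum (f := fun k => W j k) (fun k _ => hW j k)
          (Finset.mem_filter.2 ⟨Finset.mem_univ i, hji⟩)
    _ ≤ n := by
        rw [Finset.sum_const, nsmul_eq_mul, mul_one]
        exact_mod_cast (Finset.card_le_univ _).trans (by simp)

theorem measurable_colSum {n : ℕ} (z : Fin n → ObsData d) (i : Fin n) :
    Measurable fun W : Fin n → Fin n → ℝ => colSum z W i :=
  Finset.measurable_sum _ fun j _ => (measurable_pi_apply i).comp (measurable_pi_apply j)

/-- Bound on the second moment of the column sums. -/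
theorem expect_sq_colSum_le (hP : BasicAssumption P) (n : ℕ+) {m : Bool → ℝ}
    (hm : ∀ ω, (G.s n : ℕ) ≤ m ω) :
    expect P (forestMatrix G ρ) n (fun z W => ENNReal.ofReal (colSum z W 0 ^ 2)) ≤
      ∑ ω : Bool, ((((G.B n : ℕ) : ℝ≥0∞)⁻¹ + ((G.s n : ℕ) : ℝ≥0∞) * (ENNReal.ofReal (m ω))⁻¹) *
        (invMinLeafSize P ρ G ω n + ((n : ℕ) : ℝ≥0∞) * pairMass P ρ G ω n) +
        ((n : ℕ) : ℝ≥0∞) ^ 2 * sampleLaw P n {z | ((arm z ω).card : ℝ) ≤ m ω}) := by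
  set T := G.learner n
  set s : ℕ := (G.s n : ℕ) with hs
  set B : ℕ := (G.B n : ℕ) with hB
  set c : Bool → ℝ≥0∞ := fun ω => (B : ℝ≥0∞)⁻¹ + (s : ℝ≥0∞) * (ENNReal.ofReal (m ω))⁻¹ with hc
  set e : Bool → (Fin n → ObsData d) → ℝ≥0∞ := fun ω z =>
    if (z 0).2.1 = ω ∧ s ≤ (arm z ω).card then
      ∫⁻ v, ENNReal.ofReal (treeCol T z v 0 ^ 2) ∂subsampleLaw s ρ z ω else 0 with he
  have hem : ∀ ω, Measurable (e ω) := by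
    intro ω
    refine Measurable.ite ?_ ?_ measurable_const
    · exact (measurableSet_eq_fun (by fun_prop) measurable_const).inter
        (measurableSet_le_card_arm s ω)
    refine measurable_lintegral_subsampleLaw ρ s ω
      (f := fun p => ENNReal.ofReal (treeCol T p.1 p.2 0 ^ 2)) ?_
    exact ENNReal.measurable_ofReal.comp
      (((measurable_pi_apply 0).comp (measurable_treeCol T)).pow_const 2)
  set bad : Bool → Set (Fin n → ObsData d) := fun ω => {z | ((arm z ω).card : ℝ) ≤ m ω} with hbad
  have hbm : ∀ ω, MeasurableSet (bad ω) := by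
    intro ω
    have h : Measurable fun z : Fin n → ObsData d => ((arm z ω).card : ℝ) := by
      simp only [arm, Finset.card_filter, Nat.cast_sum]
      refine Finset.measurable_fun_sum _ fun i _ => ?_
      exact (Measurable.of_discrete (f := fun k : ℕ => (k : ℝ))).comp (Measurable.ite
        (measurableSet_eq_fun (by fun_prop) measurable_const) measurable_const measurable_const)
    exact measurableSet_le h measurable_const
  have hpt : ∀ z, ∫⁻ W, ENNReal.ofReal (colSum z W 0 ^ 2) ∂forestMatrix G ρ n z ≤
      ∑ ω, (c ω * e ω z + (bad ω).indicator (fun _ => ((n : ℕ) : ℝ≥0∞) ^ 2) z) := by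
    intro z
    set ω := (z 0).2.1 with hω
    refine le_trans ?_ (Finset.single_le_sum (f := fun ω => c ω * e ω z +
      (bad ω).indicator (fun _ => ((n : ℕ) : ℝ≥0∞) ^ 2) z) (fun _ _ => zero_le)
      (Finset.mem_univ ω))
    by_cases hz : z ∈ bad ω
    · refine le_add_left ?_
      rw [Set.indicator_of_mem hz]
      calc _ ≤ ∫⁻ _, ((n : ℕ) : ℝ≥0∞) ^ 2 ∂forestMatrix G ρ n z := by
            refine lintegral_mono_ae ?_
            filter_upwards [ae_forestMatrix_nonneg ρ G n z] with W hW
            have h0 : 0 ≤ colSum z W 0 := Finset.sum_nonneg fun j _ => hW.1 j 0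
            rw [ENNReal.ofReal_pow h0]
            gcongr
            rw [← ENNReal.ofReal_natCast]
            exact ENNReal.ofReal_le_ofReal (colSum_le z hW.1 hW.2 0)
        _ = _ := by simp
    · refine le_add_right ?_
      have hlt : m ω < ((arm z ω).card : ℝ) := not_le.1 hz
      have hsc : s ≤ (arm z ω).card := by
        have : (s : ℝ) ≤ (arm z ω).card := (hm ω).trans hlt.le
        exact_mod_cast this
      have hmz : Measurable fun W : Fin n → Fin n → ℝ => ENNReal.ofReal (colSum z W 0 ^ 2) :=
        ENNReal.measurable_ofReal.comp ((measurable_colSum z 0).pow_const 2)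
      rw [lintegral_forestMatrix ρ G n z hmz]
      refine (lintegral_sq_colSum_le T ρ (G.B n).pos hsc).trans ?_
      have hez : e ω z = ∫⁻ v, ENNReal.ofReal (treeCol T z v 0 ^ 2) ∂subsampleLaw s ρ z ω :=
        if_pos ⟨rfl, hsc⟩
      have hinv : (((arm z ω).card : ℕ) : ℝ≥0∞)⁻¹ ≤ (ENNReal.ofReal (m ω))⁻¹ := by
        rw [ENNReal.inv_le_inv, ← ENNReal.ofReal_natCast]
        exact ENNReal.ofReal_le_ofReal hlt.le
      rw [hez]
      simp only [hc]
      gcongr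
  calc _ ≤ ∫⁻ z, ∑ ω, (c ω * e ω z + (bad ω).indicator (fun _ => ((n : ℕ) : ℝ≥0∞) ^ 2) z)
        ∂sampleLaw P n := lintegral_mono hpt
    _ = ∑ ω, (c ω * ∫⁻ z, e ω z ∂sampleLaw P n +
          ((n : ℕ) : ℝ≥0∞) ^ 2 * sampleLaw P n (bad ω)) := by
        have hms : ∀ ω, Measurable fun z => c ω * e ω z +
            (bad ω).indicator (fun _ => ((n : ℕ) : ℝ≥0∞) ^ 2) z := fun ω =>
          ((hem ω).const_mul _).add (measurable_const.indicator (hbm ω))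
        rw [lintegral_finsetSum _ fun ω _ => hms ω]
        refine Finset.sum_congr rfl fun ω _ => ?_
        rw [lintegral_add_left ((hem ω).const_mul _), lintegral_const_mul _ (hem ω),
          lintegral_indicator_const (hbm ω)]
    _ ≤ _ := by
        gcongr with ω _
        exact lintegral_sq_treeCol_le ρ P G hP ω n 0

end ColumnMoment

/-! ### Powers of n against exponentials -/

section Limits

theorem tendsto_pnat_cast : Tendsto (fun n : ℕ+ => ((n : ℕ) : ℝ)) atTop atTop :=
  tendsto_natCast_atTop_atTop.comp tendsto_PNat_val_atTop_atTop

theorem tendsto_rpow_mul_exp (r : ℝ) {c : ℝ} (hc : 0 < c) :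
    Tendsto (fun n : ℕ+ => ENNReal.ofReal (((n : ℕ) : ℝ) ^ r) *
      ENNReal.ofReal (Real.exp (-c * ((n : ℕ) : ℝ)))) atTop (𝓝 0) := by
  have h := ENNReal.tendsto_ofReal
    ((tendsto_rpow_mul_exp_neg_mul_atTop_nhds_zero r c hc).comp tendsto_pnat_cast)
  rw [ENNReal.ofReal_zero] at h
  refine h.congr fun n => ?_
  rw [Function.comp_apply, ENNReal.ofReal_mul (by positivity)]

end Limits

/-! ### Asymptotic upper bound for the second moment of the column sums -/

section ColumnLimit

variable {d : ℕ} {Ξ : Type*} [MeasurableSpace Ξ] (ρ : Measure Ξ) [IsProbabilityMeasure ρ]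
  (P : Measure (FullData d)) [IsProbabilityMeasure P] (G : ForestDesign d Ξ)

theorem eventually_subsample_le (hG : ForestDRAssumption P ρ G) {c : ℝ} (hc : 0 < c) :
    ∀ᶠ n : ℕ+ in atTop, ((G.s n : ℕ) : ℝ) ≤ c * ((n : ℕ) : ℝ) := by
  obtain ⟨C, hC⟩ := hG.subsample.bound
  have hsq : Tendsto (fun n : ℕ+ => √((n : ℕ) : ℝ)) atTop atTop :=
    Real.tendsto_sqrt_atTop.comp tendsto_pnat_cast
  filter_upwards [hC, hsq.eventually_ge_atTop (C / c)] with n hn hn'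
  rw [Real.norm_of_nonneg (by positivity), Real.norm_of_nonneg (by positivity)] at hn
  rw [div_le_iff₀ hc] at hn'
  calc ((G.s n : ℕ) : ℝ) ≤ C * √((n : ℕ) : ℝ) := hn
    _ ≤ √((n : ℕ) : ℝ) * c * √((n : ℕ) : ℝ) := by gcongr
    _ = c * (√((n : ℕ) : ℝ) * √((n : ℕ) : ℝ)) := by ring
    _ = _ := by rw [Real.mul_self_sqrt (by positivity)]

theorem eventually_div_trees_le (hG : ForestDRAssumption P ρ G) : ∃ C : ℝ≥0,
    ∀ᶠ n : ℕ+ in atTop, ((n : ℕ) : ℝ≥0∞) * ((G.B n : ℕ) : ℝ≥0∞)⁻¹ ≤ C := by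
  obtain ⟨C, hC⟩ := hG.trees.bound
  refine ⟨C.toNNReal, ?_⟩
  filter_upwards [hC] with n hn
  have hB : (0 : ℝ) < ((G.B n : ℕ) : ℝ) := by exact_mod_cast (G.B n).pos
  rw [Real.norm_of_nonneg (by positivity), norm_one, mul_one] at hn
  rw [← ENNReal.ofReal_natCast (n : ℕ), ← ENNReal.ofReal_natCast (G.B n : ℕ),
    ← ENNReal.ofReal_inv_of_pos hB, ← ENNReal.ofReal_mul (by positivity), ← div_eq_mul_inv]
  exact ENNReal.ofReal_le_ofReal hn

theorem lintegral_sq_armRatio_ne_top (hP : BasicAssumption P) (ω : Bool) :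
    ∫⁻ x, armRatio P ω x ^ 2 ∂covSubLaw P ω ≠ ∞ := by
  obtain ⟨R, hR⟩ := exists_armRatio_le P hP
  have h : ∫⁻ x, armRatio P ω x ^ 2 ∂covSubLaw P ω ≤ ∫⁻ _, (R : ℝ≥0∞) ^ 2 ∂covSubLaw P ω := by
    refine lintegral_mono_ae ?_
    filter_upwards [covSubLaw_absolutelyContinuous P ω (hR ω)] with x hx
    gcongr
  refine ne_top_of_le_ne_top ?_ h
  rw [lintegral_const]
  exact ENNReal.mul_ne_top (by simp) (measure_ne_top _ _)

/-- With arms of size at least qn, q slightly below the arm probability p, the main term (s / (qn))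
n `pairMass` is s `pairMass` / q, and s `pairMass` is at most pV + t, `V` being here the
contribution of one arm. The term of the number of trees is (n/B)(1/s)(s `pairMass`), negligible
because n/B is bounded and s tends to infinity. Small arms are exponentially rare, which beats the
crude n². -/
theorem eventually_expect_sq_colSum_le (hd : 0 < d) (hP : BasicAssumption P)
    (hG : ForestDRAssumption P ρ G) {ε : ℝ≥0} (hε : 0 < ε) :
    ∀ᶠ n : ℕ+ in atTop,
      expect P (forestMatrix G ρ) n (fun z W => ENNReal.ofReal (colSum z W 0 ^ 2)) ≤
        ∑ ω : Bool, ∫⁻ x, armRatio P ω x ^ 2 ∂covSubLaw P ω + ε := by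
  set p : Bool → ℝ≥0 := fun ω => (armMass P ω).toNNReal with hp
  have hpc : ∀ ω, (p ω : ℝ≥0∞) = armMass P ω := fun ω =>
    ENNReal.coe_toNNReal (armMass_ne_top P ω)
  have hp0 : ∀ ω, 0 < p ω := fun ω =>
    ENNReal.toNNReal_pos (armMass_pos P hP ω).ne' (armMass_ne_top P ω)
  set V : Bool → ℝ≥0 := fun ω => (∫⁻ x, armRatio P ω x ^ 2 ∂covSubLaw P ω).toNNReal with hV
  have hVc : ∀ ω, (V ω : ℝ≥0∞) = ∫⁻ x, armRatio P ω x ^ 2 ∂covSubLaw P ω := fun ω =>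
    ENNReal.coe_toNNReal (lintegral_sq_armRatio_ne_top P hP ω)
  -- One tolerance `t` serves for all errors. At `t = 0` the bound equals the target sum without
  -- `ε`, and it is continuous there.
  obtain ⟨t, ht, hft⟩ : ∃ t : ℝ≥0, 0 < t ∧ ∑ ω, (2 * t + (t + (p ω / (1 + t))⁻¹) *
      (p ω * V ω + t) + t) ≤ ∑ ω, V ω + ε := by
    have hcont : ContinuousAt (fun t : ℝ≥0 => ∑ ω, (2 * t + (t + (p ω / (1 + t))⁻¹) *
        (p ω * V ω + t) + t)) 0 := by
      have h1 : ∀ ω, ContinuousAt (fun t : ℝ≥0 => (p ω / (1 + t))⁻¹) 0 := by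
        intro ω
        have h2 : ContinuousAt (fun t : ℝ≥0 => p ω / (1 + t)) 0 :=
          ContinuousAt.div₀ (by fun_prop) (by fun_prop) (by simp)
        exact h2.inv₀ (by simpa using (hp0 ω).ne')
      refine tendsto_finsetSum _ fun ω _ => ?_
      have := h1 ω
      exact ContinuousAt.tendsto (by fun_prop)
    have h0 : ∑ ω, (2 * (0 : ℝ≥0) + (0 + (p ω / (1 + 0))⁻¹) * (p ω * V ω + 0) + 0) < ∑ ω, V ω + ε := by
      refine lt_of_le_of_lt (le_of_eq (Finset.sum_congr rfl fun ω _ => ?_)) (lt_add_of_pos_right _ hε)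
      have := (hp0 ω).ne'
      field_simp
      ring
    have hev := (hcont.eventually (gt_mem_nhds h0)).filter_mono
      (nhdsWithin_le_nhds (s := Set.Ioi 0))
    obtain ⟨t, h1, h2⟩ := (hev.and self_mem_nhdsWithin).exists
    exact ⟨t, h2, h1.le⟩
  set q : Bool → ℝ≥0 := fun ω => p ω / (1 + t) with hq
  have hq0 : ∀ ω, 0 < q ω := fun ω => div_pos (hp0 ω) (by positivity)
  have hqp : ∀ ω, 0 < (p ω : ℝ) - q ω := by
    intro ω
    rw [sub_pos, NNReal.coe_lt_coe]
    exact div_lt_self (hp0 ω) (lt_add_of_pos_right _ ht)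
  obtain ⟨C, hC⟩ := eventually_div_trees_le ρ P G hG
  have hbad : ∀ ω, ∀ᶠ n : ℕ+ in atTop, ((n : ℕ) : ℝ≥0∞) ^ 2 *
      sampleLaw P n {z | ((arm z ω).card : ℝ) ≤ q ω * ((n : ℕ) : ℝ)} ≤ t := by
    intro ω
    have hc : 0 < 2 * ((p ω : ℝ) - q ω) ^ 2 := by have := hqp ω; positivity
    filter_upwards [(tendsto_rpow_mul_exp 2 hc).eventually
      (gt_mem_nhds (show (0 : ℝ≥0∞) < t by exact_mod_cast ht))] with n hn
    refine le_trans ?_ hn.le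
    gcongr
    · rw [Real.rpow_two, ENNReal.ofReal_pow (by positivity), ENNReal.ofReal_natCast]
    · have h := sampleLaw_card_arm_le P ω (hqp ω).le n
      have h2 : (armMass P ω).toReal = p ω := rfl
      rwa [h2, sub_sub_cancel] at h
  have hinv : ∀ ω (c : ℝ≥0), ∀ᶠ n : ℕ+ in atTop, c * invMinLeafSize P ρ G ω n ≤ t := by
    intro ω c
    have h := ENNReal.Tendsto.const_mul (hG.leafSize ω) (Or.inr (ENNReal.coe_ne_top (r := c)))
    rw [mul_zero] at h
    filter_upwards [h.eventually (gt_mem_nhds (show (0 : ℝ≥0∞) < t by exact_mod_cast ht))] with n hn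
    exact hn.le
  filter_upwards [hC, eventually_all.2 hbad, eventually_all.2 fun ω => hinv ω 2,
    eventually_all.2 fun ω => hinv ω C,
    eventually_all.2 fun ω => eventually_pairMass_le P ρ G hd hP (hG.leafSize ω) ht,
    eventually_all.2 fun ω => eventually_subsample_le ρ P G hG (c := q ω) (by exact_mod_cast hq0 ω)]
    with n hCn hbn hin hiCn hpn hsn
  refine (expect_sq_colSum_le ρ P G hP n hsn).trans ?_
  have hfin : ((∑ ω, (2 * t + (t + (q ω)⁻¹) * (p ω * V ω + t) + t) : ℝ≥0) : ℝ≥0∞) ≤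
      ∑ ω, ∫⁻ x, armRatio P ω x ^ 2 ∂covSubLaw P ω + ε := by
    simp only [← hVc]
    exact_mod_cast hft
  refine le_trans ?_ hfin
  push_cast
  refine Finset.sum_le_sum fun ω _ => ?_
  refine add_le_add ?_ (hbn ω)
  set s : ℕ := (G.s n : ℕ)
  set B : ℕ := (G.B n : ℕ)
  set N : ℕ := (n : ℕ)
  have hs0 : (s : ℝ≥0∞) ≠ 0 := by exact_mod_cast (G.s n).pos.ne'
  have hst : (s : ℝ≥0∞) ≠ ∞ := ENNReal.natCast_ne_top s
  have hN0 : (N : ℝ≥0∞) ≠ 0 := by exact_mod_cast n.pos.ne'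
  have hNt : (N : ℝ≥0∞) ≠ ∞ := ENNReal.natCast_ne_top N
  have hq1 : (q ω : ℝ≥0∞) ≠ 0 := by exact_mod_cast (hq0 ω).ne'
  have hm : ENNReal.ofReal (q ω * (N : ℝ)) = q ω * N := by
    rw [ENNReal.ofReal_mul (by positivity), ENNReal.ofReal_natCast, ENNReal.ofReal_coe_nnreal]
  have hsm : (s : ℝ≥0∞) * (q ω * N : ℝ≥0∞)⁻¹ ≤ 1 := by
    rw [← div_eq_mul_inv]
    refine ENNReal.div_le_of_le_mul ?_
    rw [one_mul, ← hm, ← ENNReal.ofReal_natCast]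
    exact ENNReal.ofReal_le_ofReal (hsn ω)
  have hB1 : (B : ℝ≥0∞)⁻¹ ≤ 1 := by
    rw [ENNReal.inv_le_one]
    exact_mod_cast (G.B n).pos
  rw [hm, mul_add]
  refine add_le_add ?_ ?_
  · calc _ ≤ (1 + 1) * invMinLeafSize P ρ G ω n := by gcongr
      _ ≤ t := by
        have := hin ω
        rw [one_add_one_eq_two]
        exact_mod_cast this
      _ ≤ 2 * t := le_mul_of_one_le_left zero_le (by norm_num)
  · have hss : (s : ℝ≥0∞)⁻¹ * s = 1 := ENNReal.inv_mul_cancel hs0 hst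
    have hNN : (N : ℝ≥0∞)⁻¹ * N = 1 := ENNReal.inv_mul_cancel hN0 hNt
    have hmi : (q ω * N : ℝ≥0∞)⁻¹ = (q ω : ℝ≥0∞)⁻¹ * (N : ℝ≥0∞)⁻¹ :=
      ENNReal.mul_inv (Or.inl hq1) (Or.inl (by simp))
    calc ((B : ℝ≥0∞)⁻¹ + s * (q ω * N : ℝ≥0∞)⁻¹) * (N * pairMass P ρ G ω n) =
        (N * (B : ℝ≥0∞)⁻¹ * ((s : ℝ≥0∞)⁻¹ * s) + (q ω : ℝ≥0∞)⁻¹ * s * ((N : ℝ≥0∞)⁻¹ * N)) *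
          pairMass P ρ G ω n := by
          rw [hss, hmi]; ring
      _ = (N * (B : ℝ≥0∞)⁻¹ * (s : ℝ≥0∞)⁻¹ + (q ω : ℝ≥0∞)⁻¹) * (s * pairMass P ρ G ω n) := by
          rw [hNN]; ring
      _ ≤ (t + (q ω : ℝ≥0∞)⁻¹) * (p ω * V ω + t) := by
          gcongr
          · calc (N : ℝ≥0∞) * (B : ℝ≥0∞)⁻¹ * (s : ℝ≥0∞)⁻¹ ≤
                C * invMinLeafSize P ρ G ω n := by
                  gcongr
                  exact inv_subsample_le P ρ G hP ω n
              _ ≤ t := hiCn ω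
          · rw [hVc, hpc]; exact hpn ω
      _ = _ := by rw [ENNReal.coe_inv (hq0 ω).ne']

end ColumnLimit

/-! ### Locality of the weights -/

section Rows

variable {d : ℕ} {Ξ : Type*} [MeasurableSpace Ξ] (ρ : Measure Ξ) [IsProbabilityMeasure ρ]
  (P : Measure (FullData d)) [IsProbabilityMeasure P] (G : ForestDesign d Ξ)

/-- Averages over the trees have the expectation of a single tree. -/
theorem lintegral_row_forestMatrix (n : ℕ+) (z : Fin n → ObsData d) (i : Fin n)
    (h : Fin n → ℝ≥0∞) :
    ∫⁻ W, ∑ j with (z j).2.1 = !(z i).2.1, ENNReal.ofReal (W i j) * h j ∂forestMatrix G ρ n z =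
      ∫⁻ v, ∑ j with (z j).2.1 = !(z i).2.1,
        ENNReal.ofReal (treeWeight (G.learner n) z v i j) * h j
          ∂subsampleLaw (G.s n) ρ z (!(z i).2.1) := by
  set T := G.learner n
  set s : ℕ := (G.s n : ℕ)
  set B : ℕ := (G.B n : ℕ)
  have hB : (0 : ℝ) < B := by exact_mod_cast (G.B n).pos
  set J : Finset (Fin n) := {j | (z j).2.1 = !(z i).2.1}
  have hmW : Measurable fun W : Fin n → Fin n → ℝ => ∑ j ∈ J, ENNReal.ofReal (W i j) * h j :=
    Finset.measurable_fun_sum _ fun j _ => (ENNReal.measurable_ofReal.comp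
      ((measurable_pi_apply j).comp (measurable_pi_apply i))).mul_const _
  set g : Finset (Fin n) × Ξ → ℝ≥0∞ := fun v =>
    ∑ j ∈ J, ENNReal.ofReal (treeWeight T z v i j) * h j with hg
  have hmg : Measurable g := Finset.measurable_fun_sum _ fun j _ => (ENNReal.measurable_ofReal.comp
      (measurable_treeWeight T measurable_const measurable_id i j)).mul_const _
  have h1 : ∀ u : ForestRandomness n B Ξ, ∑ j ∈ J, ENNReal.ofReal (forestWeight T z u i j) * h j =
      (B : ℝ≥0∞)⁻¹ * ∑ b, g (u (b, !(z i).2.1)) := by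
    intro u
    simp only [hg]
    rw [Finset.sum_comm, Finset.mul_sum]
    refine Finset.sum_congr rfl fun j _ => ?_
    rw [forestWeight_eq, ENNReal.ofReal_mul (by positivity), ENNReal.ofReal_inv_of_pos hB,
      ENNReal.ofReal_natCast, ENNReal.ofReal_sum_of_nonneg fun b _ => treeWeight_nonneg T _ _ _ _,
      ← Finset.sum_mul, mul_assoc]
  have hmb : ∀ b : Fin B, Measurable fun u : ForestRandomness n B Ξ => g (u (b, !(z i).2.1)) :=
    fun b => hmg.comp (measurable_pi_apply _)
  rw [lintegral_forestMatrix ρ G n z hmW, lintegral_congr h1,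
    lintegral_const_mul _ (Finset.measurable_fun_sum _ fun b _ => hmb b),
    lintegral_finsetSum _ fun b _ => hmb b]
  have h2 : ∀ b : Fin B, ∫⁻ u : ForestRandomness n B Ξ, g (u (b, !(z i).2.1))
      ∂forestRandomnessLaw s B ρ z = ∫⁻ v, g v ∂subsampleLaw s ρ z (!(z i).2.1) := fun b =>
    (measurePreserving_eval (fun q : Fin B × Bool => subsampleLaw s ρ z q.2)
      (b, !(z i).2.1)).lintegral_comp hmg
  rw [Finset.sum_congr rfl fun b _ => h2 b, Finset.sum_const, nsmul_eq_mul, ← mul_assoc,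
    Finset.card_univ, Fintype.card_fin,
    ENNReal.inv_mul_cancel (by exact_mod_cast (G.B n).pos.ne') (ENNReal.natCast_ne_top _), one_mul]

/-- The moments of the distance to the points in the same leaf. -/
noncomputable def leafDist (T : BaseLearner d Ξ) (ℓ : ℕ) {m : ℕ} (x : Cov d)
    (a : Fin m → Cov d × ℝ) (ξ : Ξ) : ℝ≥0∞ :=
  ∑ r, leafShare T ξ a x (a r).1 * edist x (a r).1 ^ ℓ

theorem measurable_leafDist (T : BaseLearner d Ξ) (ℓ : ℕ) {β : Type*} [MeasurableSpace β] {m : ℕ}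
    {f : β → Ξ} {g : β → Fin m → Cov d × ℝ} {h : β → Cov d} (hf : Measurable f)
    (hg : Measurable g) (hh : Measurable h) :
    Measurable fun b => leafDist T ℓ (h b) (g b) (f b) :=
  Finset.measurable_fun_sum _ fun r _ =>
    (measurable_leafShare T hf hg hh (by fun_prop)).mul ((hh.edist (by fun_prop)).pow_const ℓ)

theorem sum_treeWeight_edist (T : BaseLearner d Ξ) (ℓ : ℕ) {n s : ℕ} {ω : Bool}
    {z : Fin n → ObsData d} {v : Finset (Fin n) × Ξ} (hv : v.1 ∈ subsamples s z ω) (i : Fin n) :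
    ∑ j with (z j).2.1 = ω, ENNReal.ofReal (treeWeight T z v i j) *
      edist (z i).1 (z j).1 ^ ℓ = leafDist T ℓ (z i).1 (subsampleData z v.1) v.2 := by
  classical
  have hsub : v.1 ⊆ Finset.univ.filter fun j => (z j).2.1 = ω := (Finset.mem_powersetCard.1 hv).1
  simp only [ofReal_treeWeight, ite_mul, zero_mul]
  rw [← Finset.sum_filter, Finset.filter_mem_eq_inter, Finset.inter_eq_right.2 hsub]
  have hsum : ∀ h : Fin n → ℝ≥0∞, ∑ j ∈ v.1, h j = ∑ r, h (v.1.orderEmbOfFin rfl r) := by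
    intro h
    conv_lhs => rw [← Finset.map_orderEmbOfFin_univ v.1 rfl, Finset.sum_map]
    rfl
  exact hsum _

/-- Data with a positive share lie in the leaf of `x`, hence within its diameter inside `S`, and the
shares sum to at most one. -/
theorem leafDist_le (T : BaseLearner d Ξ) (ℓ : ℕ) {m : ℕ} {S : Set (Cov d)} {x : Cov d} (hx : x ∈ S)
    {a : Fin m → Cov d × ℝ} (ha : ∀ r, (a r).1 ∈ S) (ξ : Ξ) :
    leafDist T ℓ x a ξ ≤ Metric.ediam ((T.tree m ξ a).leafAt x ∩ S) ^ ℓ := by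
  classical
  calc leafDist T ℓ x a ξ ≤ ∑ r, leafShare T ξ a x (a r).1 *
        Metric.ediam ((T.tree m ξ a).leafAt x ∩ S) ^ ℓ := by
        refine Finset.sum_le_sum fun r _ => ?_
        by_cases hr : (a r).1 ∈ (T.tree m ξ a).leafAt x
        · gcongr
          exact Metric.edist_le_ediam_of_mem ⟨mem_leafAt_self _ _, hx⟩ ⟨hr, ha r⟩
        · simp [leafShare, hr]
    _ ≤ 1 * Metric.ediam ((T.tree m ξ a).leafAt x ∩ S) ^ ℓ := by
        rw [← Finset.sum_mul, sum_leafShare]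
        gcongr
        exact ENNReal.div_self_le_one
    _ = _ := one_mul _

theorem ae_covSupport : ∀ᵐ x ∂P.fst, x ∈ covSupport P := Measure.support_mem_ae

theorem ae_armLaw_covSupport (hP : BasicAssumption P) (ω : Bool) :
    ∀ᵐ a ∂armLaw P ω, a.1 ∈ covSupport P := by
  have hac : (armLaw P ω).fst ≪ P.fst := by
    have h1 := covSubLaw_absolutelyContinuous P ω
    rw [covSubLaw_eq_smul P hP] at h1
    exact (Measure.absolutelyContinuous_smul (armMass_pos P hP ω).ne').trans h1
  exact ae_of_ae_map measurable_fst.aemeasurable (hac (ae_covSupport P))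

theorem covSubLaw_le (ω : Bool) : covSubLaw P ω ≤ P.fst := by
  rw [covSubLaw_eq]
  refine (withDensity_mono (ae_of_all _ (armProb_le_one P ω))).trans (le_of_eq ?_)
  simp

theorem exists_fst_le (hD : DensityAssumption P) :
    ∃ C : ℝ≥0, P.fst ≤ (C : ℝ≥0∞) • volume.restrict (covSupport P) := by
  obtain ⟨f, hf, hPf, c, C, hc, hcC⟩ := hD.density
  refine ⟨C, ?_⟩
  have hS : MeasurableSet (covSupport P) := hD.compact.measurableSet
  have h1 : P.fst = (volume.restrict (covSupport P)).withDensity fun x => (f x : ℝ≥0∞) := by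
    rw [← restrict_withDensity hS, ← hPf, Measure.restrict_eq_self_of_ae_mem (ae_covSupport P)]
  rw [h1, ← withDensity_const]
  refine withDensity_mono ?_
  filter_upwards [hcC] with x hx
  exact_mod_cast hx.2

theorem lintegral_leafDist_le (hP : BasicAssumption P) {C : ℝ≥0}
    (hC : P.fst ≤ (C : ℝ≥0∞) • volume.restrict (covSupport P)) (ω ω' : Bool) (ℓ : ℕ) (n : ℕ+) :
    ∫⁻ x, ∫⁻ q, leafDist (G.learner n) ℓ x q.1 q.2 ∂treeLaw P ρ (G.s n) ω ∂covSubLaw P ω' ≤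
      C * leafDiamMoment P ρ G ω ℓ n := by
  have := isProbabilityMeasure_armLaw P hP ω
  have hq : ∀ᵐ q ∂treeLaw P ρ (G.s n) ω, ∀ r, (q.1 r).1 ∈ covSupport P := by
    have h : ∀ᵐ a ∂(Measure.pi fun _ : Fin (G.s n) => armLaw P ω), ∀ r,
        (a r).1 ∈ covSupport P := by
      rw [ae_all_iff]
      exact fun r => (measurePreserving_eval (fun _ : Fin (G.s n) => armLaw P ω) r
        ).quasiMeasurePreserving.ae (ae_armLaw_covSupport P hP ω)
    exact Measure.quasiMeasurePreserving_fst.ae h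
  calc _ ≤ ∫⁻ x, ∫⁻ q, leafDist (G.learner n) ℓ x q.1 q.2 ∂treeLaw P ρ (G.s n) ω ∂P.fst :=
        lintegral_mono' (covSubLaw_le P ω') le_rfl
    _ ≤ ∫⁻ x, ∫⁻ q, Metric.ediam (((G.learner n).tree (G.s n) q.2 q.1).leafAt x ∩ covSupport P) ^ ℓ
          ∂(treeLaw P ρ (G.s n) ω) ∂P.fst := by
        refine lintegral_mono_ae ?_
        filter_upwards [ae_covSupport P] with x hx
        refine lintegral_mono_ae ?_
        filter_upwards [hq] with q hq
        exact leafDist_le _ ℓ hx hq _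
    _ ≤ ∫⁻ x, ∫⁻ q, Metric.ediam (((G.learner n).tree (G.s n) q.2 q.1).leafAt x ∩ covSupport P) ^ ℓ
          ∂(treeLaw P ρ (G.s n) ω) ∂((C : ℝ≥0∞) • volume.restrict (covSupport P)) :=
        lintegral_mono' hC le_rfl
    _ = _ := by rw [lintegral_smul_measure, smul_eq_mul]; rfl

theorem ae_sampleLaw_covSupport (n : ℕ) : ∀ᵐ z ∂sampleLaw P n, ∀ i, (z i).1 ∈ covSupport P := by
  rw [ae_all_iff]
  intro i
  refine (measurePreserving_eval (fun _ : Fin n => obsLaw P) i).quasiMeasurePreserving.ae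
    (p := fun o : ObsData d => o.1 ∈ covSupport P) ?_
  refine ae_of_ae_map (f := Prod.fst) measurable_fst.aemeasurable ?_
  rw [obsLaw_map_fst]
  exact ae_covSupport P

theorem ofReal_discrepancy {n : ℕ} (ℓ : ℕ) (z : Fin n → ObsData d) {W : Fin n → Fin n → ℝ}
    (hW : ∀ i j, 0 ≤ W i j) (i : Fin n) : ENNReal.ofReal (discrepancy ℓ z W i) =
      ∑ j with (z j).2.1 = !(z i).2.1, ENNReal.ofReal (W i j) * edist (z i).1 (z j).1 ^ ℓ := by
  rw [discrepancy, ENNReal.ofReal_sum_of_nonneg fun j _ => by positivity]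
  refine Finset.sum_congr rfl fun j _ => ?_
  rw [abs_of_nonneg (hW i j), ENNReal.ofReal_mul (hW i j), ENNReal.ofReal_pow (norm_nonneg _),
    edist_comm, edist_dist, dist_eq_norm]

/-- The discrepancy in terms of the leaf diameters. -/
theorem expect_discrepancy_le (hP : BasicAssumption P) {C : ℝ≥0}
    (hC : P.fst ≤ (C : ℝ≥0∞) • volume.restrict (covSupport P)) (ℓ : ℕ) (n : ℕ+) :
    expect P (forestMatrix G ρ) n (fun z W => ENNReal.ofReal (discrepancy ℓ z W 0)) ≤
      C * ∑ ω : Bool, leafDiamMoment P ρ G ω ℓ n + Metric.ediam (covSupport P) ^ ℓ *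
        ∑ ω : Bool, sampleLaw P n {z | (arm z ω).card < (G.s n : ℕ)} := by
  set T := G.learner n
  set s : ℕ := (G.s n : ℕ)
  set Δ := Metric.ediam (covSupport P)
  set e : Bool → (Fin n → ObsData d) → ℝ≥0∞ := fun ω z =>
    if (∀ _ : Fin 1, (z 0).2.1 = !ω) ∧ s ≤ (arm z ω).card then
      ∫⁻ v, leafDist T ℓ (z 0).1 (subsampleData z v.1) v.2 ∂subsampleLaw s ρ z ω else 0 with he
  have hme : ∀ ω, Measurable (e ω) := by
    intro ω
    refine Measurable.ite ?_ ?_ measurable_const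
    · simp only [forall_const]
      exact (measurableSet_eq_fun (by fun_prop) measurable_const).inter
        (measurableSet_le_card_arm s ω)
    refine measurable_lintegral_subsampleLaw ρ s ω
      (f := fun p => leafDist T ℓ (p.1 0).1 (subsampleData p.1 p.2.1) p.2.2) ?_
    have h : Measurable fun p : Finset (Fin n) × ((Fin n → ObsData d) × Ξ) =>
        leafDist T ℓ (p.2.1 0).1 (subsampleData p.2.1 p.1) p.2.2 := by
      refine measurable_from_prod_countable_right fun I => ?_
      exact measurable_leafDist T ℓ (by fun_prop)
        ((measurable_subsampleData I).comp measurable_fst) (by fun_prop)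
    exact h.comp (g := fun p : Finset (Fin n) × ((Fin n → ObsData d) × Ξ) =>
        leafDist T ℓ (p.2.1 0).1 (subsampleData p.2.1 p.1) p.2.2)
      (f := fun p : (Fin n → ObsData d) × (Finset (Fin n) × Ξ) => (p.2.1, p.1, p.2.2))
      (by fun_prop)
  have hbm : ∀ ω, MeasurableSet {z : Fin n → ObsData d | (arm z ω).card < s} := by
    intro ω
    simp only [← not_le]
    exact (measurableSet_le_card_arm s ω).compl
  have hpt : ∀ᵐ z ∂sampleLaw P n, ∫⁻ W, ENNReal.ofReal (discrepancy ℓ z W 0)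
      ∂forestMatrix G ρ n z ≤
      ∑ ω, (e ω z + {z : Fin n → ObsData d | (arm z ω).card < s}.indicator (fun _ => Δ ^ ℓ) z) := by
    filter_upwards [ae_sampleLaw_covSupport P n] with z hzS
    set ω := !(z 0).2.1 with hω
    refine le_trans ?_ (Finset.single_le_sum (f := fun ω => e ω z +
      {z : Fin n → ObsData d | (arm z ω).card < s}.indicator (fun _ => Δ ^ ℓ) z)
      (fun _ _ => zero_le) (Finset.mem_univ ω))
    have h1 : ∫⁻ W, ENNReal.ofReal (discrepancy ℓ z W 0) ∂forestMatrix G ρ n z =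
        ∫⁻ W, ∑ j with (z j).2.1 = !(z 0).2.1, ENNReal.ofReal (W 0 j) *
          edist (z 0).1 (z j).1 ^ ℓ ∂forestMatrix G ρ n z := by
      refine lintegral_congr_ae ?_
      filter_upwards [ae_forestMatrix_nonneg ρ G n z] with W hW
      exact ofReal_discrepancy ℓ z hW.1 0
    rw [h1]
    -- If the arm has fewer than `s` units, the tree is built on a smaller sample and
    -- `leafDiamMoment` says nothing about it; the distance is then bounded by the diameter of the
    -- support.
    by_cases hc : s ≤ (arm z ω).card
    · refine le_add_right ?_
      have hez : e ω z = ∫⁻ v, leafDist T ℓ (z 0).1 (subsampleData z v.1) v.2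
          ∂subsampleLaw s ρ z ω := if_pos ⟨fun _ => by rw [hω, Bool.not_not], hc⟩
      rw [hez, lintegral_row_forestMatrix ρ G n z 0]
      refine lintegral_mono_ae ?_
      filter_upwards [ae_subsampleLaw ρ s z ω] with v hv
      exact (sum_treeWeight_edist T ℓ hv 0).le
    · refine le_add_left ?_
      rw [Set.indicator_of_mem (show z ∈ {z | (arm z ω).card < s} from not_le.1 hc)]
      calc _ ≤ ∫⁻ _, Δ ^ ℓ ∂forestMatrix G ρ n z := by
            refine lintegral_mono_ae ?_
            filter_upwards [ae_forestMatrix_nonneg ρ G n z] with W hW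
            calc _ ≤ ∑ j with (z j).2.1 = !(z 0).2.1, ENNReal.ofReal (W 0 j) * Δ ^ ℓ := by
                  gcongr with j _
                  exact Metric.edist_le_ediam_of_mem (hzS 0) (hzS j)
              _ ≤ 1 * Δ ^ ℓ := by
                  rw [← Finset.sum_mul, ← ENNReal.ofReal_sum_of_nonneg fun j _ => hW.1 0 j]
                  gcongr
                  change ENNReal.ofReal (rowSum z W 0) ≤ 1
                  by_cases h : ∃ j, (z j).2.1 = !(z 0).2.1
                  · rw [hW.2 0 h]; simp
                  · rw [rowSum_eq_zero z W 0 h]; simp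
              _ = _ := one_mul _
        _ = _ := by simp
  have hred : ∀ ω, ∫⁻ z, e ω z ∂sampleLaw P n ≤ C * leafDiamMoment P ρ G ω ℓ n := by
    intro ω
    have hinj : Function.Injective fun _ : Fin 1 => (0 : Fin n) :=
      Function.injective_of_subsingleton _
    refine (lintegral_subsample_le P ρ hP s ω hinj
      (Φ := fun m x a ξ => leafDist T ℓ (x 0) a ξ) fun m =>
        measurable_leafDist T ℓ (by fun_prop) (by fun_prop) (by fun_prop)).trans ?_
    refine le_trans (le_of_eq ?_) (lintegral_leafDist_le ρ P G hP hC ω (!ω) ℓ n)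
    have := isProbabilityMeasure_treeLaw P ρ hP s ω
    have hmp := measurePreserving_funUnique (covSubLaw P (!ω)) (Fin 1)
    have hm : Measurable fun x : Cov d => ∫⁻ q, leafDist T ℓ x q.1 q.2 ∂treeLaw P ρ s ω := by
      refine Measurable.lintegral_prod_right' (f := fun w : Cov d ×
        ((Fin s → Cov d × ℝ) × Ξ) => leafDist T ℓ w.1 w.2.1 w.2.2) ?_
      exact measurable_leafDist T ℓ (by fun_prop) (by fun_prop) (by fun_prop)
    exact hmp.lintegral_comp hm
  calc _ ≤ ∫⁻ z, ∑ ω, (e ω z + {z : Fin n → ObsData d | (arm z ω).card < s}.indicator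
        (fun _ => Δ ^ ℓ) z) ∂sampleLaw P n := lintegral_mono_ae hpt
    _ = ∑ ω, (∫⁻ z, e ω z ∂sampleLaw P n +
          Δ ^ ℓ * sampleLaw P n {z | (arm z ω).card < s}) := by
        have hms : ∀ ω, Measurable fun z => e ω z + {z : Fin n → ObsData d |
            (arm z ω).card < s}.indicator (fun _ => Δ ^ ℓ) z := fun ω =>
          (hme ω).add (measurable_const.indicator (hbm ω))
        rw [lintegral_finsetSum _ fun ω _ => hms ω]
        refine Finset.sum_congr rfl fun ω _ => ?_
        rw [lintegral_add_left (hme ω), lintegral_indicator_const (hbm ω)]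
    _ ≤ _ := by
        rw [Finset.sum_add_distrib, Finset.mul_sum, Finset.mul_sum]
        gcongr with ω _
        exact hred ω

end Rows

/-! ### Continuity of the density ratio -/

section Continuity

variable {d : ℕ} (P : Measure (FullData d)) [IsProbabilityMeasure P]

/-- By Bayes' rule the density of X times the conditional probability of arm ω equals p_ω times the
arm density g_ω. In the quotient of two arms the density of X cancels, leaving a quotient of arm
densities, continuous at almost every point since g_ω does not vanish almost everywhere under the
law of X. The cutoff at `R` makes the version bounded everywhere. -/
theorem exists_continuous_armRatio (hP : BasicAssumption P) (hD : DensityAssumption P) :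
    ∃ (R : ℝ≥0) (r : Bool → Cov d → ℝ≥0), ∀ ω, (∀ x, r ω x ≤ R) ∧
      (∀ᵐ x ∂P.fst, armRatio P ω x = r ω x) ∧
      ∀ᵐ x ∂P.fst, ContinuousWithinAt (r ω) (covSupport P) x := by
  obtain ⟨R, hR⟩ := exists_armRatio_le P hP
  obtain ⟨η, hη, hηP⟩ := exists_le_armProb P hP
  obtain ⟨f, hf, hPf, c, C, hc, hcC⟩ := hD.density
  choose g hg hPg hcont using hD.arm_density
  have hS : MeasurableSet (covSupport P) := hD.compact.measurableSet
  have hac : P.fst ≪ volume.restrict (covSupport P) := by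
    rw [← Measure.restrict_eq_self_of_ae_mem (ae_covSupport P)]
    exact (hPf ▸ withDensity_absolutelyContinuous _ _ : P.fst ≪ volume).restrict _
  have hac' : P.fst ≪ volume := hac.trans Measure.restrict_le_self.absolutelyContinuous
  set p : Bool → ℝ≥0 := fun ω => (armMass P ω).toNNReal with hp
  have hpc : ∀ ω, (p ω : ℝ≥0∞) = armMass P ω := fun ω =>
    ENNReal.coe_toNNReal (armMass_ne_top P ω)
  have hp0 : ∀ ω, p ω ≠ 0 := fun ω =>
    (ENNReal.toNNReal_pos (armMass_pos P hP ω).ne' (armMass_ne_top P ω)).ne'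
  have heq : ∀ ω, ∀ᵐ x ∂P.fst, (f x : ℝ≥0∞) * armProb P ω x = p ω * g ω x := by
    intro ω
    have h1 : covSubLaw P ω = volume.withDensity fun x => (f x : ℝ≥0∞) * armProb P ω x := by
      rw [covSubLaw_eq, hPf, ← withDensity_mul _ hf.coe_nnreal_ennreal (measurable_armProb P ω)]
      rfl
    have h2 : covSubLaw P ω = volume.withDensity fun x => (p ω : ℝ≥0∞) * g ω x := by
      rw [covSubLaw_eq_smul P hP, hPg, ← withDensity_smul _ (hg ω).coe_nnreal_ennreal, hpc]
      rfl
    refine hac' ?_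
    refine (withDensity_eq_iff ?_ ?_ ?_).1 (h1.symm.trans h2)
    · exact (hf.coe_nnreal_ennreal.mul (measurable_armProb P ω)).aemeasurable
    · exact ((hg ω).coe_nnreal_ennreal.const_mul _).aemeasurable
    · rw [← setLIntegral_univ, ← withDensity_apply _ MeasurableSet.univ, ← h1]
      exact measure_ne_top _ _
  have hfc : ∀ᵐ x ∂P.fst, f x ≠ 0 := by
    filter_upwards [hac hcC] with x hx
    exact (hc.trans_le hx.1).ne'
  have hg0 : ∀ ω, ∀ᵐ x ∂P.fst, g ω x ≠ 0 := by
    intro ω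
    filter_upwards [heq ω, hfc, hηP ω] with x hx hfx hηx h0
    rw [h0, ENNReal.coe_zero, mul_zero, mul_eq_zero] at hx
    rcases hx with hx | hx
    · exact hfx (by exact_mod_cast hx)
    · rw [hx] at hηx
      exact absurd hηx (not_le.2 (by exact_mod_cast hη))
  refine ⟨R, fun ω x => min (p (!ω) * g (!ω) x / (p ω * g ω x)) R, fun ω =>
    ⟨fun x => min_le_right _ _, ?_, ?_⟩⟩
  · filter_upwards [heq ω, heq (!ω), hg0 ω, hfc, hR ω] with x h1 h2 h3 h4 h5
    have hne : p ω * g ω x ≠ 0 := mul_ne_zero (hp0 ω) h3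
    have hx : armRatio P ω x = ((p (!ω) * g (!ω) x / (p ω * g ω x) : ℝ≥0) : ℝ≥0∞) := by
      rw [ENNReal.coe_div hne, ENNReal.coe_mul, ENNReal.coe_mul, ← h1, ← h2, armRatio,
        ENNReal.mul_div_mul_left _ _ (by exact_mod_cast h4) ENNReal.coe_ne_top]
    rw [ENNReal.coe_min, ← hx, min_eq_left h5]
  · filter_upwards [hac (hcont ω), hac (hcont (!ω)), hg0 ω] with x h1 h2 h3
    have hne : p ω * g ω x ≠ 0 := mul_ne_zero (hp0 ω) h3
    have h4 : Tendsto (fun x => p (!ω) * g (!ω) x / (p ω * g ω x)) (𝓝[covSupport P] x)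
        (𝓝 (p (!ω) * g (!ω) x / (p ω * g ω x))) :=
      Filter.Tendsto.div (Filter.Tendsto.const_mul _ h2) (Filter.Tendsto.const_mul _ h1) hne
    exact h4.min tendsto_const_nhds

/-- The points near which the oscillation of `r` on `S` exceeds `ε`. -/
def oscillationSet (S : Set (Cov d)) (r : Cov d → ℝ≥0) (ε : ℝ≥0) (δ : ℝ≥0∞) : Set (Cov d) :=
  {x | ∃ y ∈ S, ∃ y' ∈ S, edist x y < δ ∧ edist x y' < δ ∧ r y + ε < r y'}

theorem isOpen_oscillationSet (S : Set (Cov d)) (r : Cov d → ℝ≥0) (ε : ℝ≥0) (δ : ℝ≥0∞) :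
    IsOpen (oscillationSet S r ε δ) := by
  have h : oscillationSet S r ε δ = ⋃ y ∈ S, ⋃ y' ∈ S, ⋃ _ : r y + ε < r y',
      {x | edist x y < δ} ∩ {x | edist x y' < δ} := by
    ext x
    simp only [oscillationSet, Set.mem_iUnion, Set.mem_inter_iff, Set.mem_ofPred_eq, exists_prop]
    constructor
    · rintro ⟨y, hy, y', hy', h1, h2, h3⟩; exact ⟨y, hy, y', hy', h3, h1, h2⟩
    · rintro ⟨y, hy, y', hy', h3, h1, h2⟩; exact ⟨y, hy, y', hy', h1, h2, h3⟩
  rw [h]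
  refine isOpen_biUnion fun y _ => isOpen_biUnion fun y' _ => isOpen_iUnion fun _ => ?_
  exact (isOpen_lt (by fun_prop) continuous_const).inter (isOpen_lt (by fun_prop) continuous_const)

/-- The sets decrease as the radius shrinks, and their intersection over the radii contains no point
of continuity, so it is null. Continuity from above of the finite measure gives the radius. -/
theorem exists_measure_oscillationSet_le {r : Cov d → ℝ≥0}
    (hr : ∀ᵐ x ∂P.fst, ContinuousWithinAt r (covSupport P) x) {ε : ℝ≥0} (hε : 0 < ε)
    {η : ℝ≥0∞} (hη : 0 < η) :
    ∃ δ₀ : ℝ≥0∞, 0 < δ₀ ∧ ∀ δ ≤ δ₀, P.fst (oscillationSet (covSupport P) r ε δ) ≤ η := by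
  set U : ℕ → Set (Cov d) := fun m => oscillationSet (covSupport P) r ε ((m : ℝ≥0∞) + 1)⁻¹ with hU
  have hmono : ∀ {δ δ' : ℝ≥0∞}, δ ≤ δ' → oscillationSet (covSupport P) r ε δ ⊆
      oscillationSet (covSupport P) r ε δ' := by
    rintro δ δ' h x ⟨y, hy, y', hy', h1, h2, h3⟩
    exact ⟨y, hy, y', hy', h1.trans_le h, h2.trans_le h, h3⟩
  have hanti : Antitone U := fun m m' h => hmono (ENNReal.inv_le_inv.2 (by gcongr))
  have hzero : P.fst (⋂ m, U m) = 0 := by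
    rw [measure_eq_zero_iff_ae_notMem]
    filter_upwards [hr] with x hx hmem
    have h2 : ∀ᶠ y in 𝓝[covSupport P] x, dist (r y) (r x) < ε / 2 :=
      hx.eventually (Metric.ball_mem_nhds _ (by positivity))
    rw [eventually_nhdsWithin_iff, Metric.nhds_basis_eball.eventually_iff] at h2
    obtain ⟨δ, hδ, hball⟩ := h2
    obtain ⟨m, hm⟩ := ENNReal.exists_inv_nat_lt hδ.ne'
    have hm' : ((m : ℝ≥0∞) + 1)⁻¹ ≤ δ := (ENNReal.inv_le_inv.2 le_self_add).trans hm.le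
    obtain ⟨y, hy, y', hy', h1, h2, h3⟩ := Set.mem_iInter.1 hmem m
    have e1 := hball (show y ∈ Metric.eball x δ by
      rw [Metric.mem_eball, edist_comm]; exact h1.trans_le hm') hy
    have e2 := hball (show y' ∈ Metric.eball x δ by
      rw [Metric.mem_eball, edist_comm]; exact h2.trans_le hm') hy'
    rw [NNReal.dist_eq, abs_lt] at e1 e2
    have h3' : (r y : ℝ) + ε < r y' := by exact_mod_cast h3
    linarith [e1.1, e2.2]
  have hlim := tendsto_measure_iInter_atTop (μ := P.fst) (s := U)
    (fun m => (isOpen_oscillationSet _ _ _ _).measurableSet.nullMeasurableSet) hanti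
    ⟨0, measure_ne_top _ _⟩
  rw [hzero] at hlim
  obtain ⟨m, hm⟩ := (hlim.eventually (gt_mem_nhds hη)).exists
  exact ⟨((m : ℝ≥0∞) + 1)⁻¹, ENNReal.inv_pos.2 (by simp), fun δ hδ =>
    (measure_mono (hmono hδ)).trans hm.le⟩

/-- If `y` is at distance at least `δ`, the distance term already exceeds the bound `R`. If it is
closer, either `x` lies in the oscillation set, where `R` is paid, or the values differ by at most
`ε`. -/
theorem le_add_oscillation {S : Set (Cov d)} {r : Cov d → ℝ≥0} {R : ℝ≥0} (hR : ∀ x, r x ≤ R)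
    (ε : ℝ≥0) {δ : ℝ≥0} (hδ : 0 < δ) {x y : Cov d} (hx : x ∈ S) (hy : y ∈ S) :
    (r x : ℝ≥0∞) ≤ r y + (R / δ : ℝ≥0) * edist x y +
      (ε + (oscillationSet S r ε δ).indicator (fun _ => (R : ℝ≥0∞)) x) := by
  by_cases hd : edist x y < δ
  · by_cases hU : x ∈ oscillationSet S r ε δ
    · rw [Set.indicator_of_mem hU]
      refine le_add_left (le_add_left ?_)
      exact_mod_cast hR x
    · have h : r x ≤ r y + ε := by
        by_contra h
        exact hU ⟨y, hy, x, hx, hd, by simpa using hδ, not_le.1 h⟩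
      calc (r x : ℝ≥0∞) ≤ r y + ε := by exact_mod_cast h
        _ ≤ _ := add_le_add le_self_add le_self_add
  · refine le_add_right (le_add_left ?_)
    calc (r x : ℝ≥0∞) ≤ R := by exact_mod_cast hR x
      _ = (R / δ : ℝ≥0) * (δ : ℝ≥0∞) := by
        rw [← ENNReal.coe_mul, div_mul_cancel₀ _ hδ.ne']
      _ ≤ _ := by gcongr; exact not_lt.1 hd

end Continuity

/-! ### Consistency of the column sums -/

section Consistency

variable {d : ℕ} {Ξ : Type*} [MeasurableSpace Ξ] (ρ : Measure Ξ) [IsProbabilityMeasure ρ]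
  (P : Measure (FullData d)) [IsProbabilityMeasure P] (G : ForestDesign d Ξ)

theorem measurable_arm_fun {g : Bool → Cov d → ℝ≥0∞} (hg : ∀ b, Measurable (g b)) :
    Measurable fun o : ObsData d => g o.2.1 o.1 := by
  have h : Measurable fun q : Bool × Cov d => g q.1 q.2 :=
    measurable_from_prod_countable_right fun b => hg b
  exact h.comp (g := fun q : Bool × Cov d => g q.1 q.2)
    (f := fun o : ObsData d => (o.2.1, o.1)) (by fun_prop)

theorem lintegral_sampleLaw_arm {g : Bool → Cov d → ℝ≥0∞} (hg : ∀ b, Measurable (g b)) {n : ℕ}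
    (i : Fin n) : ∫⁻ z, g (z i).2.1 (z i).1 ∂sampleLaw P n =
      ∑ b, ∫⁻ x, g b x ∂covSubLaw P b := by
  have h := (measurePreserving_eval (fun _ : Fin n => obsLaw P) i).lintegral_comp
    (measurable_arm_fun hg)
  refine Eq.trans h ?_
  conv_lhs => rw [obsLaw_eq_sum, lintegral_finsetSum_measure]
  refine Finset.sum_congr rfl fun b _ => ?_
  rw [covSubLaw, lintegral_map (hg b) measurable_fst, subLaw]
  refine setLIntegral_congr_fun (measurableSet_arm b) fun o ho => ?_
  have ho' : o.2.1 = b := ho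
  simp only [ho']

/-- Integrating the ratio of arm `b` over the opposite arm is integrating its square over arm `b`,
by the change of measure `covSubLaw_not`. Thus the limit of the cross term is the second moment of
the density ratio. -/
theorem sum_lintegral_armRatio_not (hP : BasicAssumption P) :
    ∑ b : Bool, ∫⁻ x, armRatio P (!b) x ∂covSubLaw P b =
      ∑ b : Bool, ∫⁻ x, armRatio P b x ^ 2 ∂covSubLaw P b := by
  have h : ∀ b, ∫⁻ x, armRatio P b x ∂covSubLaw P (!b) =
      ∫⁻ x, armRatio P b x ^ 2 ∂covSubLaw P b := by
    intro b
    rw [covSubLaw_not P hP, lintegral_withDensity_eq_lintegral_mul _ (measurable_armRatio P b)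
      (measurable_armRatio P b)]
    simp only [Pi.mul_apply, sq]
  rw [← Finset.sum_congr rfl fun b _ => h b]
  simp [add_comm]

theorem exists_eventually_card_arm_lt_le (hP : BasicAssumption P) (hG : ForestDRAssumption P ρ G) :
    ∃ c : ℝ, 0 < c ∧ ∀ᶠ n : ℕ+ in atTop,
      ∑ ω : Bool, sampleLaw P n {z | (arm z ω).card < (G.s n : ℕ)} ≤
        2 * ENNReal.ofReal (Real.exp (-c * ((n : ℕ) : ℝ))) := by
  set p : Bool → ℝ := fun ω => (armMass P ω).toReal
  have hp0 : ∀ ω, 0 < p ω := fun ω =>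
    ENNReal.toReal_pos (armMass_pos P hP ω).ne' (armMass_ne_top P ω)
  set m := min (p true) (p false) with hm
  have hm0 : 0 < m := lt_min (hp0 _) (hp0 _)
  have hmp : ∀ ω, m ≤ p ω := by
    intro ω; cases ω
    · exact min_le_right _ _
    · exact min_le_left _ _
  refine ⟨2 * (m / 2) ^ 2, by positivity, ?_⟩
  filter_upwards [eventually_subsample_le ρ P G hG (c := m / 2) (by positivity)] with n hn
  have h : ∀ ω, sampleLaw P n {z | (arm z ω).card < (G.s n : ℕ)} ≤
      ENNReal.ofReal (Real.exp (-(2 * (m / 2) ^ 2) * ((n : ℕ) : ℝ))) := by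
    intro ω
    refine (measure_mono fun z hz => ?_).trans
      (sampleLaw_card_arm_le P ω (ε := m / 2) (by positivity) n)
    have hz' : ((arm z ω).card : ℝ) < ((G.s n : ℕ) : ℝ) := by exact_mod_cast hz
    refine hz'.le.trans (hn.trans ?_)
    gcongr
    linarith [hmp ω]
  calc _ ≤ ∑ _ω : Bool, ENNReal.ofReal (Real.exp (-(2 * (m / 2) ^ 2) * ((n : ℕ) : ℝ))) :=
        Finset.sum_le_sum fun ω _ => h ω
    _ = _ := by simp

theorem tendsto_card_arm_lt (hP : BasicAssumption P) (hG : ForestDRAssumption P ρ G) :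
    Tendsto (fun n : ℕ+ => ∑ ω : Bool, sampleLaw P n {z | (arm z ω).card < (G.s n : ℕ)}) atTop
      (𝓝 0) := by
  obtain ⟨c, hc, h⟩ := exists_eventually_card_arm_lt_le ρ P G hP hG
  have h1 := ENNReal.Tendsto.const_mul (tendsto_rpow_mul_exp 0 hc)
    (Or.inr (ENNReal.ofNat_ne_top (n := 2)))
  rw [mul_zero] at h1
  refine tendsto_of_tendsto_of_tendsto_of_le_of_le' tendsto_const_nhds h1
    (Eventually.of_forall fun _ => zero_le) ?_
  filter_upwards [h] with n hn
  simpa using hn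

theorem ediam_covSupport_ne_top (hD : DensityAssumption P) :
    Metric.ediam (covSupport P) ≠ ∞ := hD.compact.isBounded.ediam_ne_top

theorem tendsto_expect_discrepancy_one (hP : BasicAssumption P) (hG : ForestDRAssumption P ρ G) :
    Tendsto (fun n => expect P (forestMatrix G ρ) n
      (fun z W => ENNReal.ofReal (discrepancy 1 z W 0))) atTop (𝓝 0) := by
  obtain ⟨C, hC⟩ := exists_fst_le P hG.density
  have h1 : Tendsto (fun n => (C : ℝ≥0∞) * ∑ ω : Bool, leafDiamMoment P ρ G ω 1 n +
      Metric.ediam (covSupport P) ^ 1 *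
        ∑ ω : Bool, sampleLaw P n {z | (arm z ω).card < (G.s n : ℕ)}) atTop (𝓝 0) := by
    have h2 := ENNReal.Tendsto.const_mul (tendsto_finsetSum (Finset.univ : Finset Bool)
      fun ω _ => hG.leafDiam ω) (Or.inr (ENNReal.coe_ne_top (r := C)))
    have h3 := ENNReal.Tendsto.const_mul (tendsto_card_arm_lt ρ P G hP hG)
      (Or.inr (ENNReal.pow_ne_top (n := 1) (ediam_covSupport_ne_top P hG.density)))
    simpa using h2.add h3
  exact tendsto_of_tendsto_of_tendsto_of_le_of_le tendsto_const_nhds h1 (fun _ => zero_le)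
    fun n => expect_discrepancy_le ρ P G hP hC 1 n

/-- The expectation of the product of the column sum and the density ratio. -/
theorem expect_cross_eq (n : ℕ+) :
    expect P (forestMatrix G ρ) n (fun z W => ENNReal.ofReal (colSum z W 0) *
      armRatio P (z 0).2.1 (z 0).1) =
    expect P (forestMatrix G ρ) n (fun z W => ∑ j, if (z j).2.1 = !(z 0).2.1 then
      ENNReal.ofReal (W 0 j) * armRatio P (z j).2.1 (z j).1 else 0) := by
  have hφ : Measurable fun q : ObsData d × ObsData d => armRatio P q.1.2.1 q.1.1 :=
    (measurable_arm_fun (measurable_armRatio P)).comp measurable_fst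
  rw [← expect_col_eq_row ρ P G n hφ]
  refine lintegral_congr fun z => lintegral_congr_ae ?_
  filter_upwards [ae_forestMatrix_nonneg ρ G n z] with W hW
  rw [colSum, ENNReal.ofReal_sum_of_nonneg fun j _ => hW.1 j 0, Finset.sum_mul, Finset.sum_filter]

/-- The weights of a row sum to one, so the ratio at unit 1 is an average over donors that
`le_add_oscillation` compares with their own ratios. The distance errors add up to a discrepancy,
the oscillation errors depend on unit 1 only. Only this lower bound is needed. -/
theorem eventually_le_expect_cross (hP : BasicAssumption P) (hG : ForestDRAssumption P ρ G)
    {ε : ℝ≥0} (hε : 0 < ε) :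
    ∀ᶠ n : ℕ+ in atTop, ∑ ω : Bool, ∫⁻ x, armRatio P ω x ^ 2 ∂covSubLaw P ω ≤
      expect P (forestMatrix G ρ) n (fun z W => ENNReal.ofReal (colSum z W 0) *
        armRatio P (z 0).2.1 (z 0).1) + ε := by
  obtain ⟨R, r, hr⟩ := exists_continuous_armRatio P hP hG.density
  -- Five errors: the discrepancy, the oscillation allowance, the two oscillation sets, one for each
  -- arm, and the small arms.
  set ε' : ℝ≥0 := ε / 5 with hε'
  have hε'0 : 0 < ε' := by positivity
  have hε'1 : (0 : ℝ≥0∞) < ε' := by exact_mod_cast hε'0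
  have hη : (0 : ℝ≥0∞) < ε' / (R + 1) := ENNReal.div_pos hε'1.ne' (by simp)
  have hRη : (R : ℝ≥0∞) * (ε' / (R + 1)) ≤ ε' := by
    rw [← mul_div_assoc]
    refine ENNReal.div_le_of_le_mul ?_
    rw [mul_comm]
    gcongr
    exact le_self_add
  choose δ₀ hδ₀ hU using fun ω => exists_measure_oscillationSet_le P (hr ω).2.2 hε'0 hη
  obtain ⟨δ, hδ, hδlt⟩ : ∃ δ : ℝ≥0, 0 < δ ∧ ∀ ω, (δ : ℝ≥0∞) ≤ δ₀ ω := by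
    have h0 : 0 < min (min (δ₀ true) (δ₀ false)) 1 :=
      lt_min (lt_min (hδ₀ _) (hδ₀ _)) one_pos
    have ht : min (min (δ₀ true) (δ₀ false)) 1 ≠ ∞ := ne_top_of_le_ne_top (by simp) (min_le_right _ _)
    refine ⟨(min (min (δ₀ true) (δ₀ false)) 1).toNNReal, ENNReal.toNNReal_pos h0.ne' ht, ?_⟩
    rw [ENNReal.coe_toNNReal ht]
    intro ω; cases ω
    · exact (min_le_left _ _).trans (min_le_right _ _)
    · exact (min_le_left _ _).trans (min_le_left _ _)
  set S := covSupport P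
  set U : Bool → Set (Cov d) := fun ω => oscillationSet S (r ω) ε' δ with hUdef
  have hUm : ∀ ω, MeasurableSet (U ω) := fun ω => (isOpen_oscillationSet _ _ _ _).measurableSet
  have hdisc : ∀ᶠ n : ℕ+ in atTop, ((R / δ : ℝ≥0) : ℝ≥0∞) * expect P (forestMatrix G ρ) n
      (fun z W => ENNReal.ofReal (discrepancy 1 z W 0)) ≤ ε' := by
    have h := ENNReal.Tendsto.const_mul (tendsto_expect_discrepancy_one ρ P G hP hG)
      (Or.inr (ENNReal.coe_ne_top (r := R / δ)))
    rw [mul_zero] at h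
    exact (h.eventually (gt_mem_nhds hε'1)).mono fun n hn => hn.le
  have hbad : ∀ᶠ n : ℕ+ in atTop, (R : ℝ≥0∞) * ∑ ω : Bool,
      sampleLaw P n {z | (arm z ω).card < (G.s n : ℕ)} ≤ ε' := by
    have h := ENNReal.Tendsto.const_mul (tendsto_card_arm_lt ρ P G hP hG)
      (Or.inr (ENNReal.coe_ne_top (r := R)))
    rw [mul_zero] at h
    exact (h.eventually (gt_mem_nhds hε'1)).mono fun n hn => hn.le
  filter_upwards [hdisc, hbad] with n hdn hbn
  set s : ℕ := (G.s n : ℕ)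
  rw [expect_cross_eq ρ P G n, ← sum_lintegral_armRatio_not P hP,
    ← lintegral_sampleLaw_arm P (g := fun b => armRatio P (!b))
      (fun b => measurable_armRatio P (!b)) (0 : Fin n)]
  have hae : ∀ᵐ z ∂sampleLaw P n, ∀ i : Fin n, ∀ ω, armRatio P ω (z i).1 = r ω (z i).1 := by
    rw [ae_all_iff]
    intro i
    refine (measurePreserving_eval (fun _ : Fin n => obsLaw P) i).quasiMeasurePreserving.ae
      (p := fun o : ObsData d => ∀ ω, armRatio P ω o.1 = r ω o.1) ?_
    refine ae_of_ae_map (f := Prod.fst) measurable_fst.aemeasurable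
      (p := fun x => ∀ ω, armRatio P ω x = r ω x) ?_
    rw [obsLaw_map_fst, ae_all_iff]
    exact fun ω => (hr ω).2.1
  set g1 : (Fin n → ObsData d) → (Fin n → Fin n → ℝ) → ℝ≥0∞ := fun z W =>
    ∑ j, if (z j).2.1 = !(z 0).2.1 then
      ENNReal.ofReal (W 0 j) * armRatio P (z j).2.1 (z j).1 else 0 with hg1
  set g2 : (Fin n → ObsData d) → (Fin n → Fin n → ℝ) → ℝ≥0∞ := fun z W =>
    ∑ j, if (z j).2.1 = !(z 0).2.1 then
      ENNReal.ofReal (W 0 j) * (((R / δ : ℝ≥0) : ℝ≥0∞) * edist (z 0).1 (z j).1 ^ 1) else 0 with hg2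
  set g3 : (Fin n → ObsData d) → ℝ≥0∞ := fun z =>
    ε' + ∑ ω, ((U ω).indicator (fun _ => (R : ℝ≥0∞)) (z 0).1 +
      {z : Fin n → ObsData d | (arm z ω).card < s}.indicator (fun _ => (R : ℝ≥0∞)) z) with hg3
  have hm1 : Measurable (Function.uncurry g1) := by
    have hφ : Measurable fun q : ObsData d × ObsData d => armRatio P q.2.2.1 q.2.1 :=
      (measurable_arm_fun (measurable_armRatio P)).comp measurable_snd
    exact Finset.measurable_fun_sum Finset.univ fun j _ => measurable_weight_term 0 j 0 j hφ
  have hm2 : Measurable (Function.uncurry g2) := by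
    have hφ : Measurable fun q : ObsData d × ObsData d =>
        ((R / δ : ℝ≥0) : ℝ≥0∞) * edist q.1.1 q.2.1 ^ 1 := by fun_prop
    exact Finset.measurable_fun_sum Finset.univ fun j _ => measurable_weight_term 0 j 0 j hφ
  have hbm : ∀ ω, MeasurableSet {z : Fin n → ObsData d | (arm z ω).card < s} := by
    intro ω
    simp only [← not_le]
    exact (measurableSet_le_card_arm s ω).compl
  have hpt : ∀ᵐ z ∂sampleLaw P n, ∀ᵐ W ∂forestMatrix G ρ n z,
      armRatio P (!(z 0).2.1) (z 0).1 ≤ g1 z W + (g2 z W + g3 z) := by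
    filter_upwards [hae, ae_sampleLaw_covSupport P n] with z hz hzS
    filter_upwards [ae_forestMatrix_nonneg ρ G n z] with W hW
    set ω := !(z 0).2.1 with hω
    have h3 : ε' + (U ω).indicator (fun _ => (R : ℝ≥0∞)) (z 0).1 ≤ g3 z := by
      simp only [hg3]
      gcongr
      refine le_trans le_self_add (Finset.single_le_sum (f := fun ω =>
        ((U ω).indicator (fun _ => (R : ℝ≥0∞)) (z 0).1 +
        {z : Fin n → ObsData d | (arm z ω).card < s}.indicator (fun _ => (R : ℝ≥0∞)) z))
        (fun _ _ => zero_le) (Finset.mem_univ ω))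
    -- If the opposite arm is empty the row vanishes and no comparison is possible. As `s` is at
    -- least 1, this case is contained in the event that the arm has fewer than `s` units.
    by_cases hex : ∃ j, (z j).2.1 = !(z 0).2.1
    · have hsum : ∑ j, (if (z j).2.1 = !(z 0).2.1 then ENNReal.ofReal (W 0 j) else 0) = 1 := by
        rw [← ofReal_rowSum z hW.1, hW.2 0 hex, ENNReal.ofReal_one]
      refine le_trans ?_ (add_le_add_right (add_le_add_right h3 _) _)
      set κ := ε' + (U ω).indicator (fun _ => (R : ℝ≥0∞)) (z 0).1
      calc armRatio P ω (z 0).1 = ∑ j, (if (z j).2.1 = !(z 0).2.1 then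
            ENNReal.ofReal (W 0 j) * armRatio P ω (z 0).1 else 0) := by
            simp only [← ite_zero_mul, ← Finset.sum_mul, hsum, one_mul]
        _ ≤ ∑ j, ((if (z j).2.1 = !(z 0).2.1 then
              ENNReal.ofReal (W 0 j) * armRatio P (z j).2.1 (z j).1 else 0) +
            ((if (z j).2.1 = !(z 0).2.1 then
      ENNReal.ofReal (W 0 j) * (((R / δ : ℝ≥0) : ℝ≥0∞) * edist (z 0).1 (z j).1 ^ 1) else 0) +
              (if (z j).2.1 = !(z 0).2.1 then ENNReal.ofReal (W 0 j) else 0) * κ)) := by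
            refine Finset.sum_le_sum fun j _ => ?_
            by_cases hj : (z j).2.1 = !(z 0).2.1
            · simp only [if_pos hj]
              rw [← mul_add, ← mul_add, hj, ← hω, hz, hz, pow_one]
              gcongr
              rw [← add_assoc]
              exact le_add_oscillation (hr ω).1 ε' hδ (hzS 0) (hzS j)
            · simp [hj]
        _ = _ := by
            rw [Finset.sum_add_distrib, Finset.sum_add_distrib, ← Finset.sum_mul, hsum, one_mul]
    · refine le_add_left (le_add_left ?_)
      have hcard : z ∈ {z : Fin n → ObsData d | (arm z ω).card < s} := by
        have h0 : (arm z ω) = ∅ := by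
          refine Finset.eq_empty_of_forall_notMem fun j hj => hex ⟨j, ?_⟩
          simpa [arm, hω] using hj
        change (arm z ω).card < s
        rw [h0, Finset.card_empty]
        exact (G.s n).pos
      calc armRatio P ω (z 0).1 ≤ R := by rw [hz]; exact_mod_cast (hr ω).1 _
        _ = {z : Fin n → ObsData d | (arm z ω).card < s}.indicator (fun _ => (R : ℝ≥0∞)) z :=
            (Set.indicator_of_mem hcard (fun _ => (R : ℝ≥0∞))).symm
        _ ≤ _ := by
            refine le_add_left (le_trans le_add_self (Finset.single_le_sum (f := fun ω =>
              ((U ω).indicator (fun _ => (R : ℝ≥0∞)) (z 0).1 +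
              {z : Fin n → ObsData d | (arm z ω).card < s}.indicator (fun _ => (R : ℝ≥0∞)) z))
              (fun _ _ => zero_le) (Finset.mem_univ ω)))
  have hUi : ∀ ω, ∫⁻ z : Fin n → ObsData d, (U ω).indicator (fun _ => (R : ℝ≥0∞)) (z 0).1
      ∂sampleLaw P n ≤ ε' := by
    intro ω
    have hmi : Measurable ((U ω).indicator fun _ : Cov d => (R : ℝ≥0∞)) :=
      measurable_const.indicator (hUm ω)
    have h1 := (measurePreserving_eval (fun _ : Fin n => obsLaw P) 0).lintegral_comp
      (hmi.comp measurable_fst)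
    refine le_trans (le_of_eq h1) ?_
    have h2 := lintegral_map (μ := obsLaw P) hmi measurable_fst
    rw [obsLaw_map_fst] at h2
    refine le_trans (le_of_eq h2.symm) ?_
    rw [lintegral_indicator_const (hUm ω)]
    refine le_trans ?_ hRη
    gcongr
    exact hU ω δ (hδlt ω)
  have hg2le : expect P (forestMatrix G ρ) n g2 ≤ ε' := by
    refine le_trans (le_of_eq ?_) hdn
    simp only [expect]
    rw [← lintegral_const_mul' _ _ (by simp)]
    refine lintegral_congr fun z => ?_
    rw [← lintegral_const_mul' _ _ (by simp)]
    refine lintegral_congr_ae ?_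
    filter_upwards [ae_forestMatrix_nonneg ρ G n z] with W hW
    rw [ofReal_discrepancy 1 z hW.1, Finset.mul_sum, Finset.sum_filter]
    simp only [hg2, mul_left_comm]
  have hm3 : ∀ ω, Measurable fun z : Fin n → ObsData d =>
      ((U ω).indicator (fun _ => (R : ℝ≥0∞)) (z 0).1 +
      {z : Fin n → ObsData d | (arm z ω).card < s}.indicator (fun _ => (R : ℝ≥0∞)) z) := by
    intro ω
    have hmi : Measurable ((U ω).indicator fun _ : Cov d => (R : ℝ≥0∞)) :=
      measurable_const.indicator (hUm ω)
    exact (hmi.comp (by fun_prop : Measurable fun z : Fin n → ObsData d => (z 0).1)).add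
      (measurable_const.indicator (hbm ω))
  have hm3' : Measurable g3 := measurable_const.add (Finset.measurable_fun_sum _ fun ω _ => hm3 ω)
  have hg3le : ∫⁻ z, g3 z ∂sampleLaw P n ≤ ε' + (2 * ε' + ε') := by
    simp only [hg3]
    rw [lintegral_add_left measurable_const, lintegral_finsetSum _ fun ω _ => hm3 ω]
    have h1 : ∀ ω, ∫⁻ z : Fin n → ObsData d, ((U ω).indicator (fun _ => (R : ℝ≥0∞)) (z 0).1 +
        {z : Fin n → ObsData d | (arm z ω).card < s}.indicator (fun _ => (R : ℝ≥0∞)) z)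
        ∂sampleLaw P n ≤ ε' + R * sampleLaw P n {z | (arm z ω).card < s} := by
      intro ω
      rw [lintegral_add_right _ (measurable_const.indicator (hbm ω)),
        lintegral_indicator_const (hbm ω)]
      gcongr
      exact hUi ω
    refine add_le_add (by simp) ((Finset.sum_le_sum fun ω _ => h1 ω).trans ?_)
    rw [Finset.sum_add_distrib, ← Finset.mul_sum]
    refine add_le_add (by simp) hbn
  calc _ = expect P (forestMatrix G ρ) n (fun z _ => armRatio P (!(z 0).2.1) (z 0).1) := by
        simp [expect]
    _ ≤ expect P (forestMatrix G ρ) n (fun z W => g1 z W + (g2 z W + g3 z)) :=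
        expect_mono ρ P G n hpt
    _ = expect P (forestMatrix G ρ) n g1 + (expect P (forestMatrix G ρ) n g2 +
          ∫⁻ z, g3 z ∂sampleLaw P n) := by
        have hm3u : Measurable (Function.uncurry fun (z : Fin n → ObsData d)
            (_ : Fin n → Fin n → ℝ) => g3 z) := hm3'.comp measurable_fst
        have hm23 : Measurable (Function.uncurry fun (z : Fin n → ObsData d)
            (W : Fin n → Fin n → ℝ) => g2 z W + g3 z) := hm2.add hm3u
        rw [expect_add ρ P G n hm1 hm23, expect_add ρ P G n hm2 hm3u]
        simp [expect]
    _ ≤ expect P (forestMatrix G ρ) n g1 + (ε' + (ε' + (2 * ε' + ε'))) := by gcongr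
    _ = _ := by
        have h5 : ε' + (ε' + (2 * ε' + ε')) = ε := by rw [hε']; ring
        rw [← h5]
        push_cast
        rfl

end Consistency

/-! ### Calculus of rates -/

section Rates

theorem IsLittleOPow.mono {a b : ℕ+ → ℝ≥0∞} {r : ℝ} (hb : IsLittleOPow b r)
    (h : ∀ᶠ n in atTop, a n ≤ b n) : IsLittleOPow a r := by
  refine tendsto_of_tendsto_of_tendsto_of_le_of_le' tendsto_const_nhds hb
    (Eventually.of_forall fun _ => zero_le) ?_
  filter_upwards [h] with n hn
  gcongr

theorem IsLittleOPow.add {a b : ℕ+ → ℝ≥0∞} {r : ℝ} (ha : IsLittleOPow a r)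
    (hb : IsLittleOPow b r) : IsLittleOPow (fun n => a n + b n) r := by
  have h := Tendsto.add ha hb
  rw [add_zero] at h
  exact h.congr fun n => ENNReal.add_div.symm

theorem IsLittleOPow.const_mul {a : ℕ+ → ℝ≥0∞} {r : ℝ} (ha : IsLittleOPow a r) {c : ℝ≥0∞}
    (hc : c ≠ ∞) : IsLittleOPow (fun n => c * a n) r := by
  have h := ENNReal.Tendsto.const_mul ha (Or.inr hc)
  rw [mul_zero] at h
  exact h.congr fun n => (mul_div_assoc _ _ _).symm

theorem isLittleOPow_exp {c : ℝ} (hc : 0 < c) (r : ℝ) :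
    IsLittleOPow (fun n => ENNReal.ofReal (Real.exp (-c * ((n : ℕ) : ℝ)))) r := by
  refine (tendsto_rpow_mul_exp (-r) hc).congr fun n => ?_
  have hn : (0 : ℝ) < ((n : ℕ) : ℝ) := by exact_mod_cast n.pos
  rw [Real.rpow_neg hn.le, ENNReal.ofReal_inv_of_pos (by positivity), mul_comm, div_eq_mul_inv]

end Rates

/-! ### Rates of the row sums, locality and mean square error -/

section Conclusion

variable {d : ℕ} {Ξ : Type*} [MeasurableSpace Ξ] (ρ : Measure Ξ) [IsProbabilityMeasure ρ]
  (P : Measure (FullData d)) [IsProbabilityMeasure P] (G : ForestDesign d Ξ)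

/-- The row sums differ from one only if an arm is empty. -/
theorem expect_sq_rowSum_sub_one_le (n : ℕ+) :
    expect P (forestMatrix G ρ) n (fun z W => ENNReal.ofReal ((rowSum z W 0 - 1) ^ 2)) ≤
      ∑ ω : Bool, sampleLaw P n {z | ((arm z ω).card : ℝ) ≤ 0} := by
  have hm : ∀ ω, MeasurableSet {z : Fin n → ObsData d | ((arm z ω).card : ℝ) ≤ 0} := by
    intro ω
    have : {z : Fin n → ObsData d | ((arm z ω).card : ℝ) ≤ 0} = {z | 1 ≤ (arm z ω).card}ᶜ := by
      ext z
      simp [Nat.one_le_iff_ne_zero]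
    rw [this]
    exact (measurableSet_le_card_arm 1 ω).compl
  calc _ ≤ ∫⁻ z, ∑ ω, {z : Fin n → ObsData d | ((arm z ω).card : ℝ) ≤ 0}.indicator 1 z
        ∂sampleLaw P n := by
        refine lintegral_mono fun z => ?_
        by_cases hex : ∃ j, (z j).2.1 = !(z 0).2.1
        · refine le_trans (le_of_eq ?_) zero_le
          calc _ = ∫⁻ _, 0 ∂forestMatrix G ρ n z := by
                refine lintegral_congr_ae ?_
                filter_upwards [ae_forestMatrix_nonneg ρ G n z] with W hW
                rw [hW.2 0 hex]; simp
            _ = 0 := by simp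
        · have hcard : z ∈ {z : Fin n → ObsData d | ((arm z (!(z 0).2.1)).card : ℝ) ≤ 0} := by
            have h0 : arm z (!(z 0).2.1) = ∅ :=
              Finset.eq_empty_of_forall_notMem fun j hj => hex ⟨j, by simpa [arm] using hj⟩
            change ((arm z (!(z 0).2.1)).card : ℝ) ≤ 0
            simp [h0]
          refine le_trans ?_ (Finset.single_le_sum (f := fun ω =>
            {z : Fin n → ObsData d | ((arm z ω).card : ℝ) ≤ 0}.indicator (fun _ => (1 : ℝ≥0∞)) z)
            (fun _ _ => zero_le) (Finset.mem_univ (!(z 0).2.1)))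
          have h1 : {z' : Fin n → ObsData d | ((arm z' (!(z 0).2.1)).card : ℝ) ≤ 0}.indicator
              (fun _ => (1 : ℝ≥0∞)) z = 1 := Set.indicator_of_mem hcard (fun _ => (1 : ℝ≥0∞))
          rw [h1]
          calc _ = ∫⁻ _, 1 ∂forestMatrix G ρ n z := by
                refine lintegral_congr fun W => ?_
                simp [rowSum_eq_zero z W 0 hex]
            _ ≤ 1 := by simp
    _ = _ := by
        rw [lintegral_finsetSum _ fun ω _ => measurable_one.indicator (hm ω)]
        exact Finset.sum_congr rfl fun ω _ => lintegral_indicator_one (hm ω)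

/-- The probability of an empty arm decays exponentially, hence faster than any power of n. -/
theorem isLittleOPow_rowSum (hP : BasicAssumption P) (r : ℝ) :
    IsLittleOPow (fun n => expect P (forestMatrix G ρ) n
      fun z W => ENNReal.ofReal ((rowSum z W 0 - 1) ^ 2)) r := by
  have hp0 : ∀ ω, 0 < (armMass P ω).toReal := fun ω =>
    ENNReal.toReal_pos (armMass_pos P hP ω).ne' (armMass_ne_top P ω)
  have hc : ∀ ω, 0 < 2 * (armMass P ω).toReal ^ 2 := fun ω => by have := hp0 ω; positivity
  refine ((isLittleOPow_exp (hc true) r).add (isLittleOPow_exp (hc false) r)).mono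
    (Eventually.of_forall fun n => (expect_sq_rowSum_sub_one_le ρ P G n).trans ?_)
  rw [Fintype.sum_bool]
  have h : ∀ ω, sampleLaw P n {z | ((arm z ω).card : ℝ) ≤ 0} ≤
      ENNReal.ofReal (Real.exp (-(2 * (armMass P ω).toReal ^ 2) * ((n : ℕ) : ℝ))) := by
    intro ω
    have := sampleLaw_card_arm_le P ω (hp0 ω).le n
    rwa [sub_self, zero_mul] at this
  exact add_le_add (h true) (h false)

theorem rowSumRate_forestMatrix (hP : BasicAssumption P) : RowSumRate P (forestMatrix G ρ) :=
  isLittleOPow_rowSum ρ P G hP (-1)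

theorem weightAssumption_forestMatrix (hP : BasicAssumption P) :
    WeightAssumption P (forestMatrix G ρ) where
  invariant := permutationInvariant_forestMatrix ρ G
  rowSum_tendsto := by
    have h := isLittleOPow_rowSum ρ P G hP 0
    simpa [IsLittleOPow] using h

theorem isLittleOPow_discrepancy (hP : BasicAssumption P) (hG : ForestDRAssumption P ρ G) {ℓ : ℕ}
    {r : ℝ} (h : ∀ ω, IsLittleOPow (leafDiamMoment P ρ G ω ℓ) r) :
    IsLittleOPow (fun n => expect P (forestMatrix G ρ) n
      fun z W => ENNReal.ofReal (discrepancy ℓ z W 0)) r := by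
  obtain ⟨C, hC⟩ := exists_fst_le P hG.density
  obtain ⟨c, hc, hbad⟩ := exists_eventually_card_arm_lt_le ρ P G hP hG
  have h1 := (((h true).add (h false)).const_mul (ENNReal.coe_ne_top (r := C))).add
    (((isLittleOPow_exp hc r).const_mul (ENNReal.ofNat_ne_top (n := 2))).const_mul
      (ENNReal.pow_ne_top (n := ℓ) (ediam_covSupport_ne_top P hG.density)))
  refine h1.mono ?_
  filter_upwards [hbad] with n hn
  refine (expect_discrepancy_le ρ P G hP hC ℓ n).trans ?_
  rw [Fintype.sum_bool]
  gcongr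

theorem lintegral_sq_armRatio_sampleLaw (n : ℕ+) :
    ∫⁻ z, armRatio P (z 0).2.1 (z 0).1 ^ 2 ∂sampleLaw P n =
      ∑ ω : Bool, ∫⁻ x, armRatio P ω x ^ 2 ∂covSubLaw P ω :=
  lintegral_sampleLaw_arm P (g := fun b x => armRatio P b x ^ 2)
    (fun b => (measurable_armRatio P b).pow_const 2) (0 : Fin n)

theorem measurable_uncurry_colSum {n : ℕ} (i : Fin n) : Measurable
    (Function.uncurry fun (z : Fin n → ObsData d) (W : Fin n → Fin n → ℝ) => colSum z W i) := by
  change Measurable fun p : (Fin n → ObsData d) × (Fin n → Fin n → ℝ) => colSum p.1 p.2 i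
  simp only [colSum, Finset.sum_filter]
  refine Finset.measurable_fun_sum _ fun j _ => Measurable.ite
    (measurable_fst (measurableSet_arm_eq i j)) ?_ measurable_const
  exact (measurable_pi_apply i).comp ((measurable_pi_apply j).comp measurable_snd)

/-- Expansion of the mean squared error of the column sums. -/
theorem expect_sq_error_add (hP : BasicAssumption P) (n : ℕ+) :
    expect P (forestMatrix G ρ) n (fun z W =>
      ENNReal.ofReal ((colSum z W 0 - densityRatio P (z 0).1 (z 0).2.1) ^ 2)) +
    2 * expect P (forestMatrix G ρ) n (fun z W => ENNReal.ofReal (colSum z W 0) *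
        armRatio P (z 0).2.1 (z 0).1) =
    expect P (forestMatrix G ρ) n (fun z W => ENNReal.ofReal (colSum z W 0 ^ 2)) +
      ∑ ω : Bool, ∫⁻ x, armRatio P ω x ^ 2 ∂covSubLaw P ω := by
  -- The identity (c - q)² + 2cq = c² + q² is lifted from the reals, which requires the ratio to be
  -- finite almost everywhere. The cross term stands on the left because subtraction in `ℝ≥0∞` is
  -- truncated.
  obtain ⟨R, hR⟩ := exists_armRatio_le P hP
  have hRz : ∀ᵐ z ∂sampleLaw P n, armRatio P (z 0).2.1 (z 0).1 ≤ R := by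
    refine (measurePreserving_eval (fun _ : Fin n => obsLaw P) 0).quasiMeasurePreserving.ae
      (p := fun o : ObsData d => armRatio P o.2.1 o.1 ≤ R) ?_
    have h : ∀ᵐ o ∂obsLaw P, ∀ b, armRatio P b o.1 ≤ R := by
      refine ae_of_ae_map (f := Prod.fst) measurable_fst.aemeasurable
        (p := fun x => ∀ b, armRatio P b x ≤ R) ?_
      rw [obsLaw_map_fst, ae_all_iff]
      exact hR
    filter_upwards [h] with o ho using ho _
  have hr : Measurable fun z : Fin n → ObsData d => armRatio P (z 0).2.1 (z 0).1 :=
    (measurable_arm_fun (measurable_armRatio P)).comp (measurable_pi_apply 0)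
  have hru : Measurable (Function.uncurry fun (z : Fin n → ObsData d)
      (_ : Fin n → Fin n → ℝ) => armRatio P (z 0).2.1 (z 0).1) := hr.comp measurable_fst
  have hc := measurable_uncurry_colSum (d := d) (0 : Fin n)
  have hm1 : Measurable (Function.uncurry fun (z : Fin n → ObsData d) (W : Fin n → Fin n → ℝ) =>
      ENNReal.ofReal (colSum z W 0 ^ 2)) := ENNReal.measurable_ofReal.comp (hc.pow_const 2)
  have hm2 : Measurable (Function.uncurry fun (z : Fin n → ObsData d) (W : Fin n → Fin n → ℝ) =>
      ENNReal.ofReal (colSum z W 0) * armRatio P (z 0).2.1 (z 0).1) :=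
    (ENNReal.measurable_ofReal.comp hc).mul hru
  have hm2' : Measurable (Function.uncurry fun (z : Fin n → ObsData d) (W : Fin n → Fin n → ℝ) =>
      2 * (ENNReal.ofReal (colSum z W 0) * armRatio P (z 0).2.1 (z 0).1)) := hm2.const_mul 2
  have hm3 : Measurable (Function.uncurry fun (z : Fin n → ObsData d) (W : Fin n → Fin n → ℝ) =>
      ENNReal.ofReal ((colSum z W 0 - densityRatio P (z 0).1 (z 0).2.1) ^ 2)) := by
    simp only [densityRatio_eq]
    exact ENNReal.measurable_ofReal.comp ((hc.sub hru.ennreal_toReal).pow_const 2)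
  have hm4 : Measurable (Function.uncurry fun (z : Fin n → ObsData d)
      (_ : Fin n → Fin n → ℝ) => armRatio P (z 0).2.1 (z 0).1 ^ 2) := hru.pow_const 2
  have h2 : 2 * expect P (forestMatrix G ρ) n (fun z W => ENNReal.ofReal (colSum z W 0) *
        armRatio P (z 0).2.1 (z 0).1) = expect P (forestMatrix G ρ) n (fun z W =>
        2 * (ENNReal.ofReal (colSum z W 0) * armRatio P (z 0).2.1 (z 0).1)) := by
    simp only [expect]
    rw [← lintegral_const_mul' _ _ (by simp)]
    refine lintegral_congr fun z => ?_
    rw [← lintegral_const_mul' _ _ (by simp)]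
  have h4 : ∑ ω : Bool, ∫⁻ x, armRatio P ω x ^ 2 ∂covSubLaw P ω =
      expect P (forestMatrix G ρ) n (fun z _ => armRatio P (z 0).2.1 (z 0).1 ^ 2) := by
    rw [← lintegral_sq_armRatio_sampleLaw P n]
    simp [expect]
  rw [h2, h4, ← expect_add ρ P G n hm3 hm2', ← expect_add ρ P G n hm1 hm4]
  refine lintegral_congr_ae ?_
  filter_upwards [hRz] with z hz
  refine lintegral_congr_ae ?_
  filter_upwards [ae_forestMatrix_nonneg ρ G n z] with W hW
  have hc0 : 0 ≤ colSum z W 0 := Finset.sum_nonneg fun j _ => hW.1 j 0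
  rw [densityRatio_eq]
  obtain ⟨q, hq⟩ : ∃ q : ℝ≥0, armRatio P (z 0).2.1 (z 0).1 = q :=
    ⟨_, (ENNReal.coe_toNNReal (ne_top_of_le_ne_top ENNReal.coe_ne_top hz)).symm⟩
  simp only [hq, ENNReal.coe_toReal]
  rw [← ENNReal.ofReal_coe_nnreal (p := q), ← ENNReal.ofReal_mul hc0, ← ENNReal.ofReal_pow (NNReal.coe_nonneg q),
    show (2 : ℝ≥0∞) = ENNReal.ofReal 2 by simp, ← ENNReal.ofReal_mul (by norm_num),
    ← ENNReal.ofReal_add (sq_nonneg _) (by positivity), ← ENNReal.ofReal_add (sq_nonneg _)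
      (sq_nonneg _)]
  congr 1
  ring

/-- With error E and cross term X, the expansion gives E + 2X ≤ 2V + ε', while V ≤ X + ε'. So E + 2X
≤ 2X + 3ε', and 2X is finite and may be cancelled. -/
theorem densityModelCondition_forestMatrix (hd : 0 < d) (hP : BasicAssumption P)
    (hG : ForestDRAssumption P ρ G) : DensityModelCondition P (forestMatrix G ρ) := by
  unfold DensityModelCondition
  rw [ENNReal.tendsto_nhds_zero]
  intro ε hε
  obtain ⟨ε', hε'0, hε'⟩ : ∃ ε' : ℝ≥0, 0 < ε' ∧ 3 * (ε' : ℝ≥0∞) ≤ ε := by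
    obtain ⟨e, he, hle⟩ := ENNReal.lt_iff_exists_nnreal_btwn.1 hε
    refine ⟨e / 3, div_pos (by exact_mod_cast he) (by norm_num), ?_⟩
    have : 3 * (e / 3) = e := by field_simp
    rw [← this] at hle
    exact_mod_cast hle.le
  filter_upwards [eventually_expect_sq_colSum_le ρ P G hd hP hG hε'0,
    eventually_le_expect_cross ρ P G hP hG hε'0] with n h1 h2
  set V := ∑ ω : Bool, ∫⁻ x, armRatio P ω x ^ 2 ∂covSubLaw P ω with hV
  have hVt : V ≠ ∞ := by
    rw [hV]
    exact ENNReal.sum_ne_top.2 fun ω _ => lintegral_sq_armRatio_ne_top P hP ω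
  have h := expect_sq_error_add ρ P G hP n
  rw [← hV] at h
  set X := expect P (forestMatrix G ρ) n (fun z W => ENNReal.ofReal (colSum z W 0) *
        armRatio P (z 0).2.1 (z 0).1)
  set E := expect P (forestMatrix G ρ) n (fun z W =>
      ENNReal.ofReal ((colSum z W 0 - densityRatio P (z 0).1 (z 0).2.1) ^ 2))
  have hle : E + 2 * X ≤ 3 * ε' + 2 * X := by
    rw [h]
    calc _ ≤ V + ε' + V := by gcongr
      _ ≤ X + ε' + ε' + (X + ε') := by gcongr
      _ = _ := by ring
  have hXt : 2 * X ≠ ∞ := by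
    refine ne_top_of_le_ne_top ?_ (h ▸ le_add_self : 2 * X ≤ _)
    exact ENNReal.add_ne_top.2 ⟨ne_top_of_le_ne_top (by simp [hVt]) h1, hVt⟩
  exact (ENNReal.le_of_add_le_add_right hXt hle).trans hε'

end Conclusion

theorem theorem6 {d : ℕ} (hd : 0 < d)
    (P : Measure (FullData d)) [IsProbabilityMeasure P]
    {Ξ : Type*} [MeasurableSpace Ξ] (ρ : Measure Ξ) [IsProbabilityMeasure ρ]
    (G : ForestDesign d Ξ) (muHat : OutcomeEstimator d)
    (hP : BasicAssumption P) :
    -- the forest weights are random variables, nonnegative and normalized, and satisfy the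
    -- conditions on the weights
    ((∀ (n : ℕ+) (z : Fin n → ObsData d), IsProbabilityMeasure (forestMatrix G ρ n z) ∧
        ∀ᵐ W ∂(forestMatrix G ρ n z), (∀ i j, 0 ≤ W i j) ∧
          ∀ i, (∃ j, (z j).2.1 = !(z i).2.1) → rowSum z W i = 1) ∧
      WeightAssumption P (forestMatrix G ρ) ∧
      ColSumBounded P (forestMatrix G ρ) ∧
      RowSumRate P (forestMatrix G ρ)) ∧
    (ForestDRAssumption P ρ G → G.Honest → DensityModelCondition P (forestMatrix G ρ)) ∧
    (G.Honest → OutcomeFree (forestMatrix G ρ)) ∧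
    (∀ (k : ℕ) (γ : ℕ → ℝ), 1 ≤ k →
      ForestDRAssumption P ρ G → G.Honest → ForestSEAssumption P ρ G muHat k γ →
        EfficiencyAssumption P (forestMatrix G ρ) muHat k γ) := by
  refine ⟨⟨fun n z => ⟨inferInstance, ae_forestMatrix_nonneg ρ G n z⟩,
    weightAssumption_forestMatrix ρ P G hP, colSumBounded_forestMatrix ρ P G,
    rowSumRate_forestMatrix ρ P G hP⟩,
    fun hG _ => densityModelCondition_forestMatrix ρ P G hd hP hG,
    outcomeFree_forestMatrix ρ G, fun k γ _ hG _ hSE => ⟨hSE.outcome, ⟨?_, ?_⟩,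
      rowSumRate_forestMatrix ρ P G hP⟩⟩
  · exact isLittleOPow_discrepancy ρ P G hP hG hSE.diam_top
  · exact fun ℓ h1 h2 => isLittleOPow_discrepancy ρ P G hP hG fun ω => hSE.diam_lower ω ℓ h1 h2
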